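/- **Lemma 2.1 (local structure of special singularities).** Let $\mathbb L^3=(\mathbb R^3,\;dx_1^2+dx_2^2-dx_3^2)$. Let $\mathcal D$ be an open disc, $q\in\mathcal D$, and let $X:\mathcal D\to\mathbb L^3$ be continuous and a maximal immersion (smooth, spacelike, with zero mean curvature) on $\mathcal D\setminus\{q\}$. Suppose that $q$ is a special singularity: for some $0<r<1$ there is a continuous map $h:\{r<|z|\le 1\}\to\mathcal D$ with $h(\{|z|=1\})=\{q\}$, which restricts to a smooth bijection from $\{r<|z|<1\}$ onto $\mathcal D\setminus\{q\}$ that is conformal for the metric induced by $X$. Write again $X$ for the reparameterized map $X\circ h$ on $\{r<|z|\le1\}$, put $P_0=X(q)=X(\{|z|=1\})$, and let $\Pi$ be a spacelike plane containing $P_0$, with Lorentzian orthogonal projection $\pi:\mathbb L^3\to\Pi$. Extend $X$ to $C=\{r<|z|<1/r\}$ by $X(1/\bar z)=2P_0-X(z)$. The extended map has a Weierstrass representation $(g,\phi_3)$ on $C$: there are holomorphic $1$-forms $\phi_1,\phi_2,\phi_3$ and a meromorphic function $g$ on $C$ with $dX=\operatorname{Re}(\phi_1,\phi_2,\phi_3)$,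 $\phi_1=\frac i2\phi_3(\frac1g-g)$ and $\phi_2=-\frac12\phi_3(\frac1g+g)$. For these data, $g$ maps $\{|z|=1\}$ to itself. Let $m\ge 0$ be the absolute value of the topological degree of $g:\{|z|=1\}\to\{|z|=1\}$. The number of zeros of $\phi_3$ on $\{|z|=1\}$, counted with multiplicity, is even; denote it by $2k$. Then: 1. For every sufficiently small closed disc $U\subset\Pi$ centred at $P_0$ (a disc for the metric induced on $\Pi$), if $V$ is the connected component of $(\pi\circ X)^{-1}(U)\subset\{r<|z|\le1\}$ that contains $\{|z|=1\}$, then $$\pi\circ X:\;V\setminus\{|z|=1\}\to U\setminus\{P_0\}$$ is a covering map with exactly $m+k$ sheets. 2. There is $r_0\in[r,1)$ such that $X:\{r_0<|z|<1\}\to\mathbb L^3$ is an embedding if and only if $g$ is injective on $\{|z|=1\}$ and $\phi_3$ has no zero on $\{|z|=1\}$; and the latter holds if and only if $m=1$ and $k=0$. 3. If $m=1$ and $k=0$, then there is $r_0\in[r,1)$ such that $X:\{r_0<|z|<1\}\to\mathbb L^3$ is an embedding and $X(\{r_0<|z|\le1\})$ is the graph over $\Pi$ of a continuous function $u$ on an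 open neighbourhood $\Omega$ of $P_0$ in $\Pi$: for one of the two unit normals $\nu$ of $\Pi$ ($\langle\nu,\nu\rangle=-1$), $X(\{r_0<|z|\le1\})=\{p+u(p)\nu: p\in\Omega\}$. Moreover $u\ge 0$, so that the graph lies in one of the closed halfspaces bounded by $\Pi$, and the graph is asymptotic at $P_0$, in the $C^1$ sense, to the half light cone with vertex $P_0$ in that halfspace: with $c(p)=\sqrt{\langle p-P_0,p-P_0\rangle}$ on $\Pi$, one has $u(p)/c(p)\to1$ as $p\to P_0$, $u$ is differentiable at all $p\neq P_0$ close to $P_0$, and $du_p-dc_p\to0$ as $p\to P_0$. (Then $P_0$ is called a conelike singularity.) -/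

import Mathlib

open Set Filter Topology Metric
open scoped ContDiff

noncomputable section

/-! ### Lorentz-Minkowski space -/

/-- The underlying vector space of the three-dimensional Lorentz-Minkowski space. -/
abbrev L3 : Type := Fin 3 → ℝ

/-- The Lorentzian inner product `dx₁² + dx₂² - dx₃²`. -/
def lorentz : LinearMap.BilinForm ℝ L3 :=
  LinearMap.mk₂ ℝ (fun x y => x 0 * y 0 + x 1 * y 1 - x 2 * y 2)
    (by intros; simp; ring) (by intros; simp; ring) (by intros; simp; ring)
    (by intros; simp; ring)

theorem lorentz_apply (x y : L3) : lorentz x y = x 0 * y 0 + x 1 * y 1 - x 2 * y 2 := rfl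

theorem lorentz_isRefl : lorentz.IsRefl := by
  intro x y h
  rw [lorentz_apply] at h ⊢
  linarith

/-- An affine plane of `L3` on which the induced metric is Riemannian. -/
structure IsSpacelikePlane (P : AffineSubspace ℝ L3) : Prop where
  nonempty : (P : Set L3).Nonempty
  finrank_eq : Module.finrank ℝ P.direction = 2
  posDef : ∀ v ∈ P.direction, v ≠ 0 → 0 < lorentz v v

/-- The direction of a spacelike plane is complementary to its Lorentz-orthogonal line. -/
theorem IsSpacelikePlane.isCompl {P : AffineSubspace ℝ L3} (hP : IsSpacelikePlane P) :
    IsCompl P.direction (lorentz.orthogonal P.direction) := by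
  apply LinearMap.BilinForm.isCompl_orthogonal_of_restrict_nondegenerate lorentz_isRefl
  constructor
  · rintro ⟨x, hx⟩ h
    by_contra hne
    have h1 := hP.posDef x hx (fun h0 => hne (Subtype.ext h0))
    have h2 : lorentz x x = 0 := h ⟨x, hx⟩
    linarith
  · rintro ⟨x, hx⟩ h
    by_contra hne
    have h1 := hP.posDef x hx (fun h0 => hne (Subtype.ext h0))
    have h2 : lorentz x x = 0 := h ⟨x, hx⟩
    linarith

/-- The Lorentzian orthogonal projection onto the spacelike plane `P`, where `p₀` is a point
of `P`: the displacement from `p₀` is projected to the direction of `P` along the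
Lorentz-orthogonal complement of that direction. -/
def lorentzProj (P : AffineSubspace ℝ L3) (hP : IsSpacelikePlane P) (p₀ : L3) (p : L3) : L3 :=
  p₀ + (Submodule.projectionOnto P.direction (lorentz.orthogonal P.direction) hP.isCompl
    (p - p₀) : L3)

/-- The closed disc of radius `s` centred at `p₀` in the plane `P`, for the induced metric. -/
def planeDisc (P : AffineSubspace ℝ L3) (p₀ : L3) (s : ℝ) : Set L3 :=
  {p | p ∈ P ∧ lorentz (p - p₀) (p - p₀) ≤ s ^ 2}

/-! ### Maximal immersions -/

/-- The metric induced by `X` at `p`, evaluated on the tangent vectors `u` and `v`. -/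
def inducedMetric (X : ℂ → L3) (p u v : ℂ) : ℝ :=
  lorentz (fderiv ℝ X p u) (fderiv ℝ X p v)

/-- `X` is a maximal immersion on the open set `S` of the real plane `ℂ`: it is smooth, the
induced metric is positive definite (so that `X` is a spacelike immersion), and the mean curvature
vanishes: the trace of the second fundamental form `(u, v) ↦ ⟨D²X(u, v), n⟩` with respect to the
induced metric, computed in orthonormal tangent frames, is zero for every normal vector `n`. -/
structure IsMaximalImmersionOn (X : ℂ → L3) (S : Set ℂ) : Prop where
  smooth : ContDiffOn ℝ ∞ X S
  spacelike : ∀ p ∈ S, ∀ v : ℂ, v ≠ 0 → 0 < inducedMetric X p v v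
  meanCurvature_eq_zero : ∀ p ∈ S, ∀ n : L3, (∀ v : ℂ, lorentz (fderiv ℝ X p v) n = 0) →
    ∀ u v : ℂ, inducedMetric X p u u = 1 → inducedMetric X p v v = 1 → inducedMetric X p u v = 0 →
      lorentz (fderiv ℝ (fderiv ℝ X) p u u + fderiv ℝ (fderiv ℝ X) p v v) n = 0

/-- The open annulus `a < |z| < b`. -/
def openAnnulus (a b : ℝ) : Set ℂ := {z | a < ‖z‖ ∧ ‖z‖ < b}

/-- The half-closed annulus `a < |z| ≤ 1`. -/
def outerClosedAnnulus (a : ℝ) : Set ℂ := {z | a < ‖z‖ ∧ ‖z‖ ≤ 1}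

/-- `h` is a conformal reparameterization of `D ∖ {q}`, with the metric induced by `X`, by the
annulus `r < |z| < 1`, where the circle `|z| = 1` corresponds to the point `q`. -/
structure IsConformalReparam (X : ℂ → L3) (D : Set ℂ) (q : ℂ) (r : ℝ) (h : ℂ → ℂ) : Prop where
  continuousOn : ContinuousOn h (outerClosedAnnulus r)
  circle : ∀ z : ℂ, ‖z‖ = 1 → h z = q
  smooth : ContDiffOn ℝ ∞ h (openAnnulus r 1)
  bijOn : BijOn h (openAnnulus r 1) (D \ {q})
  pos : ∀ z ∈ openAnnulus r 1, 0 < inducedMetric (X ∘ h) z 1 1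
  isometric : ∀ z ∈ openAnnulus r 1,
    inducedMetric (X ∘ h) z 1 1 = inducedMetric (X ∘ h) z Complex.I Complex.I
  orthogonal : ∀ z ∈ openAnnulus r 1, inducedMetric (X ∘ h) z 1 Complex.I = 0

/-- `X : D → L3` is a maximal immersion of the open set `D` with a special singularity at `q`, and
`h` is a conformal reparameterization of it by the annulus `r < |z| ≤ 1`. -/
structure IsSpecialSingularity (X : ℂ → L3) (D : Set ℂ) (q : ℂ) (r : ℝ) (h : ℂ → ℂ) : Prop where
  mem : q ∈ D
  continuousOn : ContinuousOn X D
  maximal : IsMaximalImmersionOn X (D \ {q})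
  r_pos : 0 < r
  r_lt_one : r < 1
  reparam : IsConformalReparam X D q r h

/-! ### Weierstrass data of the immersion extended by reflection -/

/-- The extension of `Y : {r < |z| ≤ 1} → L3` to `{r < |z| < 1 / r}` by
`Y ∘ J = -Y + 2 p₀`, where `J z = 1 / conj z`. -/
def schwarzExtension (Y : ℂ → L3) (p₀ : L3) (z : ℂ) : L3 :=
  if ‖z‖ ≤ 1 then Y z else (2 : ℝ) • p₀ - Y (1 / (starRingEnd ℂ) z)

/-- `(g, φ₁ dz, φ₂ dz, φ₃ dz)` is the Weierstrass representation on `{r < |z| < 1 / r}` of the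
extension by reflection of `Y : {r < |z| ≤ 1} → L3`, `Y = p₀` on the unit circle (here `φⱼ` is
`φ (j - 1)`): the `φⱼ` are holomorphic, `dYⱼ = Re (φⱼ dz)`, and `g` is meromorphic (in normal form,
so that it takes its analytic values away from its poles) with `φ₁ = (i/2) φ₃ (1/g - g)` and
`φ₂ = -(1/2) φ₃ (1/g + g)` away from a discrete set. -/
structure IsWeierstrassData (Y : ℂ → L3) (p₀ : L3) (r : ℝ) (g : ℂ → ℂ) (φ : Fin 3 → ℂ → ℂ) :
    Prop where
  holomorphic : ∀ j, DifferentiableOn ℂ (φ j) (openAnnulus r (1 / r))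
  hasFDerivAt : ∀ j, ∀ z ∈ openAnnulus r (1 / r),
    HasFDerivAt (fun w => schwarzExtension Y p₀ w j)
      (Complex.reCLM.comp (φ j z • ContinuousLinearMap.id ℝ ℂ)) z
  meromorphic : MeromorphicNFOn g (openAnnulus r (1 / r))
  relations : ∀ᶠ z in codiscreteWithin (openAnnulus r (1 / r)), g z ≠ 0 ∧
    φ 0 z = Complex.I / 2 * φ 2 z * (1 / g z - g z) ∧
    φ 1 z = -(1 / 2) * φ 2 z * (1 / g z + g z)

/-- `g` maps the unit circle to itself with (signed) topological degree `d`. -/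
def HasCircleDegree (g : ℂ → ℂ) (d : ℤ) : Prop :=
  ∃ θ : ℝ → ℝ, Continuous θ ∧
    (∀ t : ℝ, g (Complex.exp (t * Complex.I)) = Complex.exp (θ t * Complex.I)) ∧
    ∀ t : ℝ, θ (t + 2 * Real.pi) = θ t + 2 * Real.pi * d

/-- The number of zeros, counted with multiplicity, of `f` on the unit circle. -/
def circleZeroCount (f : ℂ → ℂ) : ℕ := ∑ᶠ z ∈ sphere (0 : ℂ) 1, analyticOrderNatAt f z

/-! ### Coverings, graphs, asymptotics -/

/-- `f` restricts to a covering map from `S` to `T` with exactly `N` sheets. -/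
def IsCoveringOfDegree (f : ℂ → L3) (S : Set ℂ) (T : Set L3) (N : ℕ) : Prop :=
  ∃ hf : MapsTo f S T, IsCoveringMap (hf.restrict f S T) ∧
    ∀ y : T, ((hf.restrict f S T) ⁻¹' {y}).encard = N

/-- `ν` is a Lorentz-unit normal vector to the plane `P` (hence timelike if `P` is spacelike). -/
def IsUnitNormal (P : AffineSubspace ℝ L3) (ν : L3) : Prop :=
  (∀ v ∈ P.direction, lorentz ν v = 0) ∧ lorentz ν ν = -1

/-- The height function, over the spacelike linear plane `W`, of the upper half light cone with
vertex at the origin. -/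
def coneHeight (W : Submodule ℝ L3) (w : W) : ℝ := Real.sqrt (lorentz (w : L3) (w : L3))

/-- The graph of `u` over the spacelike linear plane `W` is asymptotic, in the `C¹` sense, to the
upper half light cone at the origin. -/
def IsAsymptoticToHalfCone (W : Submodule ℝ L3) (u : W → ℝ) : Prop :=
  Tendsto (fun w => u w / coneHeight W w) (𝓝[≠] 0) (𝓝 1) ∧
  (∀ᶠ w in 𝓝[≠] (0 : W), DifferentiableAt ℝ u w) ∧
  Tendsto (fun w => fderiv ℝ u w - fderiv ℝ (coneHeight W) w) (𝓝[≠] 0) (𝓝 0)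

/-- The set `S` is the graph over the plane `P` of a continuous function defined on an open
neighbourhood of `p₀` in `P`, it lies in the closed halfspace bounded by `P` to which one of the
two unit normals `ν` of `P` points, and it is asymptotic at `p₀` to the half light cone with vertex
`p₀` in that halfspace. -/
def IsConelikeGraph (P : AffineSubspace ℝ L3) (p₀ : L3) (S : Set L3) : Prop :=
  ∃ ν : L3, IsUnitNormal P ν ∧ ∃ (Ω : Set P.direction) (u : P.direction → ℝ),
    IsOpen Ω ∧ 0 ∈ Ω ∧ ContinuousOn u Ω ∧
    S = (fun w : P.direction => p₀ + (w : L3) + u w • ν) '' Ω ∧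
    (∀ w ∈ Ω, 0 ≤ u w) ∧
    IsAsymptoticToHalfCone P.direction u

end

/-!
The immersion is conformal with zero mean curvature, hence harmonic, and constant on the unit circle.
By the reflection principle (`harmonicOnNhd_of_odd`, proved with the Poisson integral) its odd
extension is harmonic, so its coordinates have holomorphic differentials, which form a null triple;
this gives the Weierstrass data (`exists_isWeierstrassData`).

Pulled back by the exponential map, the data become periodic functions `A = Φ₁ + σΦ₂`,
`B = Φ₁ - σΦ₂`, `C = Φ₃` on a strip around the imaginary axis, with `A B = C²` and
`A (-conj w) = conj (B w)`. The surface is spacelike on the left of the axis, so `|A| ≠ |B|` there, and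
the sign `σ = ±i` is chosen such that `|A| < |B|` (`IsNullData`). The orthogonal projection to any
spacelike plane, in complex coordinates, is a map `f` with `df = (a dw + conj (b dw)) / 2`, where `a` is
the pairing of the data with a null vector and `b` is conjugate to the reflection of `a`. For null
vectors the sign of `|a| - |b|` does not depend on the plane (`norm_nullPairing_sub`): with the right
orientation of the plane `|a| < |b|` on the left, so `f` reverses the orientation there.

As `f` vanishes on the axis, `f (-x + it)` is minus one half of the integral of `a` over the segment
from `-x + it` to `x + it`. Since `|a|` is smaller on the left of the axis than at the reflected
points, such integrals do not vanish for small `x`, even next to a zero of `a` on the axis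
(`exists_integral_ne_zero`). Hence `f` has no zeros near the circle, and shrinking the segment to its
right end is a homotopy, so the winding number of `f` is that of `a` on the right of the axis
(`hasWinding_integral`). The deformation `(A, s² B, s C)` of the data shows that it is also that of
`A`, whatever the plane (`hasWinding_nullPairing`). Now `A` is `Φ₃` times the Gauss map `g` (or `1 / g`),
up to a constant. By Hopf's lemma the Gauss map turns strictly monotonically along the circle
(`exists_strictMono_angle`), so it contributes `m ≥ 1`, and it is injective there exactly if `m = 1`. As
`Φ₃` is symmetric under the reflection, it has an even number `2k` of zeros on the circle and
contributes `k` (`exists_circleZeroCount_eq_two_mul`). In total the winding number is `m + k`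
(`exists_nullData`).

By the argument principle for maps whose zeros are nondegenerate, `f` takes every small nonzero value
`m + k` times near the circle (`IsPlanarBranch.encard_preimage`), and a local homeomorphism with
finite fibres of constant cardinality is a covering. If the surface is embedded, the height over the
plane separates the points of a fibre; the points of greatest height in their fibres then form an
open and closed subset of a connected collar, so there is one sheet only (`le_one_of_separates`).
Conversely, with one sheet the height is a function on the plane. On the circle the null relation makes
the derivatives of height and planar projection equal in size, and comparing the normal derivatives
there gives the asymptotics of the height and of its gradient (`exists_forall_asymptotic`).
-/


noncomputable section

/-! ### Winding numbers of closed curves in the punctured plane -/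

/-- The `2π`-periodic curve `c` in `ℂ ∖ {0}` has winding number `n` around the origin: it has a
continuous logarithm that grows by `2πin` over a period. -/
def HasWinding (c : ℝ → ℂ) (n : ℤ) : Prop :=
  ∃ ℓ : ℝ → ℂ, Continuous ℓ ∧ (∀ t, Complex.exp (ℓ t) = c t) ∧
    ∀ t, ℓ (t + 2 * Real.pi) = ℓ t + 2 * Real.pi * n * Complex.I

/-- A continuous function on a connected space with values in `2πiℤ` is constant. -/
theorem eq_of_exp_eq_one {α : Type*} [TopologicalSpace α] [PreconnectedSpace α] {ℓ : α → ℂ}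
    (hℓ : Continuous ℓ) (h : ∀ t, Complex.exp (ℓ t) = 1) (s t : α) : ℓ s = ℓ t := by
  have key := (Complex.isCoveringMapOn_exp.isCoveringMap_restrictPreimage).const_of_comp
    (g := fun t : α => (⟨ℓ t, by simp⟩ : Complex.exp ⁻¹' {0}ᶜ))
    (by fun_prop) (fun s t => by
      apply Subtype.ext
      simp [Set.restrictPreimage, h])
  have := key s t
  simpa using congrArg Subtype.val this

theorem HasWinding.unique {c : ℝ → ℂ} {n m : ℤ} (h : HasWinding c n) (h' : HasWinding c m) :
    n = m := by
  obtain ⟨ℓ, h1, h2, h3⟩ := h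
  obtain ⟨ℓ', h1', h2', h3'⟩ := h'
  have key := eq_of_exp_eq_one (h1.sub h1') (fun t => by
    simp only [Pi.sub_apply]
    rw [Complex.exp_sub, h2, h2', div_self]
    rw [← h2]; exact Complex.exp_ne_zero _) (0 + 2 * Real.pi) 0
  simp only [Pi.sub_apply, h3, h3'] at key
  have h4 : (2 * Real.pi * Complex.I : ℂ) * (n - m) = 0 := by linear_combination key
  rcases mul_eq_zero.1 h4 with h5 | h5
  · exact absurd h5 Complex.two_pi_I_ne_zero
  · exact_mod_cast sub_eq_zero.1 h5

theorem HasWinding.ne_zero {c : ℝ → ℂ} {n : ℤ} (h : HasWinding c n) (t : ℝ) : c t ≠ 0 := by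
  obtain ⟨ℓ, _, h2, _⟩ := h
  rw [← h2]; exact Complex.exp_ne_zero _

theorem HasWinding.mul {c c' : ℝ → ℂ} {n m : ℤ} (h : HasWinding c n) (h' : HasWinding c' m) :
    HasWinding (fun t => c t * c' t) (n + m) := by
  obtain ⟨ℓ, h1, h2, h3⟩ := h
  obtain ⟨ℓ', h1', h2', h3'⟩ := h'
  refine ⟨fun t => ℓ t + ℓ' t, h1.add h1', fun t => by rw [Complex.exp_add, h2, h2'], fun t => ?_⟩
  simp only [h3, h3']; push_cast; ring

theorem HasWinding.conj {c : ℝ → ℂ} {n : ℤ} (h : HasWinding c n) :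
    HasWinding (fun t => (starRingEnd ℂ) (c t)) (-n) := by
  obtain ⟨ℓ, h1, h2, h3⟩ := h
  refine ⟨fun t => (starRingEnd ℂ) (ℓ t), Complex.continuous_conj.comp h1,
    fun t => by rw [Complex.exp_conj, h2], fun t => ?_⟩
  simp [h3, map_ofNat]

theorem hasWinding_const {a : ℂ} (ha : a ≠ 0) : HasWinding (fun _ => a) 0 :=
  ⟨fun _ => Complex.log a, continuous_const, fun _ => Complex.exp_log ha, fun _ => by simp⟩

theorem hasWinding_exp : HasWinding (fun t => Complex.exp (t * Complex.I)) 1 :=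
  ⟨fun t => t * Complex.I, by fun_prop, fun _ => rfl, fun t => by push_cast; ring⟩

theorem HasWinding.prod {ι : Type*} {c : ι → ℝ → ℂ} {n : ι → ℤ} (s : Finset ι)
    (h : ∀ i ∈ s, HasWinding (c i) (n i)) :
    HasWinding (fun t => ∏ i ∈ s, c i t) (∑ i ∈ s, n i) := by
  classical
  induction s using Finset.induction_on with
  | empty => simpa using hasWinding_const one_ne_zero
  | insert a s ha ih =>
    simp only [Finset.prod_insert ha, Finset.sum_insert ha]
    exact (h a (by simp)).mul (ih fun i hi => h i (by simp [hi]))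

theorem HasWinding.pow {c : ℝ → ℂ} {n : ℤ} (h : HasWinding c n) (k : ℕ) :
    HasWinding (fun t => c t ^ k) (k * n) := by
  simpa using HasWinding.prod (Finset.range k) (c := fun _ => c) (n := fun _ => n) fun _ _ => h

/-- All curves of a homotopy of closed curves in `ℂ ∖ {0}` have the same winding number. -/
theorem exists_hasWinding_of_homotopy {H : ℝ → ℝ → ℂ}
    (hc : ContinuousOn (fun x : ℝ × ℝ => H x.1 x.2) (Icc 0 1 ×ˢ univ))
    (h0 : ∀ s ∈ Icc (0 : ℝ) 1, ∀ t, H s t ≠ 0)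
    (hp : ∀ s ∈ Icc (0 : ℝ) 1, ∀ t, H s (t + 2 * Real.pi) = H s t) :
    ∃ n : ℤ, ∀ s ∈ Icc (0 : ℝ) 1, HasWinding (H s) n := by
  let P : ℝ → ℝ := fun s => (projIcc 0 1 zero_le_one s : ℝ)
  have hP : ∀ s, P s ∈ Icc (0 : ℝ) 1 := fun s => (projIcc 0 1 zero_le_one s).2
  have hPs : ∀ s ∈ Icc (0 : ℝ) 1, P s = s := fun s hs => by
    simp only [P]; rw [projIcc_of_mem zero_le_one hs]
  let f : C(ℝ × ℝ, ℂ) := ⟨fun x => H (P x.1) x.2, by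
    refine hc.comp_continuous (f := fun x : ℝ × ℝ => (P x.1, x.2)) ?_ fun x => ⟨hP _, trivial⟩
    have : Continuous P := continuous_subtype_val.comp continuous_projIcc
    fun_prop⟩
  obtain ⟨F, ⟨-, hF⟩, -⟩ := Complex.isCoveringMapOn_exp.existsUnique_continuousMap_lifts f
    (a₀ := 0) (e₀ := Complex.log (f 0)) (Complex.exp_log (h0 _ (hP _) _))
    (fun x => h0 _ (hP _) _)
  have hF' : ∀ s t, Complex.exp (F (s, t)) = H (P s) t := fun s t => congrFun hF (s, t)
  have hper : ∀ s t, Complex.exp (F (s, t + 2 * Real.pi) - F (s, t)) = 1 := fun s t => by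
    rw [Complex.exp_sub, hF', hF', hp _ (hP s), div_self (h0 _ (hP s) _)]
  obtain ⟨n, hn⟩ := Complex.exp_eq_one_iff.1 (hper 0 0)
  refine ⟨n, fun s hs => ⟨fun t => F (s, t), by fun_prop, fun t => by rw [hF', hPs s hs],
    fun t => ?_⟩⟩
  have := eq_of_exp_eq_one (α := ℝ × ℝ) (ℓ := fun x => F (x.1, x.2 + 2 * Real.pi) - F (x.1, x.2))
    (by fun_prop) (fun x => hper _ _) (s, t) (0, 0)
  simp only [hn] at this
  linear_combination this

theorem exists_hasWinding {c : ℝ → ℂ} (hc : Continuous c) (h0 : ∀ t, c t ≠ 0)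
    (hp : ∀ t, c (t + 2 * Real.pi) = c t) : ∃ n : ℤ, HasWinding c n := by
  obtain ⟨n, hn⟩ := exists_hasWinding_of_homotopy (H := fun _ => c)
    (hc.comp continuous_snd).continuousOn (fun _ _ => h0) (fun _ _ => hp)
  exact ⟨n, hn 0 (by simp)⟩

theorem HasWinding.of_homotopy {H : ℝ → ℝ → ℂ} {n : ℤ}
    (hc : ContinuousOn (fun x : ℝ × ℝ => H x.1 x.2) (Icc 0 1 ×ˢ univ))
    (h0 : ∀ s ∈ Icc (0 : ℝ) 1, ∀ t, H s t ≠ 0)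
    (hp : ∀ s ∈ Icc (0 : ℝ) 1, ∀ t, H s (t + 2 * Real.pi) = H s t)
    {s s' : ℝ} (hs : s ∈ Icc (0 : ℝ) 1) (hs' : s' ∈ Icc (0 : ℝ) 1)
    (h : HasWinding (H s) n) : HasWinding (H s') n := by
  obtain ⟨m, hm⟩ := exists_hasWinding_of_homotopy hc h0 hp
  rw [h.unique (hm s hs)]
  exact hm s' hs'

theorem HasWinding.continuous {c : ℝ → ℂ} {n : ℤ} (h : HasWinding c n) : Continuous c := by
  obtain ⟨ℓ, h1, h2, _⟩ := h
  rw [← (funext h2 : (fun t => Complex.exp (ℓ t)) = c)]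
  fun_prop

theorem HasWinding.periodic {c : ℝ → ℂ} {n : ℤ} (h : HasWinding c n) (t : ℝ) :
    c (t + 2 * Real.pi) = c t := by
  obtain ⟨ℓ, _, h2, h3⟩ := h
  rw [← h2, ← h2, h3, Complex.exp_add]
  have : Complex.exp (2 * Real.pi * n * Complex.I) = 1 := by
    rw [Complex.exp_eq_one_iff]; exact ⟨n, by ring⟩
  rw [this, mul_one]

/-- Rouché's theorem for winding numbers. -/
theorem HasWinding.of_norm_sub_lt {c c' : ℝ → ℂ} {n : ℤ} (h : HasWinding c n)
    (hc' : Continuous c') (hp : ∀ t, c' (t + 2 * Real.pi) = c' t)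
    (hlt : ∀ t, ‖c' t - c t‖ < ‖c t‖) : HasWinding c' n := by
  have hc := h.continuous
  have := HasWinding.of_homotopy (H := fun s t => c t + s * (c' t - c t)) (n := n) (s := 0)
    (s' := 1) (by fun_prop) (fun s hs t h0 => ?_) (fun s hs t => by rw [hp, h.periodic])
    (by simp) (by simp) (by simpa using h)
  · simpa using this
  · have h1 : ‖c t‖ = ‖(s : ℂ) * (c' t - c t)‖ :=
      (congrArg norm (eq_neg_of_add_eq_zero_left h0)).trans (norm_neg _)
    rw [norm_mul, Complex.norm_real, Real.norm_of_nonneg hs.1] at h1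
    nlinarith [hlt t, hs.2, norm_nonneg (c' t - c t)]

theorem hasWinding_circle_sub_of_lt {ρ : ℝ} {z₀ : ℂ} (h : ‖z₀‖ < ρ) :
    HasWinding (fun t => ρ * Complex.exp (t * Complex.I) - z₀) 1 := by
  have hρ : 0 < ρ := (norm_nonneg _).trans_lt h
  have h1 : HasWinding (fun t => (ρ : ℂ) * Complex.exp (t * Complex.I)) (0 + 1) :=
    (hasWinding_const (a := ρ) (by exact_mod_cast hρ.ne')).mul hasWinding_exp
  rw [zero_add] at h1
  refine h1.of_norm_sub_lt (by fun_prop) (fun t => ?_) (fun t => ?_)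
  · rw [h1.periodic]
  · simpa [Complex.norm_exp_ofReal_mul_I, abs_of_pos hρ] using h

theorem hasWinding_circle_sub_of_gt {ρ : ℝ} {z₀ : ℂ} (hρ : 0 < ρ) (h : ρ < ‖z₀‖) :
    HasWinding (fun t => ρ * Complex.exp (t * Complex.I) - z₀) 0 := by
  have h0 : -z₀ ≠ 0 := by
    rw [neg_ne_zero, ← norm_pos_iff]; linarith
  refine (hasWinding_const h0).of_norm_sub_lt (by fun_prop) (fun t => ?_) (fun t => ?_)
  · rw [hasWinding_exp.periodic]
  · simpa [Complex.norm_exp_ofReal_mul_I, abs_of_pos hρ] using h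

/-! ### The argument principle for maps with nondegenerate zeros -/

/-- Near its zero `z₀`, the map `F` is a perturbation of a multiplication `z ↦ β (z - z₀)`, with a
relative error bounded away from one. Sense-preserving local diffeomorphisms have this property. -/
def HasPosZero (F : ℂ → ℂ) (z₀ : ℂ) : Prop :=
  ∃ (β : ℂ) (κ : ℝ), κ < ‖β‖ ∧ ∀ᶠ z in 𝓝[≠] z₀, ‖F z / (z - z₀) - β‖ ≤ κ

theorem HasPosZero.div {F h : ℂ → ℂ} {z₀ : ℂ} (hF : HasPosZero F z₀) (hh : ContinuousAt h z₀)
    (h0 : h z₀ ≠ 0) {G : ℂ → ℂ} (hG : ∀ᶠ z in 𝓝 z₀, F z = h z * G z) : HasPosZero G z₀ := by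
  obtain ⟨β, κ, hκ, hev⟩ := hF
  have hpos : 0 < ‖h z₀‖ := norm_pos_iff.2 h0
  obtain ⟨M, hM1, hM2⟩ := exists_between (div_lt_div_of_pos_right hκ hpos)
  refine ⟨β / h z₀, M, by rwa [norm_div], ?_⟩
  have hlim : Tendsto (fun z => κ / ‖h z‖ + ‖β‖ * ‖(h z)⁻¹ - (h z₀)⁻¹‖) (𝓝 z₀)
      (𝓝 (κ / ‖h z₀‖ + ‖β‖ * ‖(h z₀)⁻¹ - (h z₀)⁻¹‖)) := by
    have : ContinuousAt (fun z => κ / ‖h z‖ + ‖β‖ * ‖(h z)⁻¹ - (h z₀)⁻¹‖) z₀ :=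
      (continuousAt_const.div hh.norm hpos.ne').add
        (continuousAt_const.mul ((hh.inv₀ h0).sub continuousAt_const).norm)
    exact this
  rw [sub_self, norm_zero, mul_zero, add_zero] at hlim
  filter_upwards [hev, nhdsWithin_le_nhds hG, nhdsWithin_le_nhds (hlim.eventually_lt_const hM1),
    nhdsWithin_le_nhds (hh.eventually_ne h0)] with z h1 h2 h3 h4
  refine le_trans ?_ h3.le
  have : G z / (z - z₀) - β / h z₀
      = (F z / (z - z₀) - β) / h z + β * ((h z)⁻¹ - (h z₀)⁻¹) := by
    rw [h2]; field_simp; ring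
  rw [this]
  refine (norm_add_le _ _).trans ?_
  rw [norm_div, norm_mul]
  gcongr

/-- A nondegenerate zero can be divided out continuously, after changing the quotient near the
zero only. -/
theorem exists_divided {F : ℂ → ℂ} {S V : Set ℂ} {z₀ : ℂ} (hF : ContinuousOn F S) (hz : z₀ ∈ S)
    (h0 : F z₀ = 0) (hlin : HasPosZero F z₀) (hV : V ∈ 𝓝 z₀) :
    ∃ G : ℂ → ℂ, ContinuousOn G S ∧ (∀ z, G z = 0 → z ≠ z₀ ∧ F z = 0) ∧
      ∀ z, z ∉ V → F z = (z - z₀) * G z := by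
  obtain ⟨β, κ, hκ, hev⟩ := hlin
  rw [eventually_nhdsWithin_iff] at hev
  obtain ⟨δ, hδ, hball⟩ := Metric.mem_nhds_iff.1 (inter_mem hV hev)
  let χ : ℂ → ℝ := fun z => min 1 (‖z - z₀‖ / δ)
  have hχc : Continuous χ := by fun_prop
  have hχ0 : ∀ z, 0 ≤ χ z := fun z => le_min zero_le_one (by positivity)
  have hχ1 : ∀ z, χ z ≤ 1 := fun z => min_le_left _ _
  have hχδ : ∀ z, z ∉ ball z₀ δ → χ z = 1 := fun z hz => by
    rw [mem_ball, dist_eq_norm, not_lt] at hz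
    exact min_eq_left ((one_le_div hδ).2 hz)
  refine ⟨fun z => (1 - χ z) * β + χ z * (F z / (z - z₀)), ?_, fun z hz0 => ?_, fun z hzV => ?_⟩
  · refine ContinuousOn.add (by fun_prop) fun z hz => ?_
    by_cases hzz : z = z₀
    · subst hzz
      have hlim : Tendsto (fun w => ‖F w‖ / δ) (𝓝[S] z) (𝓝 0) := by
        have := ((hF z hz).norm.div_const δ).tendsto
        simpa [h0] using this
      have : Tendsto (fun w => (χ w : ℂ) * (F w / (w - z))) (𝓝[S] z) (𝓝 0) := by
        refine squeeze_zero_norm (fun w => ?_) hlim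
        rw [norm_mul, norm_div, Complex.norm_real, Real.norm_of_nonneg (hχ0 w)]
        rcases eq_or_ne w z with rfl | hw
        · simp; positivity
        · have : 0 < ‖w - z‖ := norm_pos_iff.2 (sub_ne_zero.2 hw)
          calc χ w * (‖F w‖ / ‖w - z‖) ≤ ‖w - z‖ / δ * (‖F w‖ / ‖w - z‖) := by
                gcongr; exact min_le_right _ _
            _ = ‖F w‖ / δ := by field_simp
      simpa [ContinuousWithinAt] using this
    · refine ContinuousWithinAt.mul (by fun_prop) ((hF z hz).div (by fun_prop) ?_)
      exact sub_ne_zero.2 hzz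
  · beta_reduce at hz0
    by_cases hzb : z ∈ ball z₀ δ
    · exfalso
      rcases eq_or_ne z z₀ with rfl | hne
      · have hβ : β = 0 := by simpa [χ] using hz0
        have hκ' : κ < 0 := by simpa [hβ] using hκ
        have hnb : ∃ w ∈ ball z δ, w ≠ z := by
          refine ⟨z + (δ / 2 : ℝ), ?_, ?_⟩
          · simp [abs_of_pos hδ]; linarith
          · simp [hδ.ne']
        obtain ⟨w, hw, hwne⟩ := hnb
        have := (hball hw).2 hwne
        linarith [norm_nonneg (F w / (w - z) - β)]
      · have h1 : ‖F z / (z - z₀) - β‖ ≤ κ := (hball hzb).2 hne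
        have h2 : β = -(χ z * (F z / (z - z₀) - β)) := by linear_combination hz0
        have h3 : ‖β‖ = χ z * ‖F z / (z - z₀) - β‖ := by
          calc ‖β‖ = ‖-(χ z * (F z / (z - z₀) - β))‖ := congrArg norm h2
            _ = _ := by
              rw [norm_neg, norm_mul, Complex.norm_real, Real.norm_of_nonneg (hχ0 z)]
        nlinarith [hχ0 z, hχ1 z, norm_nonneg (F z / (z - z₀) - β)]
    · have hne : z ≠ z₀ := by rintro rfl; exact hzb (mem_ball_self hδ)
      refine ⟨hne, ?_⟩
      rw [hχδ z hzb] at hz0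
      have : F z / (z - z₀) = 0 := by simpa using hz0
      rcases div_eq_zero_iff.1 this with h | h
      · exact h
      · exact absurd (sub_eq_zero.1 h) hne
  · have hzb : z ∉ ball z₀ δ := fun h => hzV (hball h).1
    have hne : z - z₀ ≠ 0 := by
      rw [sub_ne_zero]; rintro rfl; exact hzb (mem_ball_self hδ)
    simp only [hχδ z hzb]
    push_cast
    field_simp
    ring

theorem exists_divided_finset {r₁ r₂ : ℝ} (Z : Finset ℂ) : ∀ F : ℂ → ℂ,
    ContinuousOn F {z | r₁ ≤ ‖z‖ ∧ ‖z‖ ≤ r₂} →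
    (∀ z, r₁ ≤ ‖z‖ → ‖z‖ ≤ r₂ → F z = 0 → z ∈ Z) →
    (∀ z ∈ Z, r₁ < ‖z‖ ∧ ‖z‖ < r₂ ∧ F z = 0 ∧ HasPosZero F z) →
    ∃ G : ℂ → ℂ, ContinuousOn G {z | r₁ ≤ ‖z‖ ∧ ‖z‖ ≤ r₂} ∧
      (∀ z, r₁ ≤ ‖z‖ → ‖z‖ ≤ r₂ → G z ≠ 0) ∧
      ∀ z, ‖z‖ = r₁ ∨ ‖z‖ = r₂ → F z = G z * ∏ x ∈ Z, (z - x) := by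
  classical
  induction Z using Finset.induction_on with
  | empty =>
    intro F hF hZ _
    exact ⟨F, hF, fun z h1 h2 h0 => by simpa using hZ z h1 h2 h0, fun z _ => by simp⟩
  | insert z₀ Z hz₀ ih =>
    intro F hF hZ hlin
    obtain ⟨h1, h2, h3, h4⟩ := hlin z₀ (by simp)
    have hopen : IsOpen ({z : ℂ | r₁ < ‖z‖ ∧ ‖z‖ < r₂} \ (Z : Set ℂ)) := by
      refine IsOpen.sdiff ?_ Z.finite_toSet.isClosed
      exact (isOpen_lt continuous_const continuous_norm).inter
        (isOpen_lt continuous_norm continuous_const)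
    obtain ⟨V, hV, hVc, hVs⟩ := exists_mem_nhds_isClosed_subset
      (hopen.mem_nhds ⟨⟨h1, h2⟩, by simpa using hz₀⟩)
    obtain ⟨G, hGc, hG0, hGV⟩ := exists_divided hF ⟨h1.le, h2.le⟩ h3 h4 hV
    have hne : ∀ z ∈ Z, z - z₀ ≠ 0 := fun z hz => by
      rw [sub_ne_zero]; rintro rfl; exact hz₀ hz
    obtain ⟨G', hc', h0', hb'⟩ := ih G hGc (fun z ha hb h0 => by
        obtain ⟨hz1, hz2⟩ := hG0 z h0
        exact (Finset.mem_insert.1 (hZ z ha hb hz2)).resolve_left hz1) (fun z hz => by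
        obtain ⟨ha, hb, hc, hd⟩ := hlin z (by simp [hz])
        have hzV : z ∉ V := fun h => (hVs h).2 hz
        refine ⟨ha, hb, ?_, ?_⟩
        · have := hGV z hzV
          rw [hc, eq_comm, mul_eq_zero] at this
          exact this.resolve_left (hne z hz)
        · refine hd.div (h := fun w => w - z₀) (by fun_prop) (hne z hz) ?_
          filter_upwards [hVc.isOpen_compl.mem_nhds hzV] with w hw
          exact hGV w hw)
    refine ⟨G', hc', h0', fun z hz => ?_⟩
    have hzV : z ∉ V := fun h => by
      have := (hVs h).1
      rcases hz with h | h <;> · rw [mem_ofPred_eq, h] at this; simp at this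
    rw [hGV z hzV, hb' z hz, Finset.prod_insert hz₀]
    ring

/-- **Argument principle**: the winding number increases, from the inner to the outer boundary
circle of an annulus, by the number of zeros in the annulus, if these are nondegenerate. -/
theorem hasWinding_annulus {r₁ r₂ : ℝ} (hr₁ : 0 < r₁) (hr : r₁ < r₂) (Z : Finset ℂ) {F : ℂ → ℂ}
    (hF : ContinuousOn F {z | r₁ ≤ ‖z‖ ∧ ‖z‖ ≤ r₂})
    (hZ : ∀ z, r₁ ≤ ‖z‖ → ‖z‖ ≤ r₂ → F z = 0 → z ∈ Z)
    (hlin : ∀ z ∈ Z, r₁ < ‖z‖ ∧ ‖z‖ < r₂ ∧ F z = 0 ∧ HasPosZero F z) {n₁ n₂ : ℤ}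
    (h₁ : HasWinding (fun t => F (r₁ * Complex.exp (t * Complex.I))) n₁)
    (h₂ : HasWinding (fun t => F (r₂ * Complex.exp (t * Complex.I))) n₂) :
    n₂ = n₁ + Z.card := by
  obtain ⟨G, hGc, hG0, hGb⟩ := exists_divided_finset Z F hF hZ hlin
  have hnorm : ∀ ρ t : ℝ, 0 < ρ → ‖(ρ : ℂ) * Complex.exp (t * Complex.I)‖ = ρ := fun ρ t hρ => by
    simp [Complex.norm_exp_ofReal_mul_I, abs_of_pos hρ]
  have hρ : ∀ s ∈ Icc (0 : ℝ) 1, r₁ ≤ r₁ + s * (r₂ - r₁) ∧ r₁ + s * (r₂ - r₁) ≤ r₂ := fun s hs =>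
    ⟨by nlinarith [hs.1], by nlinarith [hs.2]⟩
  obtain ⟨n, hn⟩ := exists_hasWinding_of_homotopy
    (H := fun s t => G ((r₁ + s * (r₂ - r₁) : ℝ) * Complex.exp (t * Complex.I)))
    (hGc.comp (by fun_prop) (fun x hx => by
      rw [mem_ofPred_eq, hnorm _ _ (hr₁.trans_le (hρ _ hx.1).1)]; exact hρ _ hx.1))
    (fun s hs t => hG0 _ (by rw [hnorm _ _ (hr₁.trans_le (hρ _ hs).1)]; exact (hρ _ hs).1)
      (by rw [hnorm _ _ (hr₁.trans_le (hρ _ hs).1)]; exact (hρ _ hs).2))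
    (fun s hs t => by rw [hasWinding_exp.periodic])
  have e1 := hn 0 (by simp)
  have e2 := hn 1 (by simp)
  have e1' := e1.mul (HasWinding.prod Z fun x hx =>
    hasWinding_circle_sub_of_gt hr₁ (hlin x hx).1)
  have e2' := e2.mul (HasWinding.prod Z fun x hx =>
    hasWinding_circle_sub_of_lt (hlin x hx).2.1)
  have k1 := h₁.unique (m := n + ∑ x ∈ Z, (0 : ℤ)) (by
    convert e1' using 2 with t
    rw [hGb _ (Or.inl (hnorm _ _ hr₁))]
    simp)
  have k2 := h₂.unique (m := n + ∑ x ∈ Z, (1 : ℤ)) (by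
    convert e2' using 2 with t
    rw [hGb _ (Or.inr (hnorm _ _ (hr₁.trans hr)))]
    simp)
  rw [k1, k2]; simp

/-! ### Boundary behaviour of holomorphic functions at the imaginary axis -/

/-- The reflection of the plane in the imaginary axis. Under the exponential map it corresponds to
the inversion `z ↦ 1 / conj z` in the unit circle. -/
def axisReflection (w : ℂ) : ℂ := -(starRingEnd ℂ) w

@[simp] theorem axisReflection_re (w : ℂ) : (axisReflection w).re = -w.re := by
  simp [axisReflection]

@[simp] theorem axisReflection_im (w : ℂ) : (axisReflection w).im = w.im := by
  simp [axisReflection]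

@[simp] theorem axisReflection_axisReflection (w : ℂ) :
    axisReflection (axisReflection w) = w := by
  simp [axisReflection]

theorem axisReflection_of_re_eq_zero {w : ℂ} (h : w.re = 0) : axisReflection w = w := by
  apply Complex.ext <;> simp [h]

@[fun_prop] theorem continuous_axisReflection : Continuous axisReflection :=
  Complex.continuous_conj.neg

theorem axisReflection_sub (w p : ℂ) :
    axisReflection w - axisReflection p = axisReflection (w - p) := by
  simp [axisReflection]; ring

theorem norm_axisReflection (w : ℂ) : ‖axisReflection w‖ = ‖w‖ := by simp [axisReflection]

theorem norm_axisReflection_sub {p : ℂ} (hp : p.re = 0) (w : ℂ) :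
    ‖axisReflection w - p‖ = ‖w - p‖ := by
  conv_lhs => rw [← axisReflection_of_re_eq_zero hp, axisReflection_sub, norm_axisReflection]

theorem HasDerivAt.conj_axisReflection {f : ℂ → ℂ} {f' w : ℂ}
    (h : HasDerivAt f f' (axisReflection w)) :
    HasDerivAt (fun v => (starRingEnd ℂ) (f (axisReflection v))) (-(starRingEnd ℂ) f') w := by
  have h1 : HasDerivAt (fun v => f (-v)) (-f') ((starRingEnd ℂ) w) := by
    simpa [Function.comp_def] using HasDerivAt.scomp ((starRingEnd ℂ) w) (g₁ := f) (h := fun v : ℂ => -v)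
      (h' := -1) (g₁' := f') h (hasDerivAt_neg _)
  have h2 := h1.conj_conj
  simpa [Function.comp_def, axisReflection] using h2

theorem AnalyticAt.conj_axisReflection {f : ℂ → ℂ} {w : ℂ}
    (h : AnalyticAt ℂ f (axisReflection w)) :
    AnalyticAt ℂ (fun v => (starRingEnd ℂ) (f (axisReflection v))) w := by
  rw [Complex.analyticAt_iff_eventually_differentiableAt] at h ⊢
  filter_upwards [(continuous_axisReflection.tendsto w).eventually h] with v hv
  exact hv.hasDerivAt.conj_axisReflection.differentiableAt

/-- A power `v ηⁿ` with `n ≥ 2` takes values with positive real part in the left half plane. -/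
theorem exists_pow_re_pos {v : ℂ} (hv : v ≠ 0) {n : ℕ} (hn : 2 ≤ n) :
    ∃ η : ℂ, η.re < 0 ∧ 0 < (η ^ n * v).re := by
  -- the directions `-exp (± 2πi / 3n)` and `-1`: the three values of the power sum to zero
  by_contra! hcon
  have hn' : (0 : ℝ) < n := by positivity
  let η : ℝ → ℂ := fun j => -Complex.exp ((j * (2 * Real.pi / (3 * n)) : ℝ) * Complex.I)
  have hη : ∀ j : ℝ, |j| ≤ 1 → (η j).re < 0 := fun j hj => by
    have hδ : |j * (2 * Real.pi / (3 * n))| ≤ Real.pi / 3 := by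
      rw [abs_mul, abs_of_nonneg (by positivity : 0 ≤ 2 * Real.pi / (3 * n))]
      have h2 : (2 : ℝ) ≤ n := by exact_mod_cast hn
      calc |j| * (2 * Real.pi / (3 * n)) ≤ 1 * (2 * Real.pi / (3 * 2)) := by gcongr
        _ = Real.pi / 3 := by ring
    simp only [η, Complex.neg_re, Complex.exp_ofReal_mul_I_re]
    have := Real.cos_pos_of_mem_Ioo (x := j * (2 * Real.pi / (3 * n)))
      ⟨by linarith [(abs_le.1 hδ).1, Real.pi_pos], by linarith [(abs_le.1 hδ).2, Real.pi_pos]⟩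
    linarith
  have hpow : ∀ j : ℝ, η j ^ n * v
      = Complex.exp ((j * (2 * Real.pi / 3) : ℝ) * Complex.I) * ((-1) ^ n * v) := fun j => by
    simp only [η]
    rw [neg_pow, ← Complex.exp_nat_mul]
    have : (n : ℂ) * (((j * (2 * Real.pi / (3 * n)) : ℝ) : ℂ) * Complex.I)
        = ((j * (2 * Real.pi / 3) : ℝ) : ℂ) * Complex.I := by
      have : (n : ℂ) ≠ 0 := by exact_mod_cast hn'.ne'
      push_cast; field_simp
    rw [this]; ring
  have h23c : Real.cos (2 * Real.pi / 3) = -1 / 2 := by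
    rw [show 2 * Real.pi / 3 = Real.pi - Real.pi / 3 by ring, Real.cos_pi_sub,
      Real.cos_pi_div_three]; ring
  have h23s : Real.sin (2 * Real.pi / 3) = √3 / 2 := by
    rw [show 2 * Real.pi / 3 = Real.pi - Real.pi / 3 by ring, Real.sin_pi_sub,
      Real.sin_pi_div_three]
  have h0 := hcon (η 0) (hη 0 (by simp))
  have h1 := hcon (η 1) (hη 1 (by simp))
  have h2 := hcon (η (-1)) (hη (-1) (by simp))
  rw [hpow] at h0 h1 h2
  set u := (-1) ^ n * v with hu
  have hu0 : u ≠ 0 := mul_ne_zero (pow_ne_zero _ (by norm_num)) hv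
  simp only [Complex.mul_re, Complex.exp_ofReal_mul_I_re, Complex.exp_ofReal_mul_I_im] at h0 h1 h2
  simp only [zero_mul, Real.cos_zero, Real.sin_zero, one_mul, neg_mul, Real.cos_neg,
    Real.sin_neg, h23c, h23s] at h0 h1 h2
  have h3 : 0 < √3 := by positivity
  have hre : u.re = 0 := by linarith
  have him : √3 * u.im = 0 := by rw [hre] at h1 h2; linarith
  exact hu0 (Complex.ext hre ((mul_eq_zero.1 him).resolve_left h3.ne'))

/-- **Hopf's lemma** for the modulus of a holomorphic function with a real logarithmic derivative
at a point of the imaginary axis, at which the modulus is larger than on the left. -/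
theorem logDeriv_re_pos_of_norm_lt {Q : ℂ → ℂ} {p : ℂ} (hQ : AnalyticAt ℂ Q p) (h0 : Q p ≠ 0)
    (hp : p.re = 0) (hlt : ∀ᶠ w in 𝓝 p, w.re < 0 → ‖Q w‖ < ‖Q p‖)
    (him : (deriv Q p / Q p).im = 0) : 0 < (deriv Q p / Q p).re := by
  have hre : ∀ᶠ w in 𝓝 p, w.re < 0 → (Q w / Q p - 1).re < 0 := by
    filter_upwards [hlt] with w hw hneg
    have h1 : ‖Q w / Q p‖ < 1 := by
      rw [norm_div, div_lt_one (norm_pos_iff.2 h0)]; exact hw hneg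
    have := (Complex.re_le_norm (Q w / Q p)).trans_lt h1
    simpa using this
  have hR : AnalyticAt ℂ (fun w => Q w / Q p - 1) p := (hQ.div_const).sub analyticAt_const
  have hleft : ∀ η : ℂ, η.re < 0 → Tendsto (fun ρ : ℝ => p + ρ * η) (𝓝[>] 0) (𝓝 p) := fun η _ => by
    have : Tendsto (fun ρ : ℝ => p + ρ * η) (𝓝 0) (𝓝 (p + (0 : ℝ) * η)) :=
      (by fun_prop : Continuous fun ρ : ℝ => p + ρ * η).tendsto 0
    simpa using this.mono_left nhdsWithin_le_nhds
  have hleft' : ∀ η : ℂ, η.re < 0 → ∀ ρ : ℝ, 0 < ρ → (p + ρ * η).re < 0 := fun η hη ρ hρ => by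
    simp [hp]; nlinarith
  have hnz : ¬ ∀ᶠ w in 𝓝 p, Q w / Q p - 1 = 0 := fun hev => by
    have h1 := (hleft (-1) (by simp)).eventually (hre.and hev)
    obtain ⟨ρ, ⟨h2, h3⟩, h4⟩ := (h1.and self_mem_nhdsWithin).exists
    have := h2 (hleft' (-1) (by simp) ρ h4)
    rw [h3] at this; simp at this
  obtain ⟨n, E, hE, hE0, hEq⟩ := hR.exists_eventuallyEq_pow_smul_nonzero_iff.2 hnz
  have hn0 : n ≠ 0 := by
    rintro rfl
    have := hEq.self_of_nhds
    simp [h0] at this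
    exact hE0 this.symm
  have hdir : ∀ η : ℂ, η.re < 0 → (η ^ n * E p).re ≤ 0 := fun η hη => by
    have h1 := (hleft η hη).eventually (hre.and hEq)
    have hlim : Tendsto (fun ρ : ℝ => (η ^ n * E (p + ρ * η)).re) (𝓝[>] 0)
        (𝓝 (η ^ n * E p).re) :=
      (Complex.continuous_re.tendsto _).comp
        (tendsto_const_nhds.mul (hE.continuousAt.tendsto.comp (hleft η hη)))
    refine le_of_tendsto hlim ?_
    filter_upwards [h1, self_mem_nhdsWithin] with ρ h2 h3
    have h4 := h2.1 (hleft' η hη ρ h3)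
    rw [h2.2, add_sub_cancel_left, smul_eq_mul, mul_pow, mul_assoc, ← Complex.ofReal_pow,
      Complex.re_ofReal_mul] at h4
    have h5 : (0 : ℝ) < ρ ^ n := pow_pos h3 n
    nlinarith
  rcases Nat.lt_or_ge n 2 with hn | hn
  · obtain rfl : n = 1 := by omega
    have hd : deriv Q p / Q p = E p := by
      have h1 : HasDerivAt (fun w => Q w / Q p - 1) (deriv Q p / Q p) p :=
        (hQ.differentiableAt.hasDerivAt.div_const _).sub_const _
      have h2 : HasDerivAt (fun w => (w - p) ^ 1 • E w) (E p) p := by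
        have := ((hasDerivAt_id p).sub_const p).mul hE.differentiableAt.hasDerivAt
        simpa [Pi.mul_def] using this
      exact h1.unique (h2.congr_of_eventuallyEq hEq)
    rw [hd] at him ⊢
    have h1 := hdir (-1) (by simp)
    simp at h1
    exact lt_of_le_of_ne h1 fun h => hE0 (Complex.ext h.symm him)
  · obtain ⟨η, h1, h2⟩ := exists_pow_re_pos hE0 hn
    exact absurd (hdir η h1) (not_le.2 h2)

/-- Hopf's lemma for a holomorphic function whose modulus on the left of the imaginary axis is
smaller than at the reflected points. -/
theorem logDeriv_re_pos_of_norm_lt_reflection {α : ℂ → ℂ} {p : ℂ} (hα : AnalyticAt ℂ α p)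
    (h0 : α p ≠ 0) (hp : p.re = 0)
    (hlt : ∀ᶠ w in 𝓝 p, w.re < 0 → ‖α w‖ < ‖α (axisReflection w)‖) :
    0 < (deriv α p / α p).re := by
  have hpr := axisReflection_of_re_eq_zero hp
  let β : ℂ → ℂ := fun w => (starRingEnd ℂ) (α (axisReflection w))
  have hα' : AnalyticAt ℂ α (axisReflection p) := by rwa [hpr]
  have hβ : AnalyticAt ℂ β p := hα'.conj_axisReflection
  have hβd : deriv β p = -(starRingEnd ℂ) (deriv α p) := by
    have := hα'.differentiableAt.hasDerivAt.conj_axisReflection.deriv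
    rwa [hpr] at this
  have hβp : β p = (starRingEnd ℂ) (α p) := by simp [β, hpr]
  have hβ0 : β p ≠ 0 := by rw [hβp]; simpa using h0
  have hQ : AnalyticAt ℂ (fun w => α w / β w) p := hα.div hβ hβ0
  have hc0 : (starRingEnd ℂ) (α p) ≠ 0 := by simpa using h0
  have hd : deriv (fun w => α w / β w) p / (α p / β p)
      = deriv α p / α p + (starRingEnd ℂ) (deriv α p / α p) := by
    have := (hα.differentiableAt.hasDerivAt.div hβ.differentiableAt.hasDerivAt hβ0).deriv
    rw [Pi.div_def] at this
    rw [this, hβd, hβp, map_div₀]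
    field_simp
    ring
  have key := logDeriv_re_pos_of_norm_lt hQ (div_ne_zero h0 hβ0) hp (by
    filter_upwards [hlt, hβ.continuousAt.eventually_ne hβ0] with w hw hw0 hneg
    have h1 : ‖α p / β p‖ = 1 := by
      rw [norm_div, hβp, RCLike.norm_conj, div_self (norm_ne_zero_iff.2 h0)]
    rw [h1, norm_div, div_lt_one (norm_pos_iff.2 hw0)]
    simpa [β] using hw hneg) (by rw [hd, Complex.add_im, Complex.conj_im, add_neg_cancel])
  rw [hd] at key
  simp only [Complex.add_re, Complex.conj_re] at key
  linarith

/-- If `G(p) = 0` and `G' = (w - p) ^ n α` with `Re (α' / α) > 0` at the point `p` of the imaginary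
axis, then, near `p` and along horizontal lines, `|G|` is larger at points that are not closer to
the axis and lie further to the right. -/
theorem exists_norm_lt_of_logDeriv_re_pos {G α : ℂ → ℂ} {p : ℂ} {n : ℕ} (hp : p.re = 0)
    (hG : ∀ᶠ w in 𝓝 p, HasDerivAt G ((w - p) ^ n * α w) w) (hG0 : G p = 0)
    (hα : AnalyticAt ℂ α p) (h0 : α p ≠ 0) (hpos : 0 < (deriv α p / α p).re) :
    ∃ δ > 0, ∀ x₁ x₂ t : ℝ, |x₁| ≤ x₂ → x₁ < x₂ → ‖(x₂ + t * Complex.I : ℂ) - p‖ < δ →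
      ‖G (x₁ + t * Complex.I)‖ < ‖G (x₂ + t * Complex.I)‖ := by
  have hGan : AnalyticAt ℂ G p := by
    rw [Complex.analyticAt_iff_eventually_differentiableAt]
    exact hG.mono fun w hw => hw.differentiableAt
  -- `G = (w - p) ^ (n + 1) E` with `E' / E = (n + 1) / (n + 2) * α' / α` at `p`
  have hord : analyticOrderAt G p = (n + 1 : ℕ) := by
    have h1 := hGan.analyticOrderAt_deriv_add_one
    have h2 : analyticOrderAt (deriv G) p = n := by
      rw [(hGan.deriv).analyticOrderAt_eq_natCast]
      refine ⟨α, hα, h0, ?_⟩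
      filter_upwards [hG] with w hw
      rw [hw.deriv, smul_eq_mul]
    rw [h2] at h1
    simp only [hG0, sub_zero] at h1
    rw [← h1]; norm_cast
  obtain ⟨E, hE, hE0, hGE⟩ := hGan.analyticOrderAt_eq_natCast.1 hord
  have hαE : ∀ᶠ w in 𝓝 p, α w = (n + 1) * E w + (w - p) * deriv E w := by
    have hne : ∀ᶠ w in 𝓝[≠] p, α w = (n + 1) * E w + (w - p) * deriv E w := by
      filter_upwards [nhdsWithin_le_nhds hG, nhdsWithin_le_nhds hGE.eventually_nhds,
        nhdsWithin_le_nhds hE.eventually_analyticAt, self_mem_nhdsWithin] with w h1 h2 h3 h4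
      have h5 : HasDerivAt (fun w => (w - p) ^ (n + 1) • E w)
          (((n + 1 : ℕ) : ℂ) * (w - p) ^ n * 1 * E w + (w - p) ^ (n + 1) * deriv E w) w :=
        (((hasDerivAt_id w).sub_const p).pow (n + 1)).mul h3.differentiableAt.hasDerivAt
      have h6 := h1.unique (h5.congr_of_eventuallyEq h2)
      have h7 : (w - p) ^ n ≠ 0 := pow_ne_zero _ (sub_ne_zero.2 h4)
      apply mul_left_cancel₀ h7
      rw [h6]; push_cast; ring
    have hc : AnalyticAt ℂ (fun w => (n + 1) * E w + (w - p) * deriv E w) p :=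
      (analyticAt_const.mul hE).add ((analyticAt_id.sub analyticAt_const).mul hE.deriv)
    exact (hα.frequently_eq_iff_eventually_eq hc).1 hne.frequently
  have hα0 : α p = (n + 1) * E p := by simpa using hαE.self_of_nhds
  have hα1 : deriv α p = (n + 2) * deriv E p := by
    have h1 : HasDerivAt (fun w => (n + 1) * E w + (w - p) * deriv E w)
        ((n + 1) * deriv E p + (1 * deriv E p + (p - p) * deriv (deriv E) p)) p :=
      (hE.differentiableAt.hasDerivAt.const_mul _).add
        (((hasDerivAt_id p).sub_const p).mul hE.deriv.differentiableAt.hasDerivAt)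
    rw [(h1.congr_of_eventuallyEq hαE).deriv]; ring
  have hEpos : 0 < (deriv E p * (starRingEnd ℂ) (E p)).re := by
    have h1 : deriv α p / α p
        = (((n + 2) / (n + 1) / Complex.normSq (E p) : ℝ) : ℂ)
          * (deriv E p * (starRingEnd ℂ) (E p)) := by
      have h2 : (n + 1 : ℂ) ≠ 0 := by exact_mod_cast Nat.succ_ne_zero n
      have h3 : (starRingEnd ℂ) (E p) ≠ 0 := by simpa using hE0
      rw [hα0, hα1]
      push_cast
      rw [← Complex.mul_conj]
      field_simp
    rw [h1, Complex.re_ofReal_mul] at hpos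
    exact pos_of_mul_pos_right hpos (by have := Complex.normSq_nonneg (E p); positivity)
  -- hence `|E|` increases along horizontal segments near `p`
  have hev : ∀ᶠ w in 𝓝 p, 0 < (deriv E w * (starRingEnd ℂ) (E w)).re ∧ AnalyticAt ℂ E w ∧
      G w = (w - p) ^ (n + 1) • E w := by
    have hc : ContinuousAt (fun w => (deriv E w * (starRingEnd ℂ) (E w)).re) p :=
      Complex.continuous_re.continuousAt.comp
        (hE.deriv.continuousAt.mul (Complex.continuous_conj.continuousAt.comp hE.continuousAt))
    exact (hc.eventually_const_lt hEpos).and (hE.eventually_analyticAt.and hGE)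
  obtain ⟨δ, hδ, hball⟩ := Metric.eventually_nhds_iff_ball.1 hev
  refine ⟨δ, hδ, fun x₁ x₂ t h1 h2 h3 => ?_⟩
  have hx2 : 0 < x₂ := by
    rcases (abs_nonneg x₁).trans h1 |>.lt_or_eq with h | h
    · exact h
    · rw [← h] at h1 h2; have := abs_nonpos_iff.1 h1; linarith
  have hnorm : ∀ x : ℝ, |x| ≤ x₂ →
      ‖(x + t * Complex.I : ℂ) - p‖ ≤ ‖(x₂ + t * Complex.I : ℂ) - p‖ := fun x hx => by
    rw [Complex.norm_def, Complex.norm_def]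
    apply Real.sqrt_le_sqrt
    simp only [Complex.normSq_apply, Complex.sub_re, Complex.sub_im, Complex.add_re,
      Complex.add_im, hp]
    simp
    nlinarith [sq_abs x, abs_nonneg x]
  have hmem : ∀ x ∈ Icc x₁ x₂, (x + t * Complex.I : ℂ) ∈ ball p δ := fun x hx => by
    rw [mem_ball, dist_eq_norm]
    refine (hnorm x (abs_le.2 ⟨?_, hx.2⟩)).trans_lt h3
    linarith [hx.1, (abs_le.1 h1).1]
  have hEd : ∀ x ∈ Icc x₁ x₂, HasDerivAt (fun y : ℝ => ‖E (y + t * Complex.I)‖ ^ 2)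
      (2 * (deriv E (x + t * Complex.I) * (starRingEnd ℂ) (E (x + t * Complex.I))).re) x := by
    intro x hx
    have h4 := (hball _ (hmem x hx)).2.1.differentiableAt.hasDerivAt
    have h5 : HasDerivAt (fun y : ℝ => E (y + t * Complex.I)) (deriv E (x + t * Complex.I)) x := by
      have h6 : HasDerivAt (fun y : ℂ => E (y + t * Complex.I)) (deriv E (x + t * Complex.I))
          (x : ℂ) := by
        simpa using HasDerivAt.comp_add_const (x : ℂ) (t * Complex.I) h4
      exact h6.comp_ofReal
    have h7 := h5.norm_sq
    convert h7 using 1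
    simp only [Complex.inner]
  have hmono : StrictMonoOn (fun y : ℝ => ‖E (y + t * Complex.I)‖ ^ 2) (Icc x₁ x₂) := by
    refine strictMonoOn_of_deriv_pos (convex_Icc _ _)
      (fun x hx => (hEd x hx).continuousAt.continuousWithinAt) fun x hx => ?_
    rw [interior_Icc] at hx
    have hx' := Ioo_subset_Icc_self hx
    rw [(hEd x hx').deriv]
    have := (hball _ (hmem x hx')).1
    linarith
  have hlt : ‖E (x₁ + t * Complex.I)‖ < ‖E (x₂ + t * Complex.I)‖ :=
    lt_of_pow_lt_pow_left₀ 2 (norm_nonneg _)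
      (hmono (left_mem_Icc.2 h2.le) (right_mem_Icc.2 h2.le) h2)
  rw [(hball _ (hmem x₁ (left_mem_Icc.2 h2.le))).2.2,
    (hball _ (hmem x₂ (right_mem_Icc.2 h2.le))).2.2, norm_smul, norm_smul, norm_pow, norm_pow]
  have hpos2 : 0 < ‖(x₂ + t * Complex.I : ℂ) - p‖ := by
    rw [norm_pos_iff]
    intro h
    have := congrArg Complex.re h
    simp [hp] at this
    exact hx2.ne' this
  calc ‖(x₁ + t * Complex.I : ℂ) - p‖ ^ (n + 1) * ‖E (x₁ + t * Complex.I)‖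
      ≤ ‖(x₂ + t * Complex.I : ℂ) - p‖ ^ (n + 1) * ‖E (x₁ + t * Complex.I)‖ := by
        gcongr; exact hnorm x₁ h1
    _ < ‖(x₂ + t * Complex.I : ℂ) - p‖ ^ (n + 1) * ‖E (x₂ + t * Complex.I)‖ := by
        gcongr

/-- If `|a|` is smaller on the left of the imaginary axis than at the reflected points, then
the integrals of `a` over short horizontal segments that cross the axis, or end to the right of it,
do not vanish. The point `p` may be a zero of `a`, of any order. -/
theorem exists_integral_ne_zero {a : ℂ → ℂ} {p : ℂ} (ha : AnalyticAt ℂ a p) (hp : p.re = 0)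
    (hlt : ∀ᶠ w in 𝓝 p, w.re < 0 → ‖a w‖ < ‖a (axisReflection w)‖) :
    ∃ δ > 0, ∀ x₁ x₂ t : ℝ, |x₁| ≤ x₂ → x₁ < x₂ → ‖(x₂ + t * Complex.I : ℂ) - p‖ < δ →
      ∫ x in x₁..x₂, a (x + t * Complex.I) ≠ 0 := by
  have hnz : ¬ ∀ᶠ w in 𝓝 p, a w = 0 := fun hev => by
    have hr : ∀ᶠ w in 𝓝 p, a (axisReflection w) = 0 := by
      have := continuous_axisReflection.tendsto p
      rw [axisReflection_of_re_eq_zero hp] at this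
      exact this.eventually hev
    have hl : Tendsto (fun ρ : ℝ => p - ρ) (𝓝[>] 0) (𝓝 p) := by
      have : Tendsto (fun ρ : ℝ => p - ρ) (𝓝 0) (𝓝 (p - (0 : ℝ))) :=
        (by fun_prop : Continuous fun ρ : ℝ => p - ρ).tendsto 0
      simpa using this.mono_left nhdsWithin_le_nhds
    obtain ⟨ρ, ⟨h1, h2, h3⟩, h4⟩ :=
      ((hl.eventually (hlt.and (hev.and hr))).and self_mem_nhdsWithin).exists
    have := h1 (by simpa [hp] using h4)
    rw [h2, h3] at this
    exact lt_irrefl _ this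
  obtain ⟨n, α, hα, hα0, haα⟩ := ha.exists_eventuallyEq_pow_smul_nonzero_iff.2 hnz
  have hrefl : Tendsto axisReflection (𝓝 p) (𝓝 p) := by
    have := continuous_axisReflection.tendsto p
    rwa [axisReflection_of_re_eq_zero hp] at this
  have hpos := logDeriv_re_pos_of_norm_lt_reflection hα hα0 hp (by
    filter_upwards [hlt, haα, hrefl.eventually haα] with w h1 h2 h3 hneg
    have h4 := h1 hneg
    rw [h2, h3, norm_smul, norm_smul, norm_pow, norm_pow, norm_axisReflection_sub hp] at h4
    exact lt_of_mul_lt_mul_left h4 (by positivity))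
  obtain ⟨ρ, hρ, hball⟩ := Metric.eventually_nhds_iff_ball.1 (ha.eventually_analyticAt.and haα)
  have hd : DifferentiableOn ℂ a (ball p ρ) := fun w hw =>
    (hball w hw).1.differentiableAt.differentiableWithinAt
  obtain ⟨G, hG0, hG⟩ := hd.isExactOn_ball.with_val_at p 0
  obtain ⟨δ, hδ, key⟩ := exists_norm_lt_of_logDeriv_re_pos (G := G) (α := α) (n := n) hp (by
    filter_upwards [ball_mem_nhds p hρ] with w hw
    have := hG w hw
    rwa [(hball w hw).2, smul_eq_mul] at this) hG0 hα hα0 hpos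
  refine ⟨min δ ρ, lt_min hδ hρ, fun x₁ x₂ t h1 h2 h3 h0 => ?_⟩
  have hmem : ∀ x ∈ uIcc x₁ x₂, (x + t * Complex.I : ℂ) ∈ ball p ρ := fun x hx => by
    rw [uIcc_of_le h2.le] at hx
    rw [mem_ball, dist_eq_norm]
    refine lt_of_le_of_lt ?_ (h3.trans_le (min_le_right _ _))
    rw [Complex.norm_def, Complex.norm_def]
    apply Real.sqrt_le_sqrt
    simp only [Complex.normSq_apply, Complex.sub_re, Complex.sub_im, Complex.add_re,
      Complex.add_im, hp]
    simp
    nlinarith [hx.1, hx.2, (abs_le.1 h1).1]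
  have hint := intervalIntegral.integral_eq_sub_of_hasDerivAt
    (f := fun x : ℝ => G (x + t * Complex.I)) (f' := fun x : ℝ => a (x + t * Complex.I))
    (a := x₁) (b := x₂) (fun x hx => by
      have h6 : HasDerivAt (fun y : ℂ => G (y + t * Complex.I)) (a (x + t * Complex.I))
          (x : ℂ) := by
        simpa using HasDerivAt.comp_add_const (x : ℂ) (t * Complex.I) (hG _ (hmem x hx))
      exact h6.comp_ofReal)
    (ContinuousOn.intervalIntegrable (hd.continuousOn.comp (by fun_prop) hmem))
  rw [h0, eq_comm, sub_eq_zero] at hint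
  exact (key x₁ x₂ t h1 h2 (h3.trans_le (min_le_left _ _))).ne (by rw [hint])

/-! ### Periodic functions on a vertical strip -/

/-- The vertical strip of half-width `ρ` around the imaginary axis. -/
def strip (ρ : ℝ) : Set ℂ := {w | |w.re| < ρ}

theorem isOpen_strip (ρ : ℝ) : IsOpen (strip ρ) :=
  isOpen_lt (Complex.continuous_re.abs) continuous_const

theorem axisReflection_mem_strip {ρ : ℝ} {w : ℂ} (h : w ∈ strip ρ) : axisReflection w ∈ strip ρ := by
  simpa [strip] using h

theorem mem_strip_mk {ρ x t : ℝ} : (x + t * Complex.I : ℂ) ∈ strip ρ ↔ |x| < ρ := by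
  simp [strip]

/-- A `2πi`-periodic property that holds locally at the imaginary axis holds in a strip. -/
theorem eventually_forall_of_periodic {P : ℝ → ℝ → Prop}
    (hper : ∀ x t, P x (t + 2 * Real.pi) ↔ P x t)
    (hloc : ∀ t₀ : ℝ, ∀ᶠ z : ℝ × ℝ in 𝓝 (0, t₀), P z.1 z.2) :
    ∀ᶠ x in 𝓝 (0 : ℝ), ∀ t, P x t := by
  have h1 := (isCompact_Icc (a := (0 : ℝ)) (b := 2 * Real.pi)).eventually_forall_of_forall_eventually
    (P := P) (x₀ := 0) fun t _ => hloc t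
  filter_upwards [h1] with x hx t
  have hp : Function.Periodic (P x) (2 * Real.pi) := fun t => propext (hper x t)
  obtain ⟨y, hy, hyt⟩ := hp.exists_mem_Ico₀ Real.two_pi_pos t
  rw [hyt]
  exact hx y (Ico_subset_Icc_self hy)

/-- A uniform version of `exists_integral_ne_zero`: for periodic `a`, the segments may start at any
height, by compactness of a period. -/
theorem exists_forall_integral_ne_zero {a : ℂ → ℂ} {ρ : ℝ} (hρ : 0 < ρ)
    (ha : DifferentiableOn ℂ a (strip ρ))
    (hper : ∀ w, a (w + 2 * Real.pi * Complex.I) = a w)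
    (hlt : ∀ w ∈ strip ρ, w.re < 0 → ‖a w‖ < ‖a (axisReflection w)‖) :
    ∃ ε > 0, ε < ρ ∧ ∀ x₁ x₂ t : ℝ, |x₁| ≤ x₂ → x₁ < x₂ → x₂ < ε →
      ∫ x in x₁..x₂, a (x + t * Complex.I) ≠ 0 := by
  have key := eventually_forall_of_periodic
    (P := fun x₂ t => ∀ x₁ : ℝ, |x₁| ≤ x₂ → x₁ < x₂ → ∫ x in x₁..x₂, a (x + t * Complex.I) ≠ 0)
    (fun x t => by
      have : ∀ x : ℝ, a (x + ((t + 2 * Real.pi : ℝ) : ℂ) * Complex.I) = a (x + t * Complex.I) :=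
        fun x => by
          rw [← hper (x + t * Complex.I)]; congr 1; push_cast; ring
      simp only [this]) fun t₀ => by
    have hp : (t₀ * Complex.I : ℂ).re = 0 := by simp
    have hmem : strip ρ ∈ 𝓝 (t₀ * Complex.I : ℂ) :=
      (isOpen_strip ρ).mem_nhds (by simpa [strip] using hρ)
    obtain ⟨δ, hδ, h⟩ := exists_integral_ne_zero
      (ha.analyticOnNhd (isOpen_strip ρ) _ (mem_of_mem_nhds hmem)) hp
      (by filter_upwards [hmem] with w hw using hlt w hw)
    have hc : Continuous fun z : ℝ × ℝ => ‖(z.1 + z.2 * Complex.I : ℂ) - t₀ * Complex.I‖ := by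
      fun_prop
    have : ∀ᶠ z : ℝ × ℝ in 𝓝 (0, t₀), ‖(z.1 + z.2 * Complex.I : ℂ) - t₀ * Complex.I‖ < δ :=
      hc.continuousAt.eventually_lt_const (by simpa using hδ)
    filter_upwards [this] with z hz x₁ h1 h2
    exact h x₁ z.1 z.2 h1 h2 hz
  obtain ⟨ε, hε, hball⟩ := Metric.eventually_nhds_iff_ball.1 key
  refine ⟨min ε (ρ / 2), lt_min hε (by linarith), (min_le_right _ _).trans_lt (by linarith),
    fun x₁ x₂ t h1 h2 h3 => hball x₂ ?_ t x₁ h1 h2⟩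
  rw [mem_ball, Real.dist_eq, sub_zero, abs_of_nonneg ((abs_nonneg _).trans h1)]
  exact h3.trans_le (min_le_left _ _)

/-- If no integral of `a` over the segments from `x₁ + it` to `x + it` with `-x ≤ x₁ < x`
vanishes, then the integrals with `x₁ = -x` wind around the origin as often as `a` does along
the line `Re w = x`: shrinking the segments is a homotopy. -/
theorem hasWinding_integral {a : ℂ → ℂ} {ρ x : ℝ} (hx : 0 < x) (hxρ : x < ρ)
    (ha : ContinuousOn a (strip ρ)) (hper : ∀ w, a (w + 2 * Real.pi * Complex.I) = a w)
    (hne : ∀ x₁ t : ℝ, |x₁| ≤ x → x₁ < x → ∫ s in x₁..x, a (s + t * Complex.I) ≠ 0)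
    (h0 : ∀ t : ℝ, a (x + t * Complex.I) ≠ 0) {N : ℤ}
    (hN : HasWinding (fun t => a (x + t * Complex.I)) N) :
    HasWinding (fun t => ∫ s in -x..x, a (s + t * Complex.I)) N := by
  have hxx : -x ≤ x := by linarith
  let cl : ℝ → ℝ := fun s => (projIcc (-x) x hxx s : ℝ)
  have hcl : Continuous cl := continuous_subtype_val.comp continuous_projIcc
  have hclm : ∀ s, cl s ∈ Icc (-x) x := fun s => (projIcc (-x) x hxx s).2
  have hcls : ∀ s ∈ Icc (-x) x, cl s = s := fun s hs => by
    simp only [cl]; rw [projIcc_of_mem hxx hs]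
  let A : ℝ → ℝ → ℂ := fun s t => a (cl s + t * Complex.I)
  have hA : Continuous fun z : ℝ × ℝ => A z.1 z.2 := by
    refine ha.comp_continuous (by fun_prop) fun z => ?_
    rw [mem_strip_mk, abs_lt]
    constructor <;> linarith [(hclm z.1).1, (hclm z.1).2]
  have hAper : ∀ s t, A s (t + 2 * Real.pi) = A s t := fun s t => by
    simp only [A]; rw [← hper (cl s + t * Complex.I)]; congr 1; push_cast; ring
  let X : ℝ → ℝ := fun s => -x + 2 * x * s
  let H : ℝ → ℝ → ℂ := fun s t => ∫ τ in (0 : ℝ)..1, A (X s + (x - X s) * τ) t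
  have hXs : ∀ s ∈ Icc (0 : ℝ) 1, -x ≤ X s ∧ X s ≤ x := fun s hs =>
    ⟨by simp only [X]; nlinarith [hs.1], by simp only [X]; nlinarith [hs.2]⟩
  have hHint : ∀ s ∈ Icc (0 : ℝ) 1, ∀ t, (x - X s : ℝ) • H s t
      = ∫ σ in X s..x, a (σ + t * Complex.I) := fun s hs t => by
    simp only [H]
    rw [intervalIntegral.smul_integral_comp_add_mul (fun σ => A σ t) (x - X s) (X s)]
    simp only [mul_zero, add_zero, mul_one]
    rw [show X s + (x - X s) = x by ring]
    refine intervalIntegral.integral_congr fun σ hσ => ?_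
    rw [uIcc_of_le (hXs s hs).2] at hσ
    simp only [A]
    rw [hcls σ ⟨(hXs s hs).1.trans hσ.1, hσ.2⟩]
  have h1 : H 1 = fun t : ℝ => a (x + t * Complex.I) := by
    funext t
    simp only [H, X, A]
    rw [intervalIntegral.integral_congr (g := fun _ => a (x + t * Complex.I))]
    · simp
    · intro τ _
      simp only
      rw [show -x + 2 * x * 1 + (x - (-x + 2 * x * 1)) * τ = x by ring,
        hcls x (right_mem_Icc.2 hxx)]
  have hw : HasWinding (H 0) N := by
    refine HasWinding.of_homotopy (H := H) (s := 1) ?_ (fun s hs t => ?_) (fun s hs t => ?_)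
      (by simp) (by simp) (by rw [h1]; exact hN)
    · refine Continuous.continuousOn ?_
      refine intervalIntegral.continuous_parametric_intervalIntegral_of_continuous' (μ := MeasureTheory.volume)
        (f := fun (z : ℝ × ℝ) τ => A (X z.1 + (x - X z.1) * τ) z.2) ?_ 0 1
      have : Continuous fun z : (ℝ × ℝ) × ℝ =>
          ((X z.1.1 + (x - X z.1.1) * z.2, z.1.2) : ℝ × ℝ) := by fun_prop
      exact hA.comp this
    · rcases (hXs s hs).2.lt_or_eq with h | h
      · intro hH
        have := hHint s hs t
        rw [hH, smul_zero] at this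
        exact hne (X s) t (abs_le.2 (hXs s hs)) h this.symm
      · have hs1 : s = 1 := by simp only [X] at h; nlinarith
        rw [hs1, h1]; exact h0 t
    · simp only [H, hAper]
  have hc := (hasWinding_const (a := (2 * x : ℂ)) (by
    have : (x : ℂ) ≠ 0 := by exact_mod_cast hx.ne'
    simpa using this)).mul hw
  rw [zero_add] at hc
  convert hc using 2 with t
  have := hHint 0 (by simp) t
  simp only [X, mul_zero, add_zero] at this
  rw [← this, Complex.real_smul]
  push_cast; ring

/-- Let `f` vanish on the imaginary axis, with derivative `(a w + a (-conj w)) / 2` in the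
horizontal direction, where `|a|` is smaller on the left of the axis than at the reflected points.
Then `f` has no zeros in a strip on the left of the axis and winds there around the origin as often
as `a` does on the right of the axis. -/
theorem exists_ne_zero_and_hasWinding {a f : ℂ → ℂ} {ρ : ℝ} (hρ : 0 < ρ)
    (ha : DifferentiableOn ℂ a (strip ρ))
    (hper : ∀ w, a (w + 2 * Real.pi * Complex.I) = a w)
    (hlt : ∀ w ∈ strip ρ, w.re < 0 → ‖a w‖ < ‖a (axisReflection w)‖)
    (hf : ∀ x t : ℝ, |x| < ρ → HasDerivAt (fun s : ℝ => f (s + t * Complex.I))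
      ((a (x + t * Complex.I) + a (-x + t * Complex.I)) / 2) x)
    (hf0 : ∀ t : ℝ, f (t * Complex.I) = 0) :
    ∃ ε > 0, ε < ρ ∧ (∀ w : ℂ, -ε < w.re → w.re < 0 → f w ≠ 0) ∧
      ∀ x : ℝ, 0 < x → x < ε → ∀ N : ℤ, HasWinding (fun t => a (x + t * Complex.I)) N →
        HasWinding (fun t => f (-x + t * Complex.I)) N := by
  obtain ⟨ε, hε, hερ, hint⟩ := exists_forall_integral_ne_zero hρ ha hper hlt
  have hrep : ∀ x t : ℝ, 0 < x → x < ρ →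
      f (-x + t * Complex.I) = -(1 / 2) * ∫ s in -x..x, a (s + t * Complex.I) := by
    intro x t hx hxρ
    have hmem : ∀ s ∈ uIcc (-x) x, |s| < ρ := fun s hs => by
      rw [uIcc_of_le (by linarith)] at hs
      exact (abs_le.2 hs).trans_lt hxρ
    have hci : ∀ y z : ℝ, y ∈ uIcc (-x) x → z ∈ uIcc (-x) x →
        IntervalIntegrable (fun s : ℝ => a (s + t * Complex.I)) MeasureTheory.volume y z :=
      fun y z hy hz => ContinuousOn.intervalIntegrable
        (ha.continuousOn.comp (by fun_prop) fun s hs =>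
          mem_strip_mk.2 (hmem s (uIcc_subset_uIcc hy hz hs)))
    have m0 : (0 : ℝ) ∈ uIcc (-x) x := by
      rw [uIcc_of_le (by linarith)]; constructor <;> linarith
    have hneg : IntervalIntegrable (fun s : ℝ => a (-s + t * Complex.I))
        MeasureTheory.volume (-x) 0 := by
      refine ContinuousOn.intervalIntegrable (ha.continuousOn.comp (by fun_prop) fun s hs => ?_)
      have := hmem s (uIcc_subset_uIcc left_mem_uIcc m0 hs)
      rw [← Complex.ofReal_neg, mem_strip_mk, abs_neg]; exact this
    have e1 := intervalIntegral.integral_eq_sub_of_hasDerivAt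
      (f := fun s : ℝ => f (s + t * Complex.I))
      (f' := fun s : ℝ => (a (s + t * Complex.I) + a (-s + t * Complex.I)) / 2)
      (a := -x) (b := 0) (fun s hs => hf s t (hmem s (uIcc_subset_uIcc left_mem_uIcc m0 hs)))
      (by exact ((hci _ _ left_mem_uIcc m0).add hneg).div_const _)
    rw [intervalIntegral.integral_div, intervalIntegral.integral_add (hci _ _ left_mem_uIcc m0)
      hneg] at e1
    have e2 : ∫ s in (-x)..0, a (-s + t * Complex.I) = ∫ s in (0 : ℝ)..x, a (s + t * Complex.I) := by
      have := intervalIntegral.integral_comp_neg (a := -x) (b := 0)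
        (fun s : ℝ => a (s + t * Complex.I))
      simpa using this
    rw [e2, intervalIntegral.integral_add_adjacent_intervals (hci _ _ left_mem_uIcc m0)
      (hci _ _ m0 right_mem_uIcc)] at e1
    simp only [Complex.ofReal_zero, zero_add, hf0, zero_sub, Complex.ofReal_neg] at e1
    linear_combination e1
  refine ⟨ε, hε, hερ, fun w h1 h2 h0 => ?_, fun x hx hxε N hN => ?_⟩
  · have := hrep (-w.re) w.im (by linarith) (by linarith)
    simp only [Complex.ofReal_neg, neg_neg, Complex.re_add_im] at this
    rw [h0, eq_comm, mul_eq_zero] at this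
    have h3 := hint (- -w.re) (-w.re) w.im (by rw [neg_neg, abs_of_neg h2]) (by linarith)
      (by linarith)
    rw [neg_neg] at h3
    exact h3 (this.resolve_left (by norm_num))
  · have h1 := hasWinding_integral hx (hxε.trans hερ) ha.continuousOn hper
      (fun x₁ t h1 h2 => hint x₁ x t h1 h2 hxε) hN.ne_zero hN
    have h2 := (hasWinding_const (a := -(1 / 2)) (by norm_num)).mul h1
    rw [zero_add] at h2
    convert h2 using 2 with t
    exact hrep x t hx (hxε.trans hερ)

/-! ### Zeros on the unit circle -/

/-- A holomorphic function with finitely many zeros in `K`, all of finite order, is the product of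
a polynomial and a function without zeros in `K`. -/
theorem exists_eq_prod_pow_mul {K : Set ℂ} (Z : Finset ℂ) : ∀ f : ℂ → ℂ, AnalyticOnNhd ℂ f K →
    (∀ x ∈ Z, x ∈ K ∧ analyticOrderAt f x ≠ ⊤) → (∀ x ∈ K, f x = 0 → x ∈ Z) →
    ∃ E : ℂ → ℂ, AnalyticOnNhd ℂ E K ∧ (∀ x ∈ K, E x ≠ 0) ∧
      ∀ z, f z = (∏ x ∈ Z, (z - x) ^ analyticOrderNatAt f x) * E z := by
  classical
  induction Z using Finset.induction_on with
  | empty =>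
    intro f hf _ hZ
    exact ⟨f, hf, fun x hx h0 => by simpa using hZ x hx h0, fun z => by simp⟩
  | insert z₀ Z hz₀ ih =>
    intro f hf hord hZ
    obtain ⟨hz₀K, hz₀o⟩ := hord z₀ (by simp)
    obtain ⟨h, hh, hh0, hfh⟩ := ((hf z₀ hz₀K).analyticOrderAt_ne_top).1 hz₀o
    set n := analyticOrderNatAt f z₀ with hn
    let f₁ : ℂ → ℂ := fun z => if z = z₀ then h z₀ else f z / (z - z₀) ^ n
    have hf₁ : ∀ z, z ≠ z₀ → f₁ z = f z / (z - z₀) ^ n := fun z hz => by simp [f₁, hz]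
    have hprod : ∀ z, f z = (z - z₀) ^ n * f₁ z := fun z => by
      rcases eq_or_ne z z₀ with rfl | hz
      · simpa [f₁] using hfh.self_of_nhds
      · rw [hf₁ z hz, mul_div_cancel₀ _ (pow_ne_zero _ (sub_ne_zero.2 hz))]
    have hev : f₁ =ᶠ[𝓝 z₀] h := by
      filter_upwards [hfh] with z hz
      rcases eq_or_ne z z₀ with rfl | hne
      · simp [f₁]
      · rw [hf₁ z hne, hz, smul_eq_mul, mul_div_cancel_left₀ _ (pow_ne_zero _ (sub_ne_zero.2 hne))]
    have han : AnalyticOnNhd ℂ f₁ K := fun z hz => by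
      rcases eq_or_ne z z₀ with rfl | hne
      · exact hh.congr hev.symm
      · have : AnalyticAt ℂ (fun z => f z / (z - z₀) ^ n) z :=
          (hf z hz).div ((analyticAt_id.sub analyticAt_const).pow n)
            (pow_ne_zero _ (sub_ne_zero.2 hne))
        refine this.congr ?_
        filter_upwards [isOpen_ne.mem_nhds hne] with w hw
        exact (hf₁ w hw).symm
    have ho : ∀ x ∈ Z, analyticOrderAt f₁ x = analyticOrderAt f x := fun x hx => by
      have hne : x ≠ z₀ := by rintro rfl; exact hz₀ hx
      have hxK := (hord x (by simp [hx])).1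
      have e1 : f = (fun z => (z - z₀) ^ n) * f₁ := funext hprod
      have hp : AnalyticAt ℂ (fun z : ℂ => (z - z₀) ^ n) x :=
        (analyticAt_id.sub analyticAt_const).pow n
      rw [e1, analyticOrderAt_mul hp (han x hxK),
        hp.analyticOrderAt_eq_zero.2 (pow_ne_zero _ (sub_ne_zero.2 hne)), zero_add]
    obtain ⟨E, hE1, hE2, hE3⟩ := ih f₁ han (fun x hx => ⟨(hord x (by simp [hx])).1, by
        rw [ho x hx]; exact (hord x (by simp [hx])).2⟩) fun x hx h0 => by
      have hne : x ≠ z₀ := by rintro rfl; simp [f₁] at h0; exact hh0 h0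
      exact (Finset.mem_insert.1 (hZ x hx (by rw [hprod, h0, mul_zero]))).resolve_left hne
    refine ⟨E, hE1, hE2, fun z => ?_⟩
    rw [Finset.prod_insert hz₀, hprod z, hE3 z, ← hn, mul_assoc]
    congr 2
    refine Finset.prod_congr rfl fun x hx => ?_
    rw [analyticOrderNatAt, analyticOrderNatAt, ho x hx]

theorem finite_zeros_of_isCompact {f : ℂ → ℂ} {K : Set ℂ} (hK : IsCompact K)
    (hf : AnalyticOnNhd ℂ f K) (ho : ∀ x ∈ K, analyticOrderAt f x ≠ ⊤) :
    (K ∩ {z | f z = 0}).Finite := by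
  by_contra hinf
  obtain ⟨x, hxK, hx⟩ := Set.Infinite.exists_accPt_of_subset_isCompact hinf hK inter_subset_left
  have h1 := (hf x hxK).eventually_eq_zero_or_eventually_ne_zero
  rcases h1 with h | h
  · exact ho x hxK (analyticOrderAt_eq_top.2 h)
  · rw [accPt_iff_frequently_nhdsNE] at hx
    obtain ⟨z, h1, h2⟩ := (hx.and_eventually h).exists
    exact h2 h1.2

theorem circleZeroCount_eq_sum {f : ℂ → ℂ} (Z : Finset ℂ) (hZ : ∀ x ∈ Z, x ∈ sphere (0 : ℂ) 1)
    (h : ∀ x ∈ sphere (0 : ℂ) 1, f x = 0 → x ∈ Z) :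
    circleZeroCount f = ∑ x ∈ Z, analyticOrderNatAt f x := by
  rw [circleZeroCount]
  refine finsum_mem_eq_sum_of_inter_support_eq _ ?_
  ext x
  simp only [mem_inter_iff, Function.mem_support, Finset.mem_coe]
  constructor
  · rintro ⟨h1, h2⟩
    exact ⟨h x h1 (apply_eq_zero_of_analyticOrderNatAt_ne_zero h2), h2⟩
  · rintro ⟨h1, h2⟩
    exact ⟨hZ x h1, h2⟩

theorem exists_collar_subset {U : Set ℂ} (hU : IsOpen U) (hs : sphere (0 : ℂ) 1 ⊆ U) :
    ∃ ε > 0, ∀ w : ℂ, |w.re| < ε → Complex.exp w ∈ U := by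
  have key := eventually_forall_of_periodic (P := fun x t => Complex.exp (x + t * Complex.I) ∈ U)
    (fun x t => by
      have : (x + ((t + 2 * Real.pi : ℝ) : ℂ) * Complex.I)
          = x + t * Complex.I + 2 * Real.pi * Complex.I := by push_cast; ring
      rw [this, Complex.exp_periodic]) fun t => by
    have hc : Continuous fun z : ℝ × ℝ => Complex.exp (z.1 + z.2 * Complex.I) := by fun_prop
    refine hc.continuousAt.eventually (hU.mem_nhds (hs ?_))
    simp [Complex.norm_exp_ofReal_mul_I]
  obtain ⟨ε, hε, hball⟩ := Metric.eventually_nhds_iff_ball.1 key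
  refine ⟨ε, hε, fun w hw => ?_⟩
  have := hball w.re (by simpa using hw) w.im
  rwa [Complex.re_add_im] at this

theorem isOpen_openAnnulus (a b : ℝ) : IsOpen (openAnnulus a b) :=
  (isOpen_lt continuous_const continuous_norm).inter (isOpen_lt continuous_norm continuous_const)

theorem sphere_subset_openAnnulus {r : ℝ} (h0 : 0 < r) (h1 : r < 1) :
    sphere (0 : ℂ) 1 ⊆ openAnnulus r (1 / r) := fun z hz => by
  rw [mem_sphere_zero_iff_norm] at hz
  simp only [openAnnulus, mem_ofPred_eq, hz]
  exact ⟨h1, (one_lt_div h0).2 h1⟩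

theorem exp_add_mul_I (x t : ℝ) :
    Complex.exp (x + t * Complex.I) = (Real.exp x : ℝ) * Complex.exp (t * Complex.I) := by
  rw [Complex.exp_add, Complex.ofReal_exp]

/-- A function without zeros on the unit circle has the same winding number along all circles
close to it. -/
theorem exists_hasWinding_comp_exp {E : ℂ → ℂ} (hE : AnalyticOnNhd ℂ E (sphere 0 1))
    (h0 : ∀ z ∈ sphere (0 : ℂ) 1, E z ≠ 0) :
    ∃ ε > 0, ∃ n : ℤ, ∀ x : ℝ, |x| < ε →
      HasWinding (fun t => E (Complex.exp (x + t * Complex.I))) n := by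
  have hop : ∀ᶠ z in 𝓝ˢ (sphere (0 : ℂ) 1), AnalyticAt ℂ E z ∧ E z ≠ 0 := by
    rw [eventually_nhdsSet_iff_forall]
    exact fun z hz => ((hE z hz).eventually_analyticAt).and
      ((hE z hz).continuousAt.eventually_ne (h0 z hz))
  obtain ⟨U, hU, hsU, hUP⟩ := eventually_nhdsSet_iff_exists.1 hop
  obtain ⟨ε, hε, hcol⟩ := exists_collar_subset hU hsU
  have hmem : ∀ x t : ℝ, |x| < ε → Complex.exp (x + t * Complex.I) ∈ U := fun x t hx =>
    hcol _ (by simpa using hx)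
  have hc : ContinuousOn E U := fun z hz => (hUP z hz).1.continuousAt.continuousWithinAt
  have hper : ∀ x t : ℝ, E (Complex.exp (x + (t + 2 * Real.pi : ℝ) * Complex.I))
      = E (Complex.exp (x + t * Complex.I)) := fun x t => by
    rw [exp_add_mul_I, hasWinding_exp.periodic, exp_add_mul_I]
  obtain ⟨n, hn⟩ := exists_hasWinding
    (c := fun t => E (Complex.exp ((0 : ℝ) + t * Complex.I)))
    (hc.comp_continuous (by fun_prop) fun t => hmem 0 t (by simpa using hε))
    (fun t => (hUP _ (hmem 0 t (by simpa using hε))).2) (hper 0)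
  refine ⟨ε, hε, n, fun x hx => ?_⟩
  have hsx : ∀ s ∈ Icc (0 : ℝ) 1, |s * x| < ε := fun s hs => by
    rw [abs_mul, abs_of_nonneg hs.1]
    calc s * |x| ≤ 1 * |x| := by gcongr; exact hs.2
      _ < ε := by rwa [one_mul]
  have := HasWinding.of_homotopy (n := n) (s := 0) (s' := 1)
    (H := fun s t => E (Complex.exp ((s * x : ℝ) + t * Complex.I)))
    (hc.comp (by fun_prop) fun z hz => hmem _ _ (hsx _ hz.1))
    (fun s hs t => (hUP _ (hmem _ _ (hsx s hs))).2) (fun s hs t => hper _ _) (by simp) (by simp)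
    (by simpa using hn)
  simpa using this

/-- Let `z φ z` be real on the unit circle. Then the number of zeros of `φ` on the circle is even,
and half of it is the winding number of `z φ z` along slightly larger circles: passing from a
circle inside to its mirror image outside adds the number of zeros to the winding number, and
reverses its sign. -/
theorem exists_circleZeroCount_eq_two_mul {φ : ℂ → ℂ} (hφ : AnalyticOnNhd ℂ φ (sphere 0 1))
    (ho : ∀ z ∈ sphere (0 : ℂ) 1, analyticOrderAt φ z ≠ ⊤)
    (hsymm : ∀ᶠ x : ℝ in 𝓝[>] 0, ∀ t : ℝ,
      Complex.exp (-x + t * Complex.I) * φ (Complex.exp (-x + t * Complex.I))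
      = (starRingEnd ℂ) (Complex.exp (x + t * Complex.I) * φ (Complex.exp (x + t * Complex.I)))) :
    ∃ k : ℕ, circleZeroCount φ = 2 * k ∧ (k = 0 ↔ ∀ z ∈ sphere (0 : ℂ) 1, φ z ≠ 0) ∧
      ∃ ε > 0, ∀ x : ℝ, 0 < x → x < ε →
        HasWinding (fun t => Complex.exp (x + t * Complex.I)
          * φ (Complex.exp (x + t * Complex.I))) k := by
  have hfin := finite_zeros_of_isCompact (isCompact_sphere 0 1) hφ ho
  let Z : Finset ℂ := hfin.toFinset
  have hZs : ∀ x ∈ Z, x ∈ sphere (0 : ℂ) 1 := fun x hx => (hfin.mem_toFinset.1 hx).1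
  have hZ : ∀ x ∈ sphere (0 : ℂ) 1, φ x = 0 → x ∈ Z := fun x h1 h2 => hfin.mem_toFinset.2 ⟨h1, h2⟩
  obtain ⟨E, hE1, hE2, hE3⟩ := exists_eq_prod_pow_mul Z φ hφ
    (fun x hx => ⟨hZs x hx, ho x (hZs x hx)⟩) hZ
  obtain ⟨ε, hε, n, hn⟩ := exists_hasWinding_comp_exp hE1 hE2
  have hw1 : ∀ x : ℝ, HasWinding (fun t => Complex.exp (x + t * Complex.I)) 1 := fun x => by
    have := (hasWinding_const (a := (Real.exp x : ℝ))
      (by exact_mod_cast (Real.exp_pos x).ne')).mul hasWinding_exp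
    simpa only [exp_add_mul_I, zero_add] using this
  have hnorm : ∀ x ∈ Z, ‖x‖ = 1 := fun x hx => by simpa using hZs x hx
  set N : ℤ := ∑ x ∈ Z, (analyticOrderNatAt φ x : ℤ) with hN
  have hpos : ∀ x : ℝ, 0 < x → x < ε → HasWinding (fun t => Complex.exp (x + t * Complex.I)
      * φ (Complex.exp (x + t * Complex.I))) (1 + (N + n)) := fun x h1 h2 => by
    have h3 := HasWinding.prod (c := fun z t => (Complex.exp (x + t * Complex.I) - z)
        ^ analyticOrderNatAt φ z) (n := fun z => analyticOrderNatAt φ z * 1) Z fun z hz => by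
      refine HasWinding.pow ?_ _
      simp only [exp_add_mul_I]
      refine hasWinding_circle_sub_of_lt ?_
      rw [hnorm z hz]; exact Real.one_lt_exp_iff.2 h1
    have h4 := (hw1 x).mul (h3.mul (hn x (by rwa [abs_of_pos h1])))
    simp only [mul_one] at h4
    simpa only [hE3 (Complex.exp _)] using h4
  have hneg : ∀ x : ℝ, 0 < x → x < ε → HasWinding (fun t => Complex.exp (-x + t * Complex.I)
      * φ (Complex.exp (-x + t * Complex.I))) (1 + (0 + n)) := fun x h1 h2 => by
    have h3 := HasWinding.prod (c := fun z t => (Complex.exp (-x + t * Complex.I) - z)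
        ^ analyticOrderNatAt φ z) (n := fun z => analyticOrderNatAt φ z * 0) Z fun z hz => by
      refine HasWinding.pow ?_ _
      simp only [← Complex.ofReal_neg, exp_add_mul_I]
      refine hasWinding_circle_sub_of_gt (Real.exp_pos _) ?_
      rw [hnorm z hz]; exact Real.exp_lt_one_iff.2 (by linarith)
    have h4 := (hw1 (-x)).mul (h3.mul (hn (-x) (by rwa [abs_neg, abs_of_pos h1])))
    simp only [mul_zero, Finset.sum_const_zero, Complex.ofReal_neg] at h4
    simpa only [hE3 (Complex.exp _)] using h4
  obtain ⟨x, hx1, hx2, hx3⟩ := (hsymm.and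
    (Ioo_mem_nhdsGT hε : ∀ᶠ x : ℝ in 𝓝[>] 0, x ∈ Ioo 0 ε)).exists
  have hw := (hpos x hx2 hx3).conj.unique (m := 1 + (0 + n)) (by
    convert hneg x hx2 hx3 using 2 with t
    exact (hx1 t).symm)
  have hcount : (circleZeroCount φ : ℤ) = N := by
    rw [circleZeroCount_eq_sum Z hZs hZ, hN]; push_cast; rfl
  obtain ⟨k, hk⟩ : ∃ k : ℕ, circleZeroCount φ = 2 * k := ⟨circleZeroCount φ / 2, by omega⟩
  refine ⟨k, hk, ⟨fun h z hz h0 => ?_, fun h => ?_⟩, ε, hε, fun x h1 h2 => ?_⟩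
  · have hsum : ∑ x ∈ Z, analyticOrderNatAt φ x = 0 := by
      rw [← circleZeroCount_eq_sum Z hZs hZ, hk, h]
    have h1 := (Finset.sum_eq_zero_iff.1 hsum) z (hZ z hz h0)
    have h2 : analyticOrderAt φ z = 0 := by
      rw [← Nat.cast_analyticOrderNatAt (ho z hz), h1]; rfl
    exact ((hφ z hz).analyticOrderAt_eq_zero.1 h2) h0
  · have : Z = ∅ := by
      rw [Finset.eq_empty_iff_forall_notMem]
      exact fun z hz => h z (hZs z hz) (hfin.mem_toFinset.1 hz).2
    rw [hN, this] at hcount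
    simp at hcount; omega
  · convert hpos x h1 h2 using 1
    omega

/-! ### Functions that are unimodular on the unit circle -/

/-- A continuous logarithm of a differentiable curve has the logarithmic derivative. -/
theorem hasDerivAt_of_exp_eq {ℓ c : ℝ → ℂ} {t : ℝ} {c' : ℂ} (hℓ : Continuous ℓ)
    (h : ∀ t, Complex.exp (ℓ t) = c t) (hc : HasDerivAt c c' t) : HasDerivAt ℓ (c' / c t) t := by
  have hct : c t ≠ 0 := by rw [← h]; exact Complex.exp_ne_zero _
  have hlog : HasDerivAt (fun s => ℓ t + Complex.log (c s / c t)) (c' / c t) t := by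
    have h1 : HasDerivAt (fun s => c s / c t) (c' / c t) t := hc.div_const _
    have h2 := (h1.clog_real (by simp [div_self hct])).const_add (ℓ t)
    simpa [div_self hct] using h2
  refine hlog.congr_of_eventuallyEq ?_
  have him : ContinuousAt (fun s => (ℓ s - ℓ t).im) t := by fun_prop
  have e1 : ∀ᶠ s in 𝓝 t, (ℓ s - ℓ t).im < Real.pi :=
    him.eventually_lt_const (by simpa using Real.pi_pos)
  have e2 : ∀ᶠ s in 𝓝 t, -Real.pi < (ℓ s - ℓ t).im :=
    him.eventually_const_lt (by simpa using Real.pi_pos)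
  filter_upwards [e1, e2] with s h1 h2
  rw [← h, ← h, ← Complex.exp_sub, Complex.log_exp h2 h1.le]
  ring

/-- If `|G| = 1` on the unit circle, `|G| < 1` inside and `|G| > 1` outside, near the circle, then
`G` maps the circle to itself by an increasing function of the angle (by Hopf's lemma). -/
theorem exists_strictMono_angle {G : ℂ → ℂ} (hG : AnalyticOnNhd ℂ G (sphere 0 1))
    (h1 : ∀ z ∈ sphere (0 : ℂ) 1, ‖G z‖ = 1)
    (hlt : ∀ᶠ z in 𝓝ˢ (sphere (0 : ℂ) 1), (‖z‖ < 1 → ‖G z‖ < 1) ∧ (1 < ‖z‖ → 1 < ‖G z‖)) :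
    ∃ (d : ℕ) (θ : ℝ → ℝ), 0 < d ∧ Continuous θ ∧ StrictMono θ ∧
      (∀ t : ℝ, G (Complex.exp (t * Complex.I)) = Complex.exp (θ t * Complex.I)) ∧
      (∀ t : ℝ, θ (t + 2 * Real.pi) = θ t + 2 * Real.pi * d) ∧
      ∃ ε > 0, ∀ x : ℝ, |x| < ε →
        HasWinding (fun t => G (Complex.exp (x + t * Complex.I))) d := by
  have hmem : ∀ t : ℝ, Complex.exp (t * Complex.I) ∈ sphere (0 : ℂ) 1 := fun t => by
    simp [Complex.norm_exp_ofReal_mul_I]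
  obtain ⟨ε, hε, n, hn⟩ := exists_hasWinding_comp_exp hG
    fun z hz h0 => by have := h1 z hz; rw [h0] at this; simp at this
  obtain ⟨ℓ, hℓ1, hℓ2, hℓ3⟩ := hn 0 (by simpa using hε)
  simp only [Complex.ofReal_zero, zero_add] at hℓ2
  have hre : ∀ t, (ℓ t).re = 0 := fun t => by
    have := h1 _ (hmem t)
    rwa [← hℓ2, Complex.norm_exp, Real.exp_eq_one_iff] at this
  have hℓθ : ∀ t, ℓ t = ((ℓ t).im : ℂ) * Complex.I := fun t => by
    apply Complex.ext <;> simp [hre]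
  have hθ : ∀ t : ℝ, ∃ v : ℝ, 0 < v ∧ HasDerivAt (fun t => (ℓ t).im) v t := fun t => by
    set p : ℂ := t * Complex.I with hp
    have hp0 : p.re = 0 := by simp [hp]
    have han : AnalyticAt ℂ (fun w => G (Complex.exp w)) p :=
      (hG _ (hmem t)).comp (f := Complex.exp) analyticAt_cexp
    have hne : G (Complex.exp p) ≠ 0 := by rw [hp, ← hℓ2]; exact Complex.exp_ne_zero _
    have hev : ∀ᶠ w in 𝓝 p, (‖Complex.exp w‖ < 1 → ‖G (Complex.exp w)‖ < 1) ∧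
        (1 < ‖Complex.exp w‖ → 1 < ‖G (Complex.exp w)‖) :=
      Complex.continuous_exp.continuousAt.eventually
        ((eventually_nhdsSet_iff_forall.1 hlt) _ (hmem t))
    have hrefl : Tendsto axisReflection (𝓝 p) (𝓝 p) := by
      have := continuous_axisReflection.tendsto p
      rwa [axisReflection_of_re_eq_zero hp0] at this
    have hpos := logDeriv_re_pos_of_norm_lt_reflection han hne hp0 (by
      filter_upwards [hev, hrefl.eventually hev] with w hw1 hw2 hneg
      refine (hw1.1 ?_).trans (hw2.2 ?_)
      · rw [Complex.norm_exp]; exact Real.exp_lt_one_iff.2 hneg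
      · rw [Complex.norm_exp, axisReflection_re]; exact Real.one_lt_exp_iff.2 (by linarith))
    refine ⟨_, hpos, ?_⟩
    have hc : HasDerivAt (fun s : ℝ => G (Complex.exp (s * Complex.I)))
        (deriv (fun w => G (Complex.exp w)) p * Complex.I) t := by
      have h2 : HasDerivAt (fun s : ℝ => (s : ℂ) * Complex.I) Complex.I t := by
        simpa using (Complex.ofRealCLM.hasDerivAt (x := t)).mul_const Complex.I
      exact HasDerivAt.comp (h₂ := fun w => G (Complex.exp w)) (h := fun s : ℝ => (s : ℂ) * Complex.I)
        t han.differentiableAt.hasDerivAt h2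
    have h3 := hasDerivAt_of_exp_eq hℓ1 hℓ2 hc
    have h4 : HasDerivAt (fun t => (ℓ t).im) (deriv (fun w => G (Complex.exp w)) p * Complex.I
        / G (Complex.exp (t * Complex.I))).im t := by
      exact (Complex.imCLM.hasFDerivAt.comp_hasDerivAt t h3)
    convert h4 using 1
    rw [← hp, mul_comm, mul_div_assoc, Complex.I_mul_im]
  have hmono : StrictMono fun t => (ℓ t).im := strictMono_of_deriv_pos fun t => by
    obtain ⟨v, hv, hd⟩ := hθ t
    rwa [hd.deriv]
  have hper : ∀ t : ℝ, (ℓ (t + 2 * Real.pi)).im = (ℓ t).im + 2 * Real.pi * n := fun t => by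
    rw [hℓ3]; simp
  have hn0 : 0 < n := by
    have h2 : (ℓ 0).im < (ℓ (0 + 2 * Real.pi)).im := hmono (by linarith [Real.pi_pos])
    rw [hper] at h2
    have h3 : (0 : ℝ) < n := by
      by_contra hcon
      nlinarith [Real.pi_pos]
    exact_mod_cast h3
  lift n to ℕ using hn0.le
  refine ⟨n, fun t => (ℓ t).im, by exact_mod_cast hn0, Complex.continuous_im.comp hℓ1, hmono,
    fun t => ?_, fun t => by simpa using hper t, ε, hε, hn⟩
  rw [← hℓθ, hℓ2]

theorem exp_mul_I_eq_iff {s t : ℝ} : Complex.exp (s * Complex.I) = Complex.exp (t * Complex.I) ↔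
    ∃ n : ℤ, s = t + 2 * Real.pi * n := by
  rw [Complex.exp_eq_exp_iff_exists_int]
  refine exists_congr fun n => ⟨fun h => ?_, fun h => ?_⟩
  · have := congrArg Complex.im h
    simp at this
    linarith
  · rw [h]; push_cast; ring

theorem exists_eq_exp_of_mem_sphere {z : ℂ} (hz : z ∈ sphere (0 : ℂ) 1) :
    ∃ t ∈ Ico (0 : ℝ) (2 * Real.pi), z = Complex.exp (t * Complex.I) := by
  have hp : Function.Periodic (fun t : ℝ => Complex.exp (t * Complex.I)) (2 * Real.pi) :=
    fun t => hasWinding_exp.periodic t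
  obtain ⟨y, hy, hyt⟩ := hp.exists_mem_Ico₀ Real.two_pi_pos z.arg
  refine ⟨y, hy, ?_⟩
  rw [← hyt]
  have := Complex.norm_mul_exp_arg_mul_I z
  rw [mem_sphere_zero_iff_norm.1 hz] at this
  simpa using this.symm

/-- For a map of the circle that is strictly monotone in the angle, injectivity is having degree
one. -/
theorem injOn_sphere_iff_degree_eq_one {G : ℂ → ℂ} {d : ℕ} {θ : ℝ → ℝ} (hd : 0 < d)
    (hθ : Continuous θ) (hmono : StrictMono θ)
    (hG : ∀ t : ℝ, G (Complex.exp (t * Complex.I)) = Complex.exp (θ t * Complex.I))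
    (hper : ∀ t : ℝ, θ (t + 2 * Real.pi) = θ t + 2 * Real.pi * d) :
    InjOn G (sphere 0 1) ↔ d = 1 := by
  have hpi := Real.pi_pos
  have hmem : ∀ t : ℝ, Complex.exp (t * Complex.I) ∈ sphere (0 : ℂ) 1 := fun t => by
    simp [Complex.norm_exp_ofReal_mul_I]
  have h2π : θ (2 * Real.pi) = θ 0 + 2 * Real.pi * d := by simpa using hper 0
  constructor
  · intro hinj
    by_contra hne
    have hd2 : (2 : ℝ) ≤ d := by exact_mod_cast (by omega : 2 ≤ d)
    obtain ⟨t, ht, htθ⟩ := intermediate_value_Icc (by positivity : (0 : ℝ) ≤ 2 * Real.pi)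
      hθ.continuousOn (show θ 0 + 2 * Real.pi ∈ Icc (θ 0) (θ (2 * Real.pi)) by
        rw [h2π]; constructor <;> nlinarith)
    have h1 : Complex.exp (t * Complex.I) = Complex.exp ((0 : ℝ) * Complex.I) := by
      refine hinj (hmem t) (hmem 0) ?_
      rw [hG, hG, exp_mul_I_eq_iff]
      exact ⟨1, by rw [htθ]; simp⟩
    obtain ⟨n, hn⟩ := exp_mul_I_eq_iff.1 h1
    have ht0 : 0 < t := by
      rcases ht.1.lt_or_eq with h | h
      · exact h
      · rw [← h] at htθ; linarith
    have ht1 : t < 2 * Real.pi := by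
      rcases ht.2.lt_or_eq with h | h
      · exact h
      · rw [h, h2π] at htθ; nlinarith
    rw [zero_add] at hn
    rw [hn] at ht0 ht1
    have h2 : (0 : ℝ) < n := by by_contra hc; nlinarith
    have h3 : (n : ℝ) < 1 := by by_contra hc; nlinarith
    have h4 : 0 < n := by exact_mod_cast h2
    have h5 : n < 1 := by exact_mod_cast h3
    omega
  · rintro rfl z hz z' hz' h
    obtain ⟨t, ht, rfl⟩ := exists_eq_exp_of_mem_sphere hz
    obtain ⟨t', ht', rfl⟩ := exists_eq_exp_of_mem_sphere hz'
    rw [hG, hG, exp_mul_I_eq_iff] at h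
    obtain ⟨n, hn⟩ := h
    have b1 := hmono.monotone ht.1
    have b2 := hmono ht.2
    have b3 := hmono.monotone ht'.1
    have b4 := hmono ht'.2
    rw [h2π] at b2 b4
    have h2 : (-1 : ℝ) < n := by by_contra hc; push_cast at *; nlinarith
    have h3 : (n : ℝ) < 1 := by by_contra hc; push_cast at *; nlinarith
    have h4 : -1 < n := by exact_mod_cast h2
    have h5 : n < 1 := by exact_mod_cast h3
    obtain rfl : n = 0 := by omega
    have htt : t = t' := hmono.injective (by simpa using hn)
    rw [htt]

/-! ### Null data on a strip and their planar projections -/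

/-- The parametrization of null vectors by spinors: `A = x²`, `B = y²`, `C = x y`. -/
theorem exists_sq_eq_mul_eq {A B C : ℂ} (h : A * B = C ^ 2) :
    ∃ x y : ℂ, A = x ^ 2 ∧ B = y ^ 2 ∧ C = x * y := by
  obtain ⟨x, hx⟩ := IsAlgClosed.exists_pow_nat_eq A (n := 2) (by norm_num)
  obtain ⟨y, hy⟩ := IsAlgClosed.exists_pow_nat_eq B (n := 2) (by norm_num)
  have h1 : (x * y - C) * (x * y + C) = 0 := by
    rw [← hx, ← hy] at h; linear_combination h
  rcases mul_eq_zero.1 h1 with h2 | h2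
  · exact ⟨x, y, hx.symm, hy.symm, by linear_combination -h2⟩
  · exact ⟨x, -y, hx.symm, by rw [← hy]; ring, by linear_combination h2⟩

/-- The pairing of a null vector of `ℂ³` with the null vector `e₁ + i e₂` of a pair of orthonormal
vectors, in coordinates in which null vectors are triples `(A, B, C)` with `A B = C²`. -/
def nullPairing (A B C p q e : ℂ) : ℂ := (A * q + B * p) / 2 - C * e

/-- The pairing of two null vectors is, up to a factor, the square of the symplectic pairing of their
spinors. -/
theorem nullPairing_sq (x y s t : ℂ) :
    nullPairing (x ^ 2) (y ^ 2) (x * y) (t ^ 2) (s ^ 2) (s * t) = (x * s - y * t) ^ 2 / 2 := by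
  simp only [nullPairing]; ring

/-- For null vectors, the pairing with a vector and with its conjugate differ in modulus by a product
of differences. This decides how a planar projection acts on the orientation, independently of the
plane. -/
theorem norm_nullPairing_sub {A B C p q e : ℂ} (h : A * B = C ^ 2) (h' : q * p = e ^ 2) :
    ‖nullPairing A B C p q e‖
      - ‖nullPairing A B C ((starRingEnd ℂ) q) ((starRingEnd ℂ) p) ((starRingEnd ℂ) e)‖
      = (‖A‖ - ‖B‖) * (‖q‖ - ‖p‖) / 2 := by
  obtain ⟨x, y, rfl, rfl, rfl⟩ := exists_sq_eq_mul_eq h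
  obtain ⟨s, t, rfl, rfl, rfl⟩ := exists_sq_eq_mul_eq h'
  have h2 : (starRingEnd ℂ) (s * t) = (starRingEnd ℂ) t * (starRingEnd ℂ) s := by
    rw [map_mul, mul_comm]
  rw [h2, map_pow, map_pow, nullPairing_sq, nullPairing_sq]
  simp only [norm_div, norm_pow, Complex.norm_ofNat, Complex.sq_norm, Complex.normSq_apply]
  simp
  ring

/-- The deformation `(A, s² B, s C)` of a null vector consists of null vectors; it joins the pairing
to a multiple of `A` through nonzero values. -/
theorem nullPairing_deform_ne_zero {A B C p q e : ℂ} (h : A * B = C ^ 2) (h' : q * p = e ^ 2)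
    (hAB : ‖B‖ < ‖A‖) (hpq : ‖p‖ < ‖q‖) {s : ℝ} (hs : s ∈ Icc (0 : ℝ) 1) :
    nullPairing A (s ^ 2 * B) (s * C) p q e ≠ 0 := by
  obtain ⟨x, y, rfl, rfl, rfl⟩ := exists_sq_eq_mul_eq h
  obtain ⟨u, t, rfl, rfl, rfl⟩ := exists_sq_eq_mul_eq h'
  have e1 : nullPairing (x ^ 2) (s ^ 2 * y ^ 2) (s * (x * y)) (t ^ 2) (u ^ 2) (u * t)
      = (x * u - s * (y * t)) ^ 2 / 2 := by
    simp only [nullPairing]; ring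
  rw [e1]
  simp only [norm_pow] at hAB hpq
  have hyx : ‖y‖ < ‖x‖ := lt_of_pow_lt_pow_left₀ 2 (norm_nonneg _) hAB
  have htu : ‖t‖ < ‖u‖ := lt_of_pow_lt_pow_left₀ 2 (norm_nonneg _) hpq
  refine div_ne_zero (pow_ne_zero _ (sub_ne_zero.2 fun heq => ?_)) two_ne_zero
  have := congrArg norm heq
  rw [norm_mul, norm_mul, norm_mul, Complex.norm_real, Real.norm_of_nonneg hs.1] at this
  have h3 : ‖y‖ * ‖t‖ < ‖x‖ * ‖u‖ := mul_lt_mul'' hyx htu (norm_nonneg _) (norm_nonneg _)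
  nlinarith [hs.1, hs.2, mul_nonneg (norm_nonneg y) (norm_nonneg t)]

/-- The Weierstrass data of a maximal surface, pulled back to a strip by the exponential map: three
`2πi`-periodic holomorphic functions `A = Φ₁ + iΦ₂`, `B = Φ₁ - iΦ₂`, `C = Φ₃` with `A B = C²` and
the symmetry that comes from the reflection in the unit circle. The surface is spacelike on the left
of the axis; the orientation is chosen such that `|A| < |B|` there. -/
structure IsNullData (ρ : ℝ) (A B C : ℂ → ℂ) : Prop where
  pos : 0 < ρ
  differentiableOn_A : DifferentiableOn ℂ A (strip ρ)
  differentiableOn_B : DifferentiableOn ℂ B (strip ρ)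
  differentiableOn_C : DifferentiableOn ℂ C (strip ρ)
  periodic_A : ∀ w, A (w + 2 * Real.pi * Complex.I) = A w
  periodic_B : ∀ w, B (w + 2 * Real.pi * Complex.I) = B w
  periodic_C : ∀ w, C (w + 2 * Real.pi * Complex.I) = C w
  null : ∀ w ∈ strip ρ, A w * B w = C w ^ 2
  reflection_A : ∀ w ∈ strip ρ, A (axisReflection w) = (starRingEnd ℂ) (B w)
  reflection_C : ∀ w ∈ strip ρ, C (axisReflection w) = (starRingEnd ℂ) (C w)
  norm_lt : ∀ w ∈ strip ρ, w.re < 0 → ‖A w‖ < ‖B w‖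

namespace IsNullData

variable {ρ : ℝ} {A B C : ℂ → ℂ}

theorem reflection_B (h : IsNullData ρ A B C) {w : ℂ} (hw : w ∈ strip ρ) :
    B (axisReflection w) = (starRingEnd ℂ) (A w) := by
  have := h.reflection_A _ (axisReflection_mem_strip hw)
  rw [axisReflection_axisReflection] at this
  rw [this, Complex.conj_conj]

theorem norm_lt_of_re_pos (h : IsNullData ρ A B C) {w : ℂ} (hw : w ∈ strip ρ) (hpos : 0 < w.re) :
    ‖B w‖ < ‖A w‖ := by
  have h1 := h.norm_lt _ (axisReflection_mem_strip hw) (by simpa using hpos)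
  rwa [h.reflection_A w hw, h.reflection_B hw, RCLike.norm_conj, RCLike.norm_conj] at h1

theorem nullPairing_reflection (h : IsNullData ρ A B C) {w : ℂ} (hw : w ∈ strip ρ) (p q e : ℂ) :
    nullPairing (A (axisReflection w)) (B (axisReflection w)) (C (axisReflection w)) p q e
      = (starRingEnd ℂ) (nullPairing (A w) (B w) (C w) ((starRingEnd ℂ) q) ((starRingEnd ℂ) p)
          ((starRingEnd ℂ) e)) := by
  rw [h.reflection_A w hw, h.reflection_B hw, h.reflection_C w hw]
  simp [nullPairing, map_ofNat]
  ring

theorem norm_nullPairing_lt (h : IsNullData ρ A B C) {p q e : ℂ} (he : q * p = e ^ 2)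
    (hpq : ‖p‖ < ‖q‖) {w : ℂ} (hw : w ∈ strip ρ) (hneg : w.re < 0) :
    ‖nullPairing (A w) (B w) (C w) p q e‖
      < ‖nullPairing (A (axisReflection w)) (B (axisReflection w)) (C (axisReflection w)) p q e‖ := by
  rw [h.nullPairing_reflection hw, RCLike.norm_conj, ← sub_neg,
    norm_nullPairing_sub (h.null w hw) he]
  nlinarith [h.norm_lt w hw hneg]

theorem differentiableOn_nullPairing (h : IsNullData ρ A B C) (p q e : ℂ) :
    DifferentiableOn ℂ (fun w => nullPairing (A w) (B w) (C w) p q e) (strip ρ) :=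
  (((h.differentiableOn_A.mul_const q).add (h.differentiableOn_B.mul_const p)).div_const 2).sub
    (h.differentiableOn_C.mul_const e)

/-- On the right of the axis, all planar projections of the data have the same winding number,
because they are homotopic to the projection `A` to a horizontal plane. -/
theorem hasWinding_nullPairing (h : IsNullData ρ A B C) {p q e : ℂ} (he : q * p = e ^ 2)
    (hpq : ‖p‖ < ‖q‖) {x : ℝ} (hx : 0 < x) (hxρ : x < ρ) {N : ℤ}
    (hN : HasWinding (fun t => A (x + t * Complex.I)) N) :
    HasWinding (fun t => nullPairing (A (x + t * Complex.I)) (B (x + t * Complex.I))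
      (C (x + t * Complex.I)) p q e) N := by
  have hmem : ∀ t : ℝ, (x + t * Complex.I : ℂ) ∈ strip ρ := fun t =>
    mem_strip_mk.2 (by rwa [abs_of_pos hx])
  have hcont : ∀ {F : ℂ → ℂ}, DifferentiableOn ℂ F (strip ρ) →
      Continuous fun z : ℝ × ℝ => F (x + z.2 * Complex.I) := fun hF =>
    hF.continuousOn.comp_continuous (by fun_prop) fun z => hmem z.2
  have hAc := hcont h.differentiableOn_A
  have hBc := hcont h.differentiableOn_B
  have hCc := hcont h.differentiableOn_C
  have hs1 : Continuous fun z : ℝ × ℝ => (z.1 : ℂ) := by fun_prop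
  have hcH : Continuous fun z : ℝ × ℝ => nullPairing (A (x + z.2 * Complex.I))
      (z.1 ^ 2 * B (x + z.2 * Complex.I)) (z.1 * C (x + z.2 * Complex.I)) p q e := by
    unfold nullPairing
    exact ((((hAc.mul continuous_const).add
      (((hs1.pow 2).mul hBc).mul continuous_const)).div_const 2).sub
      ((hs1.mul hCc).mul continuous_const))
  have hq : q ≠ 0 := by
    rintro rfl; rw [norm_zero] at hpq; exact absurd hpq (not_lt.2 (norm_nonneg p))
  have hper : ∀ t : ℝ, (x + ((t + 2 * Real.pi : ℝ) : ℂ) * Complex.I : ℂ)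
      = x + t * Complex.I + 2 * Real.pi * Complex.I := fun t => by push_cast; ring
  have h0 := hN.mul (hasWinding_const (a := q / 2) (by simpa using hq))
  rw [add_zero] at h0
  have := HasWinding.of_homotopy (n := N) (s := 0) (s' := 1)
    (H := fun s t => nullPairing (A (x + t * Complex.I)) (s ^ 2 * B (x + t * Complex.I))
      (s * C (x + t * Complex.I)) p q e)
    hcH.continuousOn
    (fun s hs t => nullPairing_deform_ne_zero (h.null _ (hmem t)) he
      (h.norm_lt_of_re_pos (hmem t) (by simpa using hx)) hpq hs)
    (fun s _ t => by simp only [hper, h.periodic_A, h.periodic_B, h.periodic_C]) (by simp) (by simp)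
    (by convert h0 using 2 with t; simp [nullPairing]; ring)
  simpa using this

end IsNullData

/-! ### Lorentz-orthonormal frames -/

/-- `(e₁, e₂, ν)` is a Lorentz-orthonormal frame, with `ν` timelike. -/
structure IsLorentzFrame (e₁ e₂ ν : L3) : Prop where
  inner_11 : lorentz e₁ e₁ = 1
  inner_22 : lorentz e₂ e₂ = 1
  inner_12 : lorentz e₁ e₂ = 0
  inner_1ν : lorentz e₁ ν = 0
  inner_2ν : lorentz e₂ ν = 0
  inner_νν : lorentz ν ν = -1

theorem lorentz_comm (x y : L3) : lorentz x y = lorentz y x := by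
  simp only [lorentz_apply]; ring

namespace IsLorentzFrame

variable {e₁ e₂ ν : L3}

theorem swap (h : IsLorentzFrame e₁ e₂ ν) : IsLorentzFrame e₂ e₁ ν :=
  ⟨h.2, h.1, by rw [lorentz_comm, h.3], h.5, h.4, h.6⟩

theorem neg_normal (h : IsLorentzFrame e₁ e₂ ν) : IsLorentzFrame e₁ e₂ (-ν) :=
  ⟨h.1, h.2, h.3, by simp [h.4], by simp [h.5], by simp [h.6]⟩

/-- The completeness relation of a Lorentz-orthonormal frame: the transpose of a Lorentz matrix is a
Lorentz matrix. -/
theorem completeness (h : IsLorentzFrame e₁ e₂ ν) :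
    e₁ 0 * e₁ 0 + e₂ 0 * e₂ 0 - ν 0 * ν 0 = 1 ∧ e₁ 1 * e₁ 1 + e₂ 1 * e₂ 1 - ν 1 * ν 1 = 1 ∧
    e₁ 2 * e₁ 2 + e₂ 2 * e₂ 2 - ν 2 * ν 2 = -1 ∧ e₁ 0 * e₁ 1 + e₂ 0 * e₂ 1 - ν 0 * ν 1 = 0 ∧
    e₁ 0 * e₁ 2 + e₂ 0 * e₂ 2 - ν 0 * ν 2 = 0 ∧ e₁ 1 * e₁ 2 + e₂ 1 * e₂ 2 - ν 1 * ν 2 = 0 := by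
  obtain ⟨h1, h2, h3, h4, h5, h6⟩ := h
  simp only [lorentz_apply] at h1 h2 h3 h4 h5 h6
  let M : Matrix (Fin 3) (Fin 3) ℝ := !![e₁ 0, e₁ 1, e₁ 2; e₂ 0, e₂ 1, e₂ 2; ν 0, ν 1, ν 2]
  let M' : Matrix (Fin 3) (Fin 3) ℝ :=
    !![e₁ 0, e₂ 0, -ν 0; e₁ 1, e₂ 1, -ν 1; -e₁ 2, -e₂ 2, ν 2]
  have hMM : M * M' = 1 := by
    ext i j
    fin_cases i <;> fin_cases j <;>
      simp [M, M', Matrix.mul_apply, Fin.sum_univ_three] <;> linarith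
  have hMM' := mul_eq_one_comm.1 hMM
  have key : ∀ i j, (M' * M) i j = (1 : Matrix (Fin 3) (Fin 3) ℝ) i j := fun i j => by rw [hMM']
  have k00 := key 0 0
  have k11 := key 1 1
  have k22 := key 2 2
  have k01 := key 0 1
  have k02 := key 0 2
  have k12 := key 1 2
  simp [M, M', Matrix.mul_apply, Fin.sum_univ_three] at k00 k11 k22 k01 k02 k12
  refine ⟨?_, ?_, ?_, ?_, ?_, ?_⟩ <;> linarith

theorem eq_sum (h : IsLorentzFrame e₁ e₂ ν) (x : L3) :
    x = lorentz x e₁ • e₁ + lorentz x e₂ • e₂ - lorentz x ν • ν := by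
  obtain ⟨h00, h11, h22, h01, h02, h12⟩ := h.completeness
  ext i
  simp only [Pi.sub_apply, Pi.add_apply, Pi.smul_apply, smul_eq_mul, lorentz_apply]
  fin_cases i <;> simp only [Fin.zero_eta, Fin.mk_one, Fin.reduceFinMk]
  · linear_combination -x 0 * h00 - x 1 * h01 + x 2 * h02
  · linear_combination -x 0 * h01 - x 1 * h11 + x 2 * h12
  · linear_combination -x 0 * h02 - x 1 * h12 + x 2 * h22

theorem ext_of_inner (h : IsLorentzFrame e₁ e₂ ν) {x : L3} (h1 : lorentz x e₁ = 0)
    (h2 : lorentz x e₂ = 0) (h3 : lorentz x ν = 0) : x = 0 := by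
  rw [h.eq_sum x, h1, h2, h3]; simp

end IsLorentzFrame

/-- A pair of Lorentz-orthonormal spacelike vectors can be completed by a cross product. -/
theorem exists_lorentzFrame {e₁ e₂ : L3} (h1 : lorentz e₁ e₁ = 1) (h2 : lorentz e₂ e₂ = 1)
    (h3 : lorentz e₁ e₂ = 0) : ∃ ν, IsLorentzFrame e₁ e₂ ν := by
  refine ⟨![e₁ 1 * e₂ 2 - e₁ 2 * e₂ 1, e₁ 2 * e₂ 0 - e₁ 0 * e₂ 2,
    -(e₁ 0 * e₂ 1 - e₁ 1 * e₂ 0)], h1, h2, h3, ?_, ?_, ?_⟩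
  · simp [lorentz_apply]; ring
  · simp [lorentz_apply]; ring
  · simp only [lorentz_apply] at h1 h2 h3 ⊢
    simp
    have key : ∀ a b c x y z : ℝ, (b * z - c * y) * (b * z - c * y)
        + (c * x - a * z) * (c * x - a * z) - (b * x - a * y) * (b * x - a * y)
        = (a * x + b * y - c * z) ^ 2
          - (a * a + b * b - c * c) * (x * x + y * y - z * z) := by intros; ring
    rw [key, h1, h2, h3]; norm_num

/-- A spacelike plane has an adapted Lorentz-orthonormal frame. -/
theorem IsSpacelikePlane.exists_frame {P : AffineSubspace ℝ L3} (hP : IsSpacelikePlane P) :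
    ∃ e₁ e₂ ν : L3, e₁ ∈ P.direction ∧ e₂ ∈ P.direction ∧ IsLorentzFrame e₁ e₂ ν ∧
      ∀ v, v ∈ P.direction ↔ lorentz v ν = 0 := by
  have normalize : ∀ v ∈ P.direction, v ≠ 0 → ∃ c : ℝ, c ≠ 0 ∧ lorentz (c • v) (c • v) = 1 := by
    intro v hv hv0
    have hpos := hP.posDef v hv hv0
    refine ⟨(√(lorentz v v))⁻¹, by positivity, ?_⟩
    simp only [map_smul, LinearMap.smul_apply, smul_eq_mul]
    rw [← mul_assoc, ← mul_inv, Real.mul_self_sqrt hpos.le, inv_mul_cancel₀ hpos.ne']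
  have hnt : ∃ v ∈ P.direction, v ≠ 0 := by
    by_contra! hcon
    have : P.direction = ⊥ := (Submodule.eq_bot_iff _).2 hcon
    have h2 := hP.finrank_eq
    rw [this] at h2
    simp at h2
  obtain ⟨v, hv, hv0⟩ := hnt
  obtain ⟨c, hc, hc1⟩ := normalize v hv hv0
  set e₁ := c • v with he₁
  have he₁m : e₁ ∈ P.direction := P.direction.smul_mem _ hv
  have hex : ∃ u ∈ P.direction, u - lorentz u e₁ • e₁ ≠ 0 := by
    by_contra! hcon
    have hle : P.direction ≤ Submodule.span ℝ {e₁} := fun u hu =>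
      Submodule.mem_span_singleton.2 ⟨lorentz u e₁, (sub_eq_zero.1 (hcon u hu)).symm⟩
    have h2 := (Submodule.finrank_mono hle).trans (finrank_span_le_card ({e₁} : Set L3))
    rw [hP.finrank_eq] at h2
    simp at h2
  obtain ⟨u, hu, hu0⟩ := hex
  have hum : u - lorentz u e₁ • e₁ ∈ P.direction :=
    P.direction.sub_mem hu (P.direction.smul_mem _ he₁m)
  obtain ⟨c', hc', hc1'⟩ := normalize _ hum hu0
  set e₂ := c' • (u - lorentz u e₁ • e₁) with he₂
  have he₂m : e₂ ∈ P.direction := P.direction.smul_mem _ hum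
  have h12 : lorentz e₁ e₂ = 0 := by
    rw [he₂, map_smul (lorentz e₁), map_sub (lorentz e₁), map_smul (lorentz e₁), hc1,
      lorentz_comm e₁ u]
    simp
  obtain ⟨ν, hν⟩ := exists_lorentzFrame hc1 hc1' h12
  have hspan : Submodule.span ℝ {e₁, e₂} = P.direction := by
    apply Submodule.eq_of_le_of_finrank_eq
    · rw [Submodule.span_le]
      rintro x (rfl | rfl)
      · exact he₁m
      · exact he₂m
    · have hli : LinearIndependent ℝ ![e₁, e₂] := by
        refine LinearIndependent.pair_iff.2 fun s t hst => ⟨?_, ?_⟩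
        · simpa [hν.inner_11, lorentz_comm e₂ e₁, h12] using congrArg (lorentz · e₁) hst
        · simpa [hν.inner_22, h12] using congrArg (lorentz · e₂) hst
      have hcard := finrank_span_eq_card hli
      rw [Matrix.range_cons, Matrix.range_cons, Matrix.range_empty, union_empty,
        singleton_union] at hcard
      rw [hP.finrank_eq, hcard, Fintype.card_fin]
  refine ⟨e₁, e₂, ν, he₁m, he₂m, hν, fun w => ⟨fun hw => ?_, fun hw => ?_⟩⟩
  · rw [← hspan, Submodule.mem_span_pair] at hw
    obtain ⟨a, b, rfl⟩ := hw
    simp [hν.inner_1ν, hν.inner_2ν]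
  · rw [hν.eq_sum w, hw, zero_smul, sub_zero]
    exact P.direction.add_mem (P.direction.smul_mem _ he₁m) (P.direction.smul_mem _ he₂m)

/-! ### The Weierstrass data on the strip -/

theorem exp_mem_openAnnulus_iff {r : ℝ} (hr : 0 < r) {w : ℂ} :
    Complex.exp w ∈ openAnnulus r (1 / r) ↔ w ∈ strip (-Real.log r) := by
  show r < ‖Complex.exp w‖ ∧ ‖Complex.exp w‖ < 1 / r ↔ |w.re| < -Real.log r
  rw [Complex.norm_exp, one_div, ← Real.log_lt_iff_lt_exp hr, ← Real.lt_log_iff_exp_lt (by positivity),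
    Real.log_inv, abs_lt, neg_neg]

theorem exp_axisReflection (w : ℂ) :
    Complex.exp (axisReflection w) = 1 / (starRingEnd ℂ) (Complex.exp w) := by
  rw [axisReflection, Complex.exp_neg, Complex.exp_conj, one_div]

theorem exp_add_two_pi_mul_I (w : ℂ) :
    Complex.exp (w + 2 * Real.pi * Complex.I) = Complex.exp w := by
  rw [Complex.exp_add, Complex.exp_two_pi_mul_I, mul_one]

theorem schwarzExtension_of_le (Y : ℂ → L3) (p₀ : L3) {z : ℂ} (hz : ‖z‖ ≤ 1) :
    schwarzExtension Y p₀ z = Y z := if_pos hz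

theorem schwarzExtension_inversion {Y : ℂ → L3} {p₀ : L3} (hY : ∀ z : ℂ, ‖z‖ = 1 → Y z = p₀)
    {z : ℂ} (hz : z ≠ 0) : schwarzExtension Y p₀ (1 / (starRingEnd ℂ) z)
      = (2 : ℝ) • p₀ - schwarzExtension Y p₀ z := by
  have hn : 0 < ‖z‖ := norm_pos_iff.2 hz
  have hnorm : ‖1 / (starRingEnd ℂ) z‖ = ‖z‖⁻¹ := by
    rw [norm_div, norm_one, RCLike.norm_conj, one_div]
  have hinv : 1 / (starRingEnd ℂ) (1 / (starRingEnd ℂ) z) = z := by simp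
  unfold schwarzExtension
  rw [hnorm, hinv]
  rcases lt_trichotomy ‖z‖ 1 with h | h | h
  · rw [if_neg (not_le.2 ((one_lt_inv₀ hn).2 h)), if_pos h.le]
  · have : ‖1 / (starRingEnd ℂ) z‖ = 1 := by rw [hnorm, h, inv_one]
    rw [if_pos (by rw [h, inv_one]), if_pos h.le, hY _ this, hY _ h, two_smul, add_sub_cancel_right]
  · rw [if_pos (inv_le_one_of_one_le₀ h.le), if_neg (not_le.2 h), sub_sub_cancel]

/-- The coefficient of the pull-back of the form `φ dz` by the exponential map. -/
def expPullback (φ : ℂ → ℂ) (w : ℂ) : ℂ := Complex.exp w * φ (Complex.exp w)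

theorem expPullback_periodic (φ : ℂ → ℂ) (w : ℂ) :
    expPullback φ (w + 2 * Real.pi * Complex.I) = expPullback φ w := by
  rw [expPullback, exp_add_two_pi_mul_I, expPullback]

theorem differentiableOn_expPullback {φ : ℂ → ℂ} {r : ℝ} (hr : 0 < r)
    (h : DifferentiableOn ℂ φ (openAnnulus r (1 / r))) :
    DifferentiableOn ℂ (expPullback φ) (strip (-Real.log r)) :=
  Complex.differentiable_exp.differentiableOn.mul
    (h.comp Complex.differentiable_exp.differentiableOn fun _ hw => (exp_mem_openAnnulus_iff hr).2 hw)

namespace IsWeierstrassData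

variable {Y : ℂ → L3} {p₀ : L3} {r : ℝ} {g : ℂ → ℂ} {φ : Fin 3 → ℂ → ℂ}

theorem hasFDerivAt_comp_exp (W : IsWeierstrassData Y p₀ r g φ) (hr : 0 < r) (j : Fin 3) {w : ℂ}
    (hw : w ∈ strip (-Real.log r)) :
    HasFDerivAt (fun w => schwarzExtension Y p₀ (Complex.exp w) j)
      (Complex.reCLM.comp (expPullback (φ j) w • ContinuousLinearMap.id ℝ ℂ)) w := by
  have h1 := W.hasFDerivAt j _ ((exp_mem_openAnnulus_iff hr).2 hw)
  have h2 := (Complex.hasDerivAt_exp w).hasFDerivAt.restrictScalars ℝ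
  refine (h1.comp w h2).congr_fderiv ?_
  ext
  · simp [expPullback]
    ring

theorem expPullback_axisReflection (W : IsWeierstrassData Y p₀ r g φ) (hr : 0 < r)
    (hY : ∀ z : ℂ, ‖z‖ = 1 → Y z = p₀) (j : Fin 3) {w : ℂ} (hw : w ∈ strip (-Real.log r)) :
    expPullback (φ j) (axisReflection w) = (starRingEnd ℂ) (expPullback (φ j) w) := by
  have h1 := W.hasFDerivAt_comp_exp hr j hw
  have h2 := W.hasFDerivAt_comp_exp hr j (axisReflection_mem_strip hw)
  have hrefl : HasFDerivAt axisReflection (-(Complex.conjCLE : ℂ →L[ℝ] ℂ)) w :=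
    (Complex.conjCLE : ℂ →L[ℝ] ℂ).hasFDerivAt.neg
  have h3 := h2.comp w hrefl
  have h4 : HasFDerivAt ((fun w => schwarzExtension Y p₀ (Complex.exp w) j) ∘ axisReflection)
      (-(Complex.reCLM.comp (expPullback (φ j) w • ContinuousLinearMap.id ℝ ℂ))) w := by
    refine (h1.const_sub (2 * p₀ j)).congr_of_eventuallyEq (Eventually.of_forall fun v => ?_)
    simp only [Function.comp_apply]
    rw [exp_axisReflection, schwarzExtension_inversion hY (Complex.exp_ne_zero v)]
    simp
  have h5 := h3.unique h4
  have e1 := DFunLike.congr_fun h5 1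
  have e2 := DFunLike.congr_fun h5 Complex.I
  simp at e1 e2
  apply Complex.ext
  · simpa using e1
  · simp; linarith

theorem eventually_relations (W : IsWeierstrassData Y p₀ r g φ) {z : ℂ}
    (hz : z ∈ openAnnulus r (1 / r)) : ∀ᶠ z in 𝓝[≠] z, g z ≠ 0 ∧
    φ 0 z = Complex.I / 2 * φ 2 z * (1 / g z - g z) ∧
    φ 1 z = -(1 / 2) * φ 2 z * (1 / g z + g z) := by
  have h1 := mem_codiscreteWithin.1 W.relations z hz
  have h2 : ∀ᶠ y in 𝓝[≠] z, y ∈ openAnnulus r (1 / r) :=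
    eventually_nhdsWithin_of_eventually_nhds ((isOpen_openAnnulus _ _).mem_nhds hz)
  filter_upwards [h2, disjoint_principal_right.1 h1] with y hy hy'
  by_contra hcon
  exact hy' ⟨hy, hcon⟩

theorem continuousAt (W : IsWeierstrassData Y p₀ r g φ) (j : Fin 3) {z : ℂ}
    (hz : z ∈ openAnnulus r (1 / r)) : ContinuousAt (φ j) z :=
  (W.holomorphic j).continuousOn.continuousAt ((isOpen_openAnnulus _ _).mem_nhds hz)

theorem analyticAt (W : IsWeierstrassData Y p₀ r g φ) (j : Fin 3) {z : ℂ}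
    (hz : z ∈ openAnnulus r (1 / r)) : AnalyticAt ℂ (φ j) z :=
  (W.holomorphic j).analyticAt ((isOpen_openAnnulus _ _).mem_nhds hz)

theorem sq_add_sq (W : IsWeierstrassData Y p₀ r g φ) {z : ℂ} (hz : z ∈ openAnnulus r (1 / r)) :
    φ 0 z ^ 2 + φ 1 z ^ 2 = φ 2 z ^ 2 := by
  have h : (fun z => φ 0 z ^ 2 + φ 1 z ^ 2) =ᶠ[𝓝[≠] z] fun z => φ 2 z ^ 2 := by
    filter_upwards [W.eventually_relations hz] with y ⟨hg, h0, h1⟩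
    rw [h0, h1]
    field_simp
    linear_combination (-(φ 2 y) ^ 2 * (1 - g y ^ 2) ^ 2) * (-Complex.I_sq)
  refine ((ContinuousAt.eventuallyEq_nhds_iff_eventuallyEq_nhdsNE ?_ ?_).1 h).self_of_nhds
  · exact ((W.continuousAt 0 hz).pow 2).add ((W.continuousAt 1 hz).pow 2)
  · exact (W.continuousAt 2 hz).pow 2

theorem expPullback_sq_add_sq (W : IsWeierstrassData Y p₀ r g φ) (hr : 0 < r) {w : ℂ}
    (hw : w ∈ strip (-Real.log r)) :
    expPullback (φ 0) w ^ 2 + expPullback (φ 1) w ^ 2 = expPullback (φ 2) w ^ 2 := by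
  have := W.sq_add_sq ((exp_mem_openAnnulus_iff hr).2 hw)
  simp only [expPullback]
  linear_combination (Complex.exp w) ^ 2 * this

/-- In the interior, the metric is positive. -/
theorem norm_sq_sub_pos (W : IsWeierstrassData Y p₀ r g φ) (hr1 : r < 1)
    (hr : 0 < r) {z : ℂ} (hz : z ∈ openAnnulus r 1) (hpos : 0 < inducedMetric Y z 1 1) :
    0 < ‖φ 0 z‖ ^ 2 + ‖φ 1 z‖ ^ 2 - ‖φ 2 z‖ ^ 2 := by
  have hz' : z ∈ openAnnulus r (1 / r) := ⟨hz.1, hz.2.trans (by rw [one_div]; exact (one_lt_inv₀ hr).2 hr1)⟩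
  have hev : ∀ᶠ y in 𝓝 z, schwarzExtension Y p₀ y = Y y := by
    filter_upwards [(isOpen_openAnnulus r 1).mem_nhds hz] with y hy
    exact schwarzExtension_of_le Y p₀ hy.2.le
  have hd : HasFDerivAt Y (ContinuousLinearMap.pi fun j =>
      Complex.reCLM.comp (φ j z • ContinuousLinearMap.id ℝ ℂ)) z := by
    rw [hasFDerivAt_pi']
    intro j
    refine ((W.hasFDerivAt j z hz').congr_of_eventuallyEq ?_).congr_fderiv ?_
    · filter_upwards [hev] with y hy
      rw [hy]
    · ext; simp
  rw [inducedMetric, hd.fderiv, lorentz_apply] at hpos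
  simp at hpos
  have h2 := congrArg Complex.re (W.sq_add_sq hz')
  simp [sq] at h2
  simp only [Complex.sq_norm, Complex.normSq_apply]
  nlinarith

end IsWeierstrassData

/-! ### The Gauss map on the circle and the orientation of the data -/

/-- A meromorphic function of modulus less than one inside the unit circle and greater than one
outside has no poles on the circle, and is unimodular there. -/
theorem analyticAt_and_norm_eq_one_of_norm_lt {G : ℂ → ℂ} {z₀ : ℂ} (hG : MeromorphicNFAt G z₀)
    (hz₀ : ‖z₀‖ = 1)
    (hlt : ∀ᶠ z in 𝓝[≠] z₀, (‖z‖ < 1 → ‖G z‖ < 1) ∧ (1 < ‖z‖ → 1 < ‖G z‖)) :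
    AnalyticAt ℂ G z₀ ∧ ‖G z₀‖ = 1 := by
  have hz0 : z₀ ≠ 0 := by rintro rfl; simp at hz₀
  have hT : Tendsto (fun s : ℝ => (s : ℂ) * z₀) (𝓝[≠] 1) (𝓝[≠] z₀) := by
    refine tendsto_nhdsWithin_iff.2 ⟨?_, ?_⟩
    · have : ContinuousAt (fun s : ℝ => (s : ℂ) * z₀) 1 := by fun_prop
      have h := this.tendsto
      simp only [Complex.ofReal_one, one_mul] at h
      exact h.mono_left nhdsWithin_le_nhds
    · filter_upwards [self_mem_nhdsWithin] with s hs h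
      exact hs (by simpa [hz0] using h)
  have hnorm : ∀ s : ℝ, 0 < s → ‖(s : ℂ) * z₀‖ = s := fun s hs => by
    rw [norm_mul, hz₀, mul_one, Complex.norm_real, Real.norm_of_nonneg hs.le]
  have hTl := hT.mono_left (nhdsLT_le_nhdsNE (1 : ℝ))
  have hTr := hT.mono_left (nhdsGT_le_nhdsNE (1 : ℝ))
  have hpos : ∀ᶠ s in 𝓝[<] (1 : ℝ), 0 < s :=
    eventually_nhdsWithin_of_eventually_nhds (lt_mem_nhds one_pos)
  have hl : ∀ᶠ s : ℝ in 𝓝[<] (1 : ℝ), ‖G ((s : ℂ) * z₀)‖ < 1 := by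
    filter_upwards [hTl.eventually hlt, hpos, self_mem_nhdsWithin] with s hs h0 h1
    exact hs.1 (by rw [hnorm s h0]; exact h1)
  have hr : ∀ᶠ s : ℝ in 𝓝[>] (1 : ℝ), 1 < ‖G ((s : ℂ) * z₀)‖ := by
    filter_upwards [hTr.eventually hlt, self_mem_nhdsWithin] with s hs h1
    exact hs.2 (by rw [hnorm s (one_pos.trans h1)]; exact h1)
  have han : AnalyticAt ℂ G z₀ := by
    rcases meromorphicNFAt_iff_analyticAt_or.1 hG with h | ⟨h, hord, -⟩
    · exact h
    · have h1 := (tendsto_norm_cobounded_atTop.comp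
        ((tendsto_cobounded_iff_meromorphicOrderAt_neg h).2 hord)).comp hTl
      obtain ⟨s, hs1, hs2⟩ := (hl.and (h1.eventually_gt_atTop 1)).exists
      exact absurd hs1 (not_lt.2 (le_of_lt hs2))
  have hc := han.continuousAt.norm.tendsto
  exact ⟨han, le_antisymm
    (le_of_tendsto ((hc.mono_left nhdsWithin_le_nhds).comp hTl) (hl.mono fun _ h => h.le))
    (ge_of_tendsto ((hc.mono_left nhdsWithin_le_nhds).comp hTr) (hr.mono fun _ h => h.le))⟩

/-- The third component of null data does not vanish identically near a point of the axis: otherwise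
all data would vanish on the axis. -/
theorem IsNullData.not_eventually_eq_zero {ρ : ℝ} {A B C : ℂ → ℂ} (h : IsNullData ρ A B C) (t : ℝ) :
    ¬ ∀ᶠ w in 𝓝 (t * Complex.I), C w = 0 := by
  intro h0
  have hconn : IsPreconnected (strip ρ) := by
    have : strip ρ = {w : ℂ | -ρ < w.re} ∩ {w : ℂ | w.re < ρ} := by
      ext w; exact abs_lt (a := w.re) (b := ρ)
    rw [this]
    exact ((convex_halfSpace_re_gt _).inter (convex_halfSpace_re_lt _)).isPreconnected
  have haxis : ∀ s : ℝ, (s * Complex.I : ℂ) ∈ strip ρ := fun s => by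
    simpa using (mem_strip_mk (x := 0) (t := s)).2 (by simpa using h.pos)
  have hC := (h.differentiableOn_C.analyticOnNhd (isOpen_strip ρ)).eqOn_zero_of_preconnected_of_eventuallyEq_zero
    hconn (haxis t) h0
  have hA : ∀ s : ℝ, A (s * Complex.I) = 0 := fun s => by
    have h1 := h.null _ (haxis s)
    have h2 := h.reflection_A _ (haxis s)
    rw [axisReflection_of_re_eq_zero (by simp)] at h2
    rw [hC (haxis s), h2] at h1
    rw [h2]
    simpa using h1
  have hA' : EqOn A 0 (strip ρ) := by
    refine (h.differentiableOn_A.analyticOnNhd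
      (isOpen_strip ρ)).eqOn_zero_of_preconnected_of_frequently_eq_zero hconn (haxis 0) ?_
    have hT : Tendsto (fun s : ℝ => (s * Complex.I : ℂ)) (𝓝[≠] 0) (𝓝[≠] ((0 : ℝ) * Complex.I)) := by
      refine tendsto_nhdsWithin_iff.2 ⟨?_, ?_⟩
      · exact (show Continuous fun s : ℝ => (s * Complex.I : ℂ) by fun_prop).continuousAt.tendsto.mono_left
          nhdsWithin_le_nhds
      · filter_upwards [self_mem_nhdsWithin] with s hs h
        exact hs (by simpa using h)
    exact hT.frequently (Eventually.of_forall hA).frequently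
  have hw : ((ρ / 2 : ℝ) : ℂ) ∈ strip ρ := by
    show |((ρ / 2 : ℝ) : ℂ).re| < ρ
    rw [Complex.ofReal_re, abs_of_pos (half_pos h.pos)]
    exact half_lt_self h.pos
  have := h.norm_lt_of_re_pos hw (by rw [Complex.ofReal_re]; exact half_pos h.pos)
  rw [hA' hw] at this
  rw [Pi.zero_apply, norm_zero] at this
  exact absurd this (not_lt.2 (norm_nonneg _))

namespace IsWeierstrassData

variable {Y : ℂ → L3} {p₀ : L3} {r : ℝ} {g : ℂ → ℂ} {φ : Fin 3 → ℂ → ℂ}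

/-- At points where the immersion is spacelike, the null forms `Φ₁ ± iΦ₂` have different moduli;
equality would make the induced metric vanish. -/
theorem norm_ne (W : IsWeierstrassData Y p₀ r g φ) (hr : 0 < r) (hr1 : r < 1)
    (hpos : ∀ z ∈ openAnnulus r 1, 0 < inducedMetric Y z 1 1) {w : ℂ}
    (hw : w ∈ strip (-Real.log r)) (hneg : w.re < 0) :
    ‖expPullback (φ 0) w + Complex.I * expPullback (φ 1) w‖
      ≠ ‖expPullback (φ 0) w - Complex.I * expPullback (φ 1) w‖ := by
  have hz : Complex.exp w ∈ openAnnulus r 1 :=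
    ⟨((exp_mem_openAnnulus_iff hr).2 hw).1, by rw [Complex.norm_exp]; exact Real.exp_lt_one_iff.2 hneg⟩
  have h1 := W.norm_sq_sub_pos hr1 hr hz (hpos _ hz)
  have h2 := W.expPullback_sq_add_sq hr hw
  set a := expPullback (φ 0) w
  set b := expPullback (φ 1) w
  have h3 : 0 < ‖a‖ ^ 2 + ‖b‖ ^ 2 - ‖expPullback (φ 2) w‖ ^ 2 := by
    have : 0 < ‖Complex.exp w‖ := norm_pos_iff.2 (Complex.exp_ne_zero w)
    simp only [a, b, expPullback, norm_mul]
    nlinarith [mul_pos (pow_pos this 2) h1]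
  intro heq
  have h4 : ‖a + Complex.I * b‖ * ‖a - Complex.I * b‖ = ‖expPullback (φ 2) w‖ ^ 2 := by
    rw [← norm_mul, ← norm_pow, ← h2]
    congr 1
    linear_combination (-b ^ 2) * Complex.I_sq
  have h5 := parallelogram_law_with_norm ℝ a (Complex.I * b)
  rw [norm_mul, Complex.norm_I, one_mul] at h5
  rw [heq] at h4 h5
  nlinarith

/-- The sign `σ = ± i` for which `|Φ₁ + σ Φ₂| < |Φ₁ - σ Φ₂|` on the left of the axis exists because
the left half of the strip is connected. -/
theorem exists_sign (W : IsWeierstrassData Y p₀ r g φ) (hr : 0 < r) (hr1 : r < 1)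
    (hpos : ∀ z ∈ openAnnulus r 1, 0 < inducedMetric Y z 1 1) :
    ∃ σ : ℂ, (σ = Complex.I ∨ σ = -Complex.I) ∧ ∀ w ∈ strip (-Real.log r), w.re < 0 →
      ‖expPullback (φ 0) w + σ * expPullback (φ 1) w‖
        < ‖expPullback (φ 0) w - σ * expPullback (φ 1) w‖ := by
  by_contra! hcon
  obtain ⟨w₁, hw₁, hn₁, h₁⟩ := hcon Complex.I (Or.inl rfl)
  obtain ⟨w₂, hw₂, hn₂, h₂⟩ := hcon (-Complex.I) (Or.inr rfl)
  rw [neg_mul, sub_neg_eq_add, ← sub_eq_add_neg] at h₂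
  let S : Set ℂ := {w : ℂ | Real.log r < w.re} ∩ {w : ℂ | w.re < 0}
  have hS : S ⊆ strip (-Real.log r) := fun w hw => by
    have h1 : Real.log r < w.re := hw.1
    have h2 : w.re < 0 := hw.2
    show |w.re| < -Real.log r
    rw [abs_of_neg h2]; linarith
  have hmem : ∀ w ∈ strip (-Real.log r), w.re < 0 → w ∈ S := fun w hw hn => by
    have h1 : |w.re| < -Real.log r := hw
    rw [abs_of_neg hn] at h1
    exact ⟨show Real.log r < w.re by linarith, hn⟩
  have hconn : IsPreconnected S :=
    ((convex_halfSpace_re_gt _).inter (convex_halfSpace_re_lt _)).isPreconnected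
  have hc := fun j => ((differentiableOn_expPullback hr (W.holomorphic j)).continuousOn.mono hS)
  obtain ⟨w, hw, heq⟩ := hconn.intermediate_value₂ (hmem _ hw₁ hn₁) (hmem _ hw₂ hn₂)
    ((hc 0).sub (continuousOn_const.mul (hc 1))).norm
    ((hc 0).add (continuousOn_const.mul (hc 1))).norm h₁ h₂
  exact W.norm_ne hr hr1 hpos (hS hw) hw.2 heq.symm

theorem isNullData (W : IsWeierstrassData Y p₀ r g φ) (hr : 0 < r) (hr1 : r < 1)
    (hY : ∀ z : ℂ, ‖z‖ = 1 → Y z = p₀) {σ : ℂ} (hσ : σ = Complex.I ∨ σ = -Complex.I)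
    (hlt : ∀ w ∈ strip (-Real.log r), w.re < 0 →
      ‖expPullback (φ 0) w + σ * expPullback (φ 1) w‖
        < ‖expPullback (φ 0) w - σ * expPullback (φ 1) w‖) :
    IsNullData (-Real.log r) (fun w => expPullback (φ 0) w + σ * expPullback (φ 1) w)
      (fun w => expPullback (φ 0) w - σ * expPullback (φ 1) w) (expPullback (φ 2)) := by
  have hσ2 : σ ^ 2 = -1 := by rcases hσ with rfl | rfl <;> simp
  have hσc : (starRingEnd ℂ) σ = -σ := by rcases hσ with rfl | rfl <;> simp
  have hd := fun j => differentiableOn_expPullback hr (W.holomorphic j)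
  exact
    { pos := by have := Real.log_neg hr hr1; linarith
      differentiableOn_A := (hd 0).add ((hd 1).const_mul σ)
      differentiableOn_B := (hd 0).sub ((hd 1).const_mul σ)
      differentiableOn_C := hd 2
      periodic_A := fun w => by simp only [expPullback_periodic]
      periodic_B := fun w => by simp only [expPullback_periodic]
      periodic_C := fun w => by simp only [expPullback_periodic]
      null := fun w hw => by
        linear_combination W.expPullback_sq_add_sq hr hw - (expPullback (φ 1) w) ^ 2 * hσ2
      reflection_A := fun w hw => by
        simp only [W.expPullback_axisReflection hr hY _ hw, map_sub, map_mul, hσc]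
        ring
      reflection_C := fun w hw => W.expPullback_axisReflection hr hY 2 hw
      norm_lt := hlt }

end IsWeierstrassData

namespace IsWeierstrassData

variable {Y : ℂ → L3} {p₀ : L3} {r : ℝ} {g : ℂ → ℂ} {φ : Fin 3 → ℂ → ℂ}

/-- The choice of the sign `σ` amounts to the choice between `g` and `1 / g` as the Gauss map; in both
cases `φ₁ + σφ₂ = -σ φ₃ G`. -/
theorem exists_gaussMap (W : IsWeierstrassData Y p₀ r g φ) {σ : ℂ}
    (hσ : σ = Complex.I ∨ σ = -Complex.I) :
    ∃ G : ℂ → ℂ, (G = g ∨ G = g⁻¹) ∧ ∀ z ∈ openAnnulus r (1 / r), MeromorphicNFAt G z ∧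
      ∀ᶠ y in 𝓝[≠] z, G y ≠ 0 ∧ φ 0 y + σ * φ 1 y = -σ * φ 2 y * G y ∧
        (φ 0 y - σ * φ 1 y) * G y = σ * φ 2 y := by
  rcases hσ with rfl | rfl
  · refine ⟨g, Or.inl rfl, fun z hz => ⟨W.meromorphic hz, ?_⟩⟩
    filter_upwards [W.eventually_relations hz] with y ⟨hg, h0, h1⟩
    refine ⟨hg, ?_, ?_⟩ <;> rw [h0, h1] <;> field_simp <;> ring
  · refine ⟨g⁻¹, Or.inr rfl, fun z hz => ⟨(W.meromorphic hz).inv, ?_⟩⟩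
    filter_upwards [W.eventually_relations hz] with y ⟨hg, h0, h1⟩
    refine ⟨by simpa using hg, ?_, ?_⟩ <;> rw [h0, h1, Pi.inv_apply] <;> field_simp <;> ring

/-- The Gauss map, or its inverse, maps the circle to itself, preserving the two sides. -/
theorem gaussMap_circle (W : IsWeierstrassData Y p₀ r g φ) (hr : 0 < r) (hr1 : r < 1) {σ : ℂ}
    (hN : IsNullData (-Real.log r) (fun w => expPullback (φ 0) w + σ * expPullback (φ 1) w)
      (fun w => expPullback (φ 0) w - σ * expPullback (φ 1) w) (expPullback (φ 2)))
    (hσ : σ = Complex.I ∨ σ = -Complex.I) {G : ℂ → ℂ}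
    (hG : ∀ z ∈ openAnnulus r (1 / r), MeromorphicNFAt G z ∧
      ∀ᶠ y in 𝓝[≠] z, G y ≠ 0 ∧ φ 0 y + σ * φ 1 y = -σ * φ 2 y * G y ∧
        (φ 0 y - σ * φ 1 y) * G y = σ * φ 2 y) {z : ℂ} (hz : z ∈ sphere (0 : ℂ) 1) :
    AnalyticAt ℂ G z ∧ ‖G z‖ = 1 ∧ ∀ᶠ y in 𝓝 z,
      ((‖y‖ < 1 → ‖G y‖ < 1) ∧ (1 < ‖y‖ → 1 < ‖G y‖)) ∧
      φ 0 y + σ * φ 1 y = -σ * φ 2 y * G y := by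
  have hσ1 : ‖σ‖ = 1 := by rcases hσ with rfl | rfl <;> simp
  have hz' := sphere_subset_openAnnulus hr hr1 hz
  have hz1 : ‖z‖ = 1 := by simpa using hz
  have hU : ∀ᶠ y in 𝓝[≠] z, y ∈ openAnnulus r (1 / r) :=
    eventually_nhdsWithin_of_eventually_nhds ((isOpen_openAnnulus _ _).mem_nhds hz')
  have hlt : ∀ᶠ y in 𝓝[≠] z, (‖y‖ < 1 → ‖G y‖ < 1) ∧ (1 < ‖y‖ → 1 < ‖G y‖) := by
    filter_upwards [hU, (hG z hz').2] with y hy ⟨_, h1, h2⟩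
    have hy0 : y ≠ 0 := by
      rintro rfl; have := hy.1; rw [norm_zero] at this; exact absurd this (not_lt.2 hr.le)
    have hyn : 0 < ‖y‖ := norm_pos_iff.2 hy0
    have hexp := Complex.exp_log hy0
    have hstrip : Complex.log y ∈ strip (-Real.log r) := (exp_mem_openAnnulus_iff hr).1 (by rwa [hexp])
    have hA : ‖expPullback (φ 0) (Complex.log y) + σ * expPullback (φ 1) (Complex.log y)‖
        = ‖y‖ * ‖φ 0 y + σ * φ 1 y‖ := by
      simp only [expPullback, hexp]; rw [← norm_mul]; congr 1; ring
    have hB : ‖expPullback (φ 0) (Complex.log y) - σ * expPullback (φ 1) (Complex.log y)‖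
        = ‖y‖ * ‖φ 0 y - σ * φ 1 y‖ := by
      simp only [expPullback, hexp]; rw [← norm_mul]; congr 1; ring
    have h3 : ‖φ 0 y + σ * φ 1 y‖ = ‖φ 0 y - σ * φ 1 y‖ * ‖G y‖ ^ 2 := by
      have : φ 0 y + σ * φ 1 y = -((φ 0 y - σ * φ 1 y) * G y ^ 2) := by
        linear_combination h1 + G y * h2
      rw [this, norm_neg, norm_mul, norm_pow]
    constructor
    · intro hlt
      have := hN.norm_lt _ hstrip (by rw [Complex.log_re]; exact Real.log_neg hyn hlt)
      simp only [hA, hB] at this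
      have h4 := lt_of_mul_lt_mul_left this hyn.le
      rw [h3] at h4
      by_contra hcon
      have h5 : 1 ≤ ‖G y‖ ^ 2 := one_le_pow₀ (not_lt.1 hcon)
      exact absurd h4 (not_lt.2 (le_mul_of_one_le_right (norm_nonneg _) h5))
    · intro hlt
      have := hN.norm_lt_of_re_pos hstrip (by rw [Complex.log_re]; exact Real.log_pos hlt)
      simp only [hA, hB] at this
      have h4 := lt_of_mul_lt_mul_left this hyn.le
      rw [h3] at h4
      by_contra hcon
      have h5 : ‖G y‖ ^ 2 ≤ 1 := pow_le_one₀ (norm_nonneg _) (not_lt.1 hcon)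
      exact absurd h4 (not_lt.2 (mul_le_of_le_one_right (norm_nonneg _) h5))
  obtain ⟨han, hn⟩ := analyticAt_and_norm_eq_one_of_norm_lt (hG z hz').1 hz1 hlt
  refine ⟨han, hn, ?_⟩
  have h1 : ∀ᶠ y in 𝓝 z, (‖y‖ < 1 → ‖G y‖ < 1) ∧ (1 < ‖y‖ → 1 < ‖G y‖) := by
    rw [eventually_nhdsWithin_iff] at hlt
    filter_upwards [hlt] with y hy
    by_cases hyz : y = z
    · rw [hyz, hz1]; exact ⟨fun h => absurd h (lt_irrefl _), fun h => absurd h (lt_irrefl _)⟩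
    · exact hy hyz
  refine h1.and ?_
  have hc0 := W.continuousAt 0 hz'
  have hc1 := W.continuousAt 1 hz'
  have hc2 := W.continuousAt 2 hz'
  exact (ContinuousAt.eventuallyEq_nhds_iff_eventuallyEq_nhdsNE
    (hc0.add (hc1.const_mul σ)) ((hc2.const_mul (-σ)).mul han.continuousAt)).1
    ((hG z hz').2.mono fun y hy => hy.2.1)

/-- The degree of the Gauss map, the number of zeros of the height differential, and the winding
number of a horizontal projection of the data. -/
theorem exists_nullData (W : IsWeierstrassData Y p₀ r g φ) (hr : 0 < r) (hr1 : r < 1)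
    (hY : ∀ z : ℂ, ‖z‖ = 1 → Y z = p₀)
    (hpos : ∀ z ∈ openAnnulus r 1, 0 < inducedMetric Y z 1 1) :
    ∃ (σ : ℂ) (d : ℤ) (m k : ℕ), (σ = Complex.I ∨ σ = -Complex.I) ∧
      IsNullData (-Real.log r) (fun w => expPullback (φ 0) w + σ * expPullback (φ 1) w)
        (fun w => expPullback (φ 0) w - σ * expPullback (φ 1) w) (expPullback (φ 2)) ∧
      HasCircleDegree g d ∧ m = d.natAbs ∧ 0 < m ∧ circleZeroCount (φ 2) = 2 * k ∧
      (k = 0 ↔ ∀ z ∈ sphere (0 : ℂ) 1, φ 2 z ≠ 0) ∧ (InjOn g (sphere 0 1) ↔ m = 1) ∧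
      ∃ ε > 0, ∀ x : ℝ, 0 < x → x < ε → HasWinding (fun t =>
        expPullback (φ 0) (x + t * Complex.I) + σ * expPullback (φ 1) (x + t * Complex.I))
          (m + k : ℕ) := by
  obtain ⟨σ, hσ, hlt⟩ := W.exists_sign hr hr1 hpos
  have hN := W.isNullData hr hr1 hY hσ hlt
  obtain ⟨G, hGg, hG⟩ := W.exists_gaussMap hσ
  have hcirc := fun z hz => W.gaussMap_circle hr hr1 hN hσ hG (z := z) hz
  obtain ⟨d, θ, hd, hθc, hθm, hθ, hθp, ε₁, hε₁, hw₁⟩ := exists_strictMono_angle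
    (fun z hz => (hcirc z hz).1) (fun z hz => (hcirc z hz).2.1)
    (eventually_nhdsSet_iff_forall.2 fun z hz => (hcirc z hz).2.2.mono fun y hy => hy.1)
  have hφ : AnalyticOnNhd ℂ (φ 2) (sphere 0 1) := fun z hz =>
    W.analyticAt 2 (sphere_subset_openAnnulus hr hr1 hz)
  have ho : ∀ z ∈ sphere (0 : ℂ) 1, analyticOrderAt (φ 2) z ≠ ⊤ := by
    intro z hz h0
    obtain ⟨t, -, rfl⟩ := exists_eq_exp_of_mem_sphere hz
    refine hN.not_eventually_eq_zero t ?_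
    have h1 := (Complex.continuous_exp.continuousAt (x := (t * Complex.I : ℂ))).eventually
      (analyticOrderAt_eq_top.1 h0)
    filter_upwards [h1] with w hw
    rw [expPullback, hw, mul_zero]
  obtain ⟨k, hk, hk0, ε₂, hε₂, hw₂⟩ := exists_circleZeroCount_eq_two_mul hφ ho (by
    filter_upwards [Ioo_mem_nhdsGT (show (0 : ℝ) < -Real.log r from hN.pos)] with x hx t
    have hmem : (x + t * Complex.I : ℂ) ∈ strip (-Real.log r) :=
      mem_strip_mk.2 (by rw [abs_of_pos hx.1]; exact hx.2)
    have := hN.reflection_C _ hmem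
    have hrefl : axisReflection (x + t * Complex.I) = -x + t * Complex.I := by
      apply Complex.ext <;> simp
    rw [hrefl] at this
    exact this)
  have hUU : {y | φ 0 y + σ * φ 1 y = -σ * φ 2 y * G y} ∈ 𝓝ˢ (sphere (0 : ℂ) 1) :=
    eventually_nhdsSet_iff_forall.2 fun z hz => (hcirc z hz).2.2.mono fun y hy => hy.2
  obtain ⟨U, hUo, hUs, hU⟩ := mem_nhdsSet_iff_exists.1 hUU
  obtain ⟨ε₃, hε₃, hw₃⟩ := exists_collar_subset hUo hUs
  have hσ0 : -σ ≠ 0 := by rcases hσ with rfl | rfl <;> simp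
  have hdeg : HasCircleDegree g (d : ℤ) ∨ HasCircleDegree g (-(d : ℤ)) := by
    rcases hGg with rfl | rfl
    · exact Or.inl ⟨θ, hθc, hθ, fun t => by rw [hθp]; simp⟩
    · refine Or.inr ⟨fun t => -θ t, hθc.neg, fun t => ?_, fun t => ?_⟩
      · have h1 : (g (Complex.exp (t * Complex.I)))⁻¹ = Complex.exp (θ t * Complex.I) := hθ t
        rw [← inv_inv (g _), h1, ← Complex.exp_neg]
        congr 1; push_cast; ring
      · simp only [hθp]; push_cast; ring
  have hinj : InjOn g (sphere 0 1) ↔ d = 1 := by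
    rw [← injOn_sphere_iff_degree_eq_one hd hθc hθm hθ hθp]
    rcases hGg with rfl | rfl
    · rfl
    · exact ⟨fun h x hx y hy hxy => h hx hy (inv_injective hxy),
        fun h x hx y hy hxy => h hx hy (congrArg (·⁻¹) hxy)⟩
  have key : ∃ D : ℤ, HasCircleDegree g D ∧ d = D.natAbs := by
    rcases hdeg with h | h
    · exact ⟨d, h, by simp⟩
    · exact ⟨-d, h, by simp⟩
  obtain ⟨D, hD, hDd⟩ := key
  refine ⟨σ, D, d, k, hσ, hN, hD, hDd, hd, hk, hk0, hinj, min ε₁ (min ε₂ ε₃), by positivity,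
    fun x hx hxε => ?_⟩
  have h1 := hw₁ x (by rw [abs_of_pos hx]; exact hxε.trans_le (min_le_left _ _))
  have h2 := hw₂ x hx (hxε.trans_le ((min_le_right _ _).trans (min_le_left _ _)))
  have h3 := ((hasWinding_const hσ0).mul h2).mul h1
  convert h3 using 1
  · ext t
    have h4 : φ 0 _ + σ * φ 1 _ = -σ * φ 2 _ * G _ := hU (hw₃ (x + t * Complex.I) (by
      simpa [abs_of_pos hx] using hxε.trans_le ((min_le_right _ _).trans (min_le_right _ _))))
    simp only [expPullback]
    linear_combination Complex.exp (x + t * Complex.I) * h4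
  · push_cast; ring

end IsWeierstrassData

/-! ### Planar maps of an annulus that reverse the orientation -/

/-- The real-linear map `v ↦ (a v + conj (b v)) / 2`; it reverses the orientation if
`|a| < |b|`. -/
def planarDifferential (a b : ℂ) : ℂ →L[ℝ] ℂ :=
  (1 / 2 : ℝ) • (a • ContinuousLinearMap.id ℝ ℂ
    + (Complex.conjCLE : ℂ →L[ℝ] ℂ).comp (b • ContinuousLinearMap.id ℝ ℂ))

theorem planarDifferential_apply (a b v : ℂ) :
    planarDifferential a b v = (a * v + (starRingEnd ℂ) (b * v)) / 2 := by
  simp [planarDifferential]; ring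

theorem norm_planarDifferential_ge (a b v : ℂ) :
    (‖b‖ - ‖a‖) / 2 * ‖v‖ ≤ ‖planarDifferential a b v‖ := by
  rw [planarDifferential_apply, norm_div, Complex.norm_ofNat]
  have h1 : ‖(starRingEnd ℂ) (b * v)‖ - ‖-(a * v)‖ ≤ ‖(starRingEnd ℂ) (b * v) - -(a * v)‖ :=
    norm_sub_norm_le _ _
  rw [norm_neg, RCLike.norm_conj, norm_mul, norm_mul, sub_neg_eq_add, add_comm _ (a * v)] at h1
  linarith

theorem planarDifferential_injective {a b : ℂ} (h : ‖a‖ < ‖b‖) :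
    Function.Injective (planarDifferential a b) := by
  rw [injective_iff_map_eq_zero]
  intro v hv
  have h1 := norm_planarDifferential_ge a b v
  rw [hv, norm_zero] at h1
  by_contra hne
  have : 0 < ‖v‖ := norm_pos_iff.2 hne
  nlinarith [mul_pos (half_pos (sub_pos.2 h)) this]

/-- An orientation reversing map `v ↦ (a v + conj (b v)) / 2`, as an equivalence. -/
def planarEquiv {a b : ℂ} (h : ‖a‖ < ‖b‖) : ℂ ≃L[ℝ] ℂ :=
  (LinearEquiv.ofInjectiveEndo (planarDifferential a b : ℂ →ₗ[ℝ] ℂ)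
    (planarDifferential_injective h)).toContinuousLinearEquiv

theorem coe_planarEquiv {a b : ℂ} (h : ‖a‖ < ‖b‖) :
    (planarEquiv h : ℂ →L[ℝ] ℂ) = planarDifferential a b := by
  exact ContinuousLinearMap.ext fun _ => rfl

theorem hasPosZero_conj {f : ℂ → ℂ} {a b z : ℂ} (h : ‖a‖ < ‖b‖)
    (hf : HasFDerivAt f (planarDifferential a b) z) :
    HasPosZero (fun w => (starRingEnd ℂ) (f w - f z)) z := by
  refine ⟨b / 2, (‖a‖ + ‖b‖) / 4, ?_, ?_⟩
  · rw [norm_div, Complex.norm_ofNat]; linarith [norm_nonneg a]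
  have h1 := hf.isLittleO.def (c := (‖b‖ - ‖a‖) / 4) (by linarith)
  filter_upwards [nhdsWithin_le_nhds h1, self_mem_nhdsWithin] with w hw hne
  have hv : w - z ≠ 0 := sub_ne_zero.2 hne
  have hvn : 0 < ‖w - z‖ := norm_pos_iff.2 hv
  have e1 : (starRingEnd ℂ) (f w - f z) / (w - z) - b / 2
      = ((starRingEnd ℂ) (f w - f z - planarDifferential a b (w - z))
        + (starRingEnd ℂ) (a * (w - z)) / 2) / (w - z) := by
    rw [planarDifferential_apply]
    simp only [map_sub, map_div₀, map_add, Complex.conj_conj, map_ofNat]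
    field_simp
    ring
  rw [e1, norm_div, div_le_iff₀ hvn]
  refine (norm_add_le _ _).trans ?_
  rw [RCLike.norm_conj, norm_div, RCLike.norm_conj, norm_mul, Complex.norm_ofNat]
  nlinarith

/-- A continuous map `f` of the annulus `r < |z| ≤ 1` to the plane that contracts the unit circle to
the origin, is an orientation reversing local diffeomorphism in the interior, has no zeros in the
collar `r₁ < |z| < 1`, and has winding number `N` on the circles there. -/
structure IsPlanarBranch (f : ℂ → ℂ) (r r₁ : ℝ) (N : ℕ) : Prop where
  r_pos : 0 < r
  r_lt : r < r₁
  lt_one : r₁ < 1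
  continuousOn : ContinuousOn f (outerClosedAnnulus r)
  circle : ∀ z : ℂ, ‖z‖ = 1 → f z = 0
  hasStrictFDerivAt : ∀ z ∈ openAnnulus r 1, ∃ a b : ℂ, ‖a‖ < ‖b‖ ∧
    HasStrictFDerivAt f (planarDifferential a b) z
  ne_zero : ∀ z ∈ openAnnulus r₁ 1, f z ≠ 0
  hasWinding : ∀ ρ : ℝ, r₁ < ρ → ρ < 1 →
    HasWinding (fun t => f (ρ * Complex.exp (t * Complex.I))) N

theorem openAnnulus_mono {a a' b : ℝ} (h : a ≤ a') : openAnnulus a' b ⊆ openAnnulus a b :=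
  fun _ hz => ⟨h.trans_lt hz.1, hz.2⟩

namespace IsPlanarBranch

variable {f : ℂ → ℂ} {r r₁ : ℝ} {N : ℕ}

theorem map_nhds (h : IsPlanarBranch f r r₁ N) {z : ℂ} (hz : z ∈ openAnnulus r 1) :
    map f (𝓝 z) = 𝓝 (f z) := by
  obtain ⟨a, b, hab, hd⟩ := h.hasStrictFDerivAt z hz
  rw [← coe_planarEquiv hab] at hd
  exact hd.map_nhds_eq_of_equiv

theorem isLocalHomeomorphOn (h : IsPlanarBranch f r r₁ N) :
    IsLocalHomeomorphOn f (openAnnulus r 1) := by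
  refine IsLocalHomeomorphOn.mk f _ fun z hz => ?_
  obtain ⟨a, b, hab, hd⟩ := h.hasStrictFDerivAt z hz
  rw [← coe_planarEquiv hab] at hd
  exact ⟨hd.toOpenPartialHomeomorph f, hd.mem_toOpenPartialHomeomorph_source, fun _ _ => rfl⟩

theorem hasPosZero (h : IsPlanarBranch f r r₁ N) {z : ℂ} (hz : z ∈ openAnnulus r 1) :
    HasPosZero (fun w => (starRingEnd ℂ) (f w - f z)) z := by
  obtain ⟨a, b, hab, hd⟩ := h.hasStrictFDerivAt z hz
  exact hasPosZero_conj hab hd.hasFDerivAt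

theorem eventually_ne (h : IsPlanarBranch f r r₁ N) {z : ℂ} (hz : z ∈ openAnnulus r 1) :
    ∀ᶠ w in 𝓝[≠] z, f w ≠ f z := by
  obtain ⟨a, b, hab, hd⟩ := h.hasStrictFDerivAt z hz
  rw [← coe_planarEquiv hab] at hd
  exact hd.hasFDerivAt.eventually_ne ⟨_, (planarEquiv hab).antilipschitz⟩

theorem isCompact_closedAnnulus (ρ : ℝ) : IsCompact {z : ℂ | ρ ≤ ‖z‖ ∧ ‖z‖ ≤ 1} := by
  refine (isCompact_closedBall (0 : ℂ) 1).of_isClosed_subset ?_ fun z hz => by simpa using hz.2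
  exact (isClosed_le continuous_const continuous_norm).inter
    (isClosed_le continuous_norm continuous_const)

theorem continuousOn_closedAnnulus (h : IsPlanarBranch f r r₁ N) {ρ : ℝ} (hρ : r < ρ) :
    ContinuousOn f {z : ℂ | ρ ≤ ‖z‖ ∧ ‖z‖ ≤ 1} :=
  h.continuousOn.mono fun _ hz => ⟨hρ.trans_le hz.1, hz.2⟩

/-- By the argument principle, every small value is taken as often as the winding number
says. -/
theorem encard_preimage (h : IsPlanarBranch f r r₁ N) {ρ : ℝ} (hρ : r₁ < ρ) (hρ1 : ρ < 1)
    {y : ℂ} (hy : y ≠ 0) (hlt : ∀ z : ℂ, ‖z‖ = ρ → ‖y‖ < ‖f z‖) :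
    {z | z ∈ openAnnulus ρ 1 ∧ f z = y}.encard = N := by
  have hρ0 : 0 < ρ := h.r_pos.trans (h.r_lt.trans hρ)
  have hrρ : r < ρ := h.r_lt.trans hρ
  set S := {z | z ∈ openAnnulus ρ 1 ∧ f z = y} with hS
  have hSeq : S = {z : ℂ | ρ ≤ ‖z‖ ∧ ‖z‖ ≤ 1} ∩ f ⁻¹' {y} := by
    ext z
    constructor
    · rintro ⟨hz, hfz⟩; exact ⟨⟨hz.1.le, hz.2.le⟩, hfz⟩
    · rintro ⟨hz, hfz⟩
      have hfz : f z = y := hfz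
      refine ⟨⟨lt_of_le_of_ne hz.1 fun h1 => ?_, lt_of_le_of_ne hz.2 fun h1 => ?_⟩, hfz⟩
      · have := hlt z h1.symm; rw [hfz] at this; exact lt_irrefl _ this
      · exact hy (by rw [← hfz, h.circle z h1])
  have hcomp : IsCompact S := by
    rw [hSeq]
    exact (isCompact_closedAnnulus ρ).of_isClosed_subset
      ((h.continuousOn_closedAnnulus hrρ).preimage_isClosed_of_isClosed
        (isCompact_closedAnnulus ρ).isClosed isClosed_singleton) inter_subset_left
  have hfin : S.Finite := by
    refine hcomp.finite ?_
    rw [isDiscrete_iff_nhdsNE]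
    intro z hz
    have h1 := h.eventually_ne (openAnnulus_mono hrρ.le hz.1)
    rw [← disjoint_iff, disjoint_principal_right]
    filter_upwards [h1] with w hw hwS
    exact hw (hwS.2.trans hz.2.symm)
  let Z := hfin.toFinset
  have hZ : ∀ z, z ∈ Z ↔ z ∈ S := fun z => hfin.mem_toFinset
  have key := hasWinding_annulus hρ0 hρ1 Z (F := fun z => (starRingEnd ℂ) (f z - y))
    (Complex.continuous_conj.comp_continuousOn
      ((h.continuousOn_closedAnnulus hrρ).sub continuousOn_const))
    (fun z h1 h2 h3 => by
      rw [hZ, hSeq]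
      exact ⟨⟨h1, h2⟩, sub_eq_zero.1 ((map_eq_zero _).1 h3)⟩)
    (fun z hz => by
      rw [hZ] at hz
      refine ⟨hz.1.1, hz.1.2, by rw [hz.2]; simp, ?_⟩
      have := h.hasPosZero (openAnnulus_mono hrρ.le hz.1)
      rwa [hz.2] at this)
    (n₁ := -(N : ℤ)) (n₂ := 0)
    (by
      have h1 : HasWinding (fun t => f (ρ * Complex.exp (t * Complex.I)) - y) N := by
        refine (h.hasWinding ρ hρ hρ1).of_norm_sub_lt ?_ ?_ ?_
        · refine Continuous.sub ?_ continuous_const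
          exact (h.hasWinding ρ hρ hρ1).continuous
        · intro t
          rw [(h.hasWinding ρ hρ hρ1).periodic t]
        · intro t
          have := hlt (ρ * Complex.exp (t * Complex.I)) (by
            rw [norm_mul, Complex.norm_exp_ofReal_mul_I, mul_one, Complex.norm_real,
              Real.norm_of_nonneg hρ0.le])
          simpa using this
      exact h1.conj)
    (by
      convert hasWinding_const (a := (starRingEnd ℂ) (-y)) (by simpa using hy) using 2 with t
      rw [h.circle _ (by simp [Complex.norm_exp_ofReal_mul_I]), zero_sub])
  have hcard : Z.card = N := by omega
  rw [← hfin.coe_toFinset, Set.encard_coe_eq_coe_finsetCard]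
  exact_mod_cast hcard

end IsPlanarBranch

/-! ### Small level sets and the covering property -/

/-- A connected part `K` of `S` that is cut off from the rest of `S` by disjoint open sets is the
connected component of its points. -/
theorem connectedComponentIn_eq_of_separation {X : Type*} [TopologicalSpace X] {S K : Set X} {x : X}
    (hK : IsPreconnected K) (hKS : K ⊆ S) (hx : x ∈ K) {U V : Set X} (hU : IsOpen U)
    (hV : IsOpen V) (hUV : Disjoint U V) (hS : S ⊆ U ∪ V) (hSV : S ∩ V ⊆ K) (hxV : x ∈ V) :
    connectedComponentIn S x = K := by
  apply Subset.antisymm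
  · have h1 := connectedComponentIn_subset S x
    have h2 : connectedComponentIn S x ⊆ V :=
      isPreconnected_connectedComponentIn.subset_right_of_subset_union hU hV hUV
        (h1.trans hS) ⟨x, mem_connectedComponentIn (hKS hx), hxV⟩
    exact fun z hz => hSV ⟨h1 hz, h2 hz⟩
  · exact hK.subset_connectedComponentIn hx hKS

namespace IsPlanarBranch

variable {f : ℂ → ℂ} {r r₁ : ℝ} {N : ℕ}

theorem exists_pos_forall_lt_norm (h : IsPlanarBranch f r r₁ N) {a b : ℝ} (ha : r₁ < a)
    (hb : b < 1) : ∃ m : ℝ, 0 < m ∧ ∀ z : ℂ, a ≤ ‖z‖ → ‖z‖ ≤ b → m < ‖f z‖ := by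
  have hK : IsCompact {z : ℂ | a ≤ ‖z‖ ∧ ‖z‖ ≤ b} :=
    (isCompact_closedAnnulus a).of_isClosed_subset
      ((isClosed_le continuous_const continuous_norm).inter
        (isClosed_le continuous_norm continuous_const)) fun z hz => ⟨hz.1, hz.2.trans hb.le⟩
  rcases eq_empty_or_nonempty {z : ℂ | a ≤ ‖z‖ ∧ ‖z‖ ≤ b} with he | hne
  · exact ⟨1, one_pos, fun z h1 h2 => absurd (show z ∈ {z : ℂ | a ≤ ‖z‖ ∧ ‖z‖ ≤ b} from ⟨h1, h2⟩)
      (by rw [he]; exact notMem_empty z)⟩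
  · obtain ⟨z₀, hz₀, hmin⟩ := hK.exists_isMinOn hne (h.continuousOn.norm.mono fun z hz =>
      ⟨h.r_lt.trans (ha.trans_le hz.1), hz.2.trans hb.le⟩)
    have hm : 0 < ‖f z₀‖ :=
      norm_pos_iff.2 (h.ne_zero z₀ ⟨ha.trans_le hz₀.1, hz₀.2.trans_lt hb⟩)
    exact ⟨‖f z₀‖ / 2, half_pos hm, fun z h1 h2 =>
      (half_lt_self hm).trans_le (hmin (show z ∈ {z : ℂ | a ≤ ‖z‖ ∧ ‖z‖ ≤ b} from ⟨h1, h2⟩))⟩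

/-- Near the unit circle, the map is small. -/
theorem exists_forall_norm_lt (h : IsPlanarBranch f r r₁ N) {a s : ℝ} (ha : r < a) (ha1 : a < 1)
    (hs : 0 < s) : ∃ b, a < b ∧ b < 1 ∧ ∀ z : ℂ, b ≤ ‖z‖ → ‖z‖ ≤ 1 → ‖f z‖ < s := by
  have hK : IsCompact ({z : ℂ | a ≤ ‖z‖ ∧ ‖z‖ ≤ 1} ∩ {z | s ≤ ‖f z‖}) :=
    (isCompact_closedAnnulus a).of_isClosed_subset
      ((h.continuousOn_closedAnnulus ha).norm.preimage_isClosed_of_isClosed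
        (isCompact_closedAnnulus a).isClosed isClosed_Ici) inter_subset_left
  rcases eq_empty_or_nonempty ({z : ℂ | a ≤ ‖z‖ ∧ ‖z‖ ≤ 1} ∩ {z | s ≤ ‖f z‖}) with he | hne
  · obtain ⟨b, hb, hb1⟩ := exists_between ha1
    refine ⟨b, hb, hb1, fun z h1 h2 => ?_⟩
    by_contra hcon
    have : z ∈ ({z : ℂ | a ≤ ‖z‖ ∧ ‖z‖ ≤ 1} ∩ {z | s ≤ ‖f z‖}) :=
      ⟨⟨hb.le.trans h1, h2⟩, not_lt.1 hcon⟩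
    rw [he] at this; exact this
  · obtain ⟨z₀, hz₀, hmax⟩ := hK.exists_isMaxOn hne continuous_norm.continuousOn
    have h0 : ‖z₀‖ < 1 := lt_of_le_of_ne hz₀.1.2 fun h1 => by
      have h2 : s ≤ ‖f z₀‖ := hz₀.2
      rw [h.circle z₀ h1, norm_zero] at h2
      exact absurd hs (not_lt.2 h2)
    obtain ⟨b, hb, hb1⟩ := exists_between h0
    refine ⟨b, hz₀.1.1.trans_lt hb, hb1, fun z h1 h2 => ?_⟩
    by_contra hcon
    have h3 : ‖z‖ ≤ ‖z₀‖ := hmax ⟨⟨hz₀.1.1.trans (hb.le.trans h1), h2⟩, not_lt.1 hcon⟩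
    linarith

/-- The set of points `ρ ≤ |z| ≤ 1` where `|f| ≤ s` is connected, if it does not meet `|z| = ρ`: on
a component not containing the unit circle, `|f|` would attain a positive minimum, which is
impossible for an open map. -/
theorem isPreconnected_sublevel (h : IsPlanarBranch f r r₁ N) {ρ s : ℝ} (hρ : r₁ < ρ)
    (hρ1 : ρ < 1) (hs : 0 ≤ s) (hlt : ∀ z : ℂ, ‖z‖ = ρ → s < ‖f z‖) :
    IsPreconnected {z : ℂ | (ρ ≤ ‖z‖ ∧ ‖z‖ ≤ 1) ∧ ‖f z‖ ≤ s} := by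
  have hrρ : r < ρ := h.r_lt.trans hρ
  set K := {z : ℂ | (ρ ≤ ‖z‖ ∧ ‖z‖ ≤ 1) ∧ ‖f z‖ ≤ s} with hK
  have hcont := h.continuousOn_closedAnnulus hrρ
  have hKc : IsCompact K := (isCompact_closedAnnulus ρ).of_isClosed_subset
    (hcont.norm.preimage_isClosed_of_isClosed (isCompact_closedAnnulus ρ).isClosed isClosed_Iic)
    inter_subset_left
  have hsph : sphere (0 : ℂ) 1 ⊆ K := by
    intro z hz
    have hz1 : ‖z‖ = 1 := by simpa using hz
    refine ⟨⟨?_, hz1.le⟩, by rw [h.circle z hz1, norm_zero]; exact hs⟩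
    rw [hz1]; exact hρ1.le
  have hcirc : IsPreconnected (sphere (0 : ℂ) 1) := by
    refine isPreconnected_sphere ?_ 0 1
    rw [Complex.rank_real_complex]; norm_num
  have key : ∀ t t' : Set ℂ, IsClosed t → IsClosed t' → K ⊆ t ∪ t' → K ∩ (t ∩ t') = ∅ →
      sphere (0 : ℂ) 1 ⊆ t → ¬ (K ∩ t').Nonempty := by
    intro t t' ht ht' hcov hdis hst hne
    obtain ⟨z, hz, hmin⟩ := (hKc.inter_right ht').exists_isMinOn hne
      (hcont.norm.mono fun z hz => hz.1.1)
    have hzt : z ∉ t := fun hzt => by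
      have : z ∈ K ∩ (t ∩ t') := ⟨hz.1, hzt, hz.2⟩
      rw [hdis] at this; exact this
    have hz1 : ‖z‖ < 1 := lt_of_le_of_ne hz.1.1.2 fun h1 => hzt (hst (by simpa using h1))
    have hzρ : ρ < ‖z‖ := lt_of_le_of_ne hz.1.1.1 fun h1 =>
      absurd hz.1.2 (not_le.2 (hlt z h1.symm))
    have hf0 := h.ne_zero z ⟨hρ.trans hzρ, hz1⟩
    -- near `z` the map takes the values `(1 - δ) f z`
    have hsmall : ∃ᶠ w in 𝓝 z, ‖f w‖ < ‖f z‖ := by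
      have hT : Tendsto (fun δ : ℝ => ((1 - δ : ℝ) : ℂ) * f z) (𝓝[>] 0) (𝓝 (f z)) := by
        have : Continuous fun δ : ℝ => ((1 - δ : ℝ) : ℂ) * f z := by fun_prop
        simpa using (this.tendsto 0).mono_left nhdsWithin_le_nhds
      have h2 : ∃ᶠ y in 𝓝 (f z), ‖y‖ < ‖f z‖ := by
        refine hT.frequently (Eventually.frequently ?_)
        filter_upwards [Ioo_mem_nhdsGT (zero_lt_one (α := ℝ))] with δ hδ
        rw [norm_mul, Complex.norm_real, Real.norm_of_nonneg (by linarith [hδ.2])]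
        have := norm_pos_iff.2 hf0
        nlinarith [hδ.1]
      rw [← h.map_nhds ⟨hrρ.trans hzρ, hz1⟩, frequently_map] at h2
      exact h2
    have hev : ∀ᶠ w in 𝓝 z, w ∉ t ∧ w ∈ openAnnulus ρ 1 :=
      (show ∀ᶠ w in 𝓝 z, w ∈ tᶜ from ht.isOpen_compl.mem_nhds hzt).and
        ((isOpen_openAnnulus ρ 1).mem_nhds ⟨hzρ, hz1⟩)
    obtain ⟨w, hw1, hw2, hw3⟩ := (hsmall.and_eventually hev).exists
    have hwK : w ∈ K := ⟨⟨hw3.1.le, hw3.2.le⟩, hw1.le.trans hz.1.2⟩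
    have hwt' : w ∈ t' := (hcov hwK).resolve_left hw2
    exact absurd (hmin ⟨hwK, hwt'⟩) (not_le.2 hw1)
  rw [isPreconnected_closed_iff]
  intro t t' ht ht' hcov hn hn'
  by_contra hcon
  rw [not_nonempty_iff_eq_empty] at hcon
  rw [isPreconnected_closed_iff] at hcirc
  by_cases hA : (sphere (0 : ℂ) 1 ∩ t').Nonempty
  · by_cases hB : (sphere (0 : ℂ) 1 ∩ t).Nonempty
    · obtain ⟨w, hw, hw'⟩ := hcirc t t' ht ht' (hsph.trans hcov) hB hA
      have : w ∈ K ∩ (t ∩ t') := ⟨hsph hw, hw'⟩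
      rw [hcon] at this; exact this
    · refine key t' t ht' ht (by rwa [union_comm]) (by rwa [inter_comm t']) ?_ hn
      intro w hw
      exact (hcov (hsph hw)).resolve_left fun hwt => hB ⟨w, hw, hwt⟩
  · refine key t t' ht ht' hcov hcon ?_ hn'
    intro w hw
    exact (hcov (hsph hw)).resolve_right fun hwt => hA ⟨w, hw, hwt⟩

/-- The part of the collar where `|f| ≤ s` covers the punctured disc of radius `s`. -/
theorem isCoveringMap_restrict (h : IsPlanarBranch f r r₁ N) {ρ s : ℝ} (hρ : r₁ < ρ)
    (hlt : ∀ z : ℂ, ‖z‖ = ρ → s < ‖f z‖) :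
    ∃ hf : MapsTo f {z : ℂ | z ∈ openAnnulus ρ 1 ∧ ‖f z‖ ≤ s} (closedBall 0 s \ {0}),
      IsCoveringMap (hf.restrict f _ _) := by
  have hrρ : r < ρ := h.r_lt.trans hρ
  have hmaps : MapsTo f {z : ℂ | z ∈ openAnnulus ρ 1 ∧ ‖f z‖ ≤ s} (closedBall 0 s \ {0}) :=
    fun z hz => ⟨by simpa using hz.2, h.ne_zero z (openAnnulus_mono hρ.le hz.1)⟩
  refine ⟨hmaps, ?_⟩
  let K := {z : ℂ | ρ ≤ ‖z‖ ∧ ‖z‖ ≤ 1}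
  have : CompactSpace K := isCompact_iff_compactSpace.1 (isCompact_closedAnnulus ρ)
  let f' : K → ℂ := f ∘ Subtype.val
  have hf'c : Continuous f' :=
    continuousOn_iff_continuous_domRestrict.1 (h.continuousOn_closedAnnulus hrρ)
  let T : Set ℂ := closedBall 0 s \ {0}
  have hmem : ∀ z : K, f' z ∈ T → (z : ℂ) ∈ openAnnulus ρ 1 := by
    intro z hz
    have h1 : ‖f z‖ ≤ s := mem_closedBall_zero_iff.1 hz.1
    refine ⟨lt_of_le_of_ne z.2.1 fun h2 => ?_, lt_of_le_of_ne z.2.2 fun h2 => ?_⟩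
    · exact absurd h1 (not_le.2 (hlt z h2.symm))
    · exact hz.2 (h.circle z h2)
  have hval : IsLocalHomeomorphOn (Subtype.val : K → ℂ) (f' ⁻¹' T) := by
    rw [isLocalHomeomorphOn_iff_isOpenEmbedding_restrict]
    intro z hz
    refine ⟨Subtype.val ⁻¹' openAnnulus ρ 1,
      ((isOpen_openAnnulus ρ 1).preimage continuous_subtype_val).mem_nhds (hmem z hz), ?_⟩
    refine ⟨IsEmbedding.subtypeVal.comp IsEmbedding.subtypeVal, ?_⟩
    have : range ((Subtype.val ⁻¹' openAnnulus ρ 1).domRestrict (Subtype.val : K → ℂ))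
        = openAnnulus ρ 1 := by
      ext w
      constructor
      · rintro ⟨v, rfl⟩; exact v.2
      · exact fun hw => ⟨⟨⟨w, hw.1.le, hw.2.le⟩, hw⟩, rfl⟩
    rw [this]
    exact isOpen_openAnnulus ρ 1
  have hloc : IsLocalHomeomorphOn f' (f' ⁻¹' T) :=
    h.isLocalHomeomorphOn.comp hval fun z hz => openAnnulus_mono hrρ.le (hmem z hz)
  have hcov := (IsCoveringMapOn.of_isLocalHomeomorphOn hf'c hloc).isCoveringMap_restrictPreimage
  let e : {z : ℂ | z ∈ openAnnulus ρ 1 ∧ ‖f z‖ ≤ s} ≃ₜ f' ⁻¹' T :=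
    { toFun := fun z => ⟨⟨z, z.2.1.1.le, z.2.1.2.le⟩, hmaps z.2⟩
      invFun := fun z => ⟨z, hmem z.1 z.2, mem_closedBall_zero_iff.1 z.2.1⟩
      left_inv := fun z => rfl
      right_inv := fun z => rfl
      continuous_toFun := by fun_prop
      continuous_invFun := by fun_prop }
  exact hcov.comp_homeomorph e

end IsPlanarBranch

/-- Transport of a covering of a plane set along an embedding `Θ` of the plane. -/
theorem isCoveringOfDegree_of_eqOn {F : ℂ → L3} {f : ℂ → ℂ} {E : Set ℂ} {T : Set ℂ} {N : ℕ}
    (Θ : ℂ → L3) (hΘ : IsEmbedding Θ) (hF : ∀ z ∈ E, F z = Θ (f z)) (hf : MapsTo f E T)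
    (hcov : IsCoveringMap (hf.restrict f E T))
    (hcard : ∀ y ∈ T, {z | z ∈ E ∧ f z = y}.encard = N) :
    IsCoveringOfDegree F E (Θ '' T) N := by
  have hmaps : MapsTo F E (Θ '' T) := fun z hz => ⟨f z, hf hz, (hF z hz).symm⟩
  have heq : hmaps.restrict F E (Θ '' T) = hΘ.homeomorphImage T ∘ hf.restrict f E T := by
    ext1 z
    exact Subtype.ext (hF z z.2)
  refine ⟨hmaps, ?_, ?_⟩
  · rw [heq]; exact hcov.homeomorph_comp _
  · rintro ⟨y, x, hx, rfl⟩
    rw [← hcard x hx, ← Function.Injective.encard_image Subtype.val_injective]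
    congr 1
    ext z
    constructor
    · rintro ⟨w, hw, rfl⟩
      have h1 : F w = Θ x := congrArg Subtype.val hw
      rw [hF w w.2] at h1
      exact ⟨w.2, hΘ.injective h1⟩
    · rintro ⟨hz, hfz⟩
      exact ⟨⟨z, hz⟩, Subtype.ext (show F z = Θ x by rw [hF z hz, hfz]), rfl⟩

/-! ### Planar projections of the surface -/

/-- The complex bilinear extension of the Lorentzian inner product. -/
def complexLorentz (x y : Fin 3 → ℂ) : ℂ := x 0 * y 0 + x 1 * y 1 - x 2 * y 2

/-- The complex vector `e₁ + i e₂`. -/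
def complexFrame (e₁ e₂ : L3) (j : Fin 3) : ℂ := e₁ j + e₂ j * Complex.I

/-- The coordinates of the orthogonal projection of a vector to the plane with orthonormal basis
`e₁, e₂`. -/
def planarCoord (e₁ e₂ : L3) : L3 →ₗ[ℝ] ℂ where
  toFun x := lorentz x e₁ + lorentz x e₂ * Complex.I
  map_add' x y := by simp; ring
  map_smul' c x := by simp; ring

theorem planarCoord_apply (e₁ e₂ x : L3) :
    planarCoord e₁ e₂ x = lorentz x e₁ + lorentz x e₂ * Complex.I := rfl

theorem continuous_planarCoord (e₁ e₂ : L3) : Continuous (planarCoord e₁ e₂) :=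
  LinearMap.continuous_of_finiteDimensional _

theorem planarCoord_eq (e₁ e₂ x : L3) :
    planarCoord e₁ e₂ x = complexLorentz (fun j => x j) (complexFrame e₁ e₂) := by
  simp only [planarCoord_apply, complexLorentz, complexFrame, lorentz_apply]
  push_cast; ring

theorem hasFDerivAt_planarCoord {Z : ℂ → L3} {p₀ : L3} {c : Fin 3 → ℂ} {z : ℂ} (e₁ e₂ : L3)
    (h : ∀ j, HasFDerivAt (fun w => Z w j)
      (Complex.reCLM.comp (c j • ContinuousLinearMap.id ℝ ℂ)) z) :
    HasFDerivAt (fun w => planarCoord e₁ e₂ (Z w - p₀))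
      (planarDifferential (complexLorentz c (complexFrame e₁ e₂))
        (complexLorentz c fun j => (starRingEnd ℂ) (complexFrame e₁ e₂ j))) z := by
  have h1 := fun j => (Complex.ofRealCLM.hasFDerivAt.comp z ((h j).sub_const (p₀ j))).mul_const
    (complexFrame e₁ e₂ j)
  have h2 := ((h1 0).add (h1 1)).sub (h1 2)
  refine (h2.congr_of_eventuallyEq (Eventually.of_forall fun w => ?_)).congr_fderiv ?_
  · simp only [planarCoord_eq, complexLorentz]
    rfl
  · refine ContinuousLinearMap.ext fun v => ?_
    rw [planarDifferential_apply]
    have hre : ∀ x : ℂ, (x.re : ℂ) = (x + (starRingEnd ℂ) x) / 2 := fun x =>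
      (Complex.re_eq_add_conj x)
    simp [complexLorentz, hre, -Complex.mul_re]
    ring

/-- The complex vector `e₁ + i e₂` of an orthonormal pair is null. -/
theorem IsLorentzFrame.complexFrame_null {e₁ e₂ ν : L3} (h : IsLorentzFrame e₁ e₂ ν) {σ : ℂ}
    (hσ : σ = Complex.I ∨ σ = -Complex.I) :
    (complexFrame e₁ e₂ 0 - σ * complexFrame e₁ e₂ 1)
      * (complexFrame e₁ e₂ 0 + σ * complexFrame e₁ e₂ 1) = complexFrame e₁ e₂ 2 ^ 2 := by
  have h1 := h.inner_11
  have h2 := h.inner_22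
  have h3 := h.inner_12
  rw [lorentz_apply] at h1 h2 h3
  have hσ2 : σ ^ 2 = -1 := by rcases hσ with rfl | rfl <;> simp
  have c1 : (e₁ 0 * e₁ 0 + e₁ 1 * e₁ 1 - e₁ 2 * e₁ 2 : ℂ) = 1 := by exact_mod_cast h1
  have c2 : (e₂ 0 * e₂ 0 + e₂ 1 * e₂ 1 - e₂ 2 * e₂ 2 : ℂ) = 1 := by exact_mod_cast h2
  have c3 : (e₁ 0 * e₂ 0 + e₁ 1 * e₂ 1 - e₁ 2 * e₂ 2 : ℂ) = 0 := by exact_mod_cast h3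
  simp only [complexFrame]
  linear_combination (-(e₁ 1 + e₂ 1 * Complex.I : ℂ) ^ 2) * hσ2 + c1 - c2
    + 2 * Complex.I * c3
    + ((e₂ 0 : ℂ) ^ 2 + (e₂ 1 : ℂ) ^ 2 - (e₂ 2 : ℂ) ^ 2) * Complex.I_sq

/-- One of the two orderings of `e₁, e₂` gives the plane a prescribed orientation. -/
theorem IsLorentzFrame.exists_norm_lt {e₁ e₂ ν : L3} (h : IsLorentzFrame e₁ e₂ ν) {σ : ℂ}
    (hσ : σ = Complex.I ∨ σ = -Complex.I) : ∃ e₁' e₂' : L3,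
      (e₁' = e₁ ∧ e₂' = e₂ ∨ e₁' = e₂ ∧ e₂' = e₁) ∧
      ‖complexFrame e₁' e₂' 0 + σ * complexFrame e₁' e₂' 1‖
        < ‖complexFrame e₁' e₂' 0 - σ * complexFrame e₁' e₂' 1‖ := by
  have h1 := h.inner_11
  have h2 := h.inner_22
  have h3 := h.inner_12
  rw [lorentz_apply] at h1 h2 h3
  have key : ‖complexFrame e₁ e₂ 0 + σ * complexFrame e₁ e₂ 1‖
      ≠ ‖complexFrame e₁ e₂ 0 - σ * complexFrame e₁ e₂ 1‖ := by
    intro heq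
    have e1 := h.complexFrame_null hσ
    have e2 := congrArg norm e1
    have e3 := parallelogram_law_with_norm ℝ (complexFrame e₁ e₂ 0) (σ * complexFrame e₁ e₂ 1)
    have hσ1 : ‖σ‖ = 1 := by rcases hσ with rfl | rfl <;> simp
    rw [norm_mul, norm_pow] at e2
    rw [norm_mul σ, hσ1, one_mul] at e3
    rw [heq] at e2 e3
    have hn : ∀ j, ‖complexFrame e₁ e₂ j‖ ^ 2 = e₁ j * e₁ j + e₂ j * e₂ j := fun j => by
      rw [Complex.sq_norm, Complex.normSq_apply]
      simp [complexFrame]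
    rw [hn, hn] at e3
    rw [hn] at e2
    linarith
  rcases lt_or_gt_of_ne key with h4 | h4
  · exact ⟨e₁, e₂, Or.inl ⟨rfl, rfl⟩, h4⟩
  · refine ⟨e₂, e₁, Or.inr ⟨rfl, rfl⟩, ?_⟩
    have hσc : (starRingEnd ℂ) σ = -σ := by rcases hσ with rfl | rfl <;> simp
    have hsw : ∀ j, complexFrame e₂ e₁ j = Complex.I * (starRingEnd ℂ) (complexFrame e₁ e₂ j) :=
      fun j => by
        simp only [complexFrame, map_add, map_mul, Complex.conj_I, Complex.conj_ofReal]
        linear_combination (e₂ j : ℂ) * Complex.I_sq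
    have e1 : complexFrame e₂ e₁ 0 + σ * complexFrame e₂ e₁ 1 = Complex.I * (starRingEnd ℂ)
        (complexFrame e₁ e₂ 0 - σ * complexFrame e₁ e₂ 1) := by
      rw [hsw, hsw, map_sub, map_mul, hσc]; ring
    have e2 : complexFrame e₂ e₁ 0 - σ * complexFrame e₂ e₁ 1 = Complex.I * (starRingEnd ℂ)
        (complexFrame e₁ e₂ 0 + σ * complexFrame e₁ e₂ 1) := by
      rw [hsw, hsw, map_add, map_mul, hσc]; ring
    rw [e1, e2, norm_mul, norm_mul, RCLike.norm_conj, RCLike.norm_conj]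
    exact mul_lt_mul_of_pos_left h4 (by simp)

theorem complexLorentz_eq_nullPairing {σ : ℂ} (hσ : σ = Complex.I ∨ σ = -Complex.I)
    (x y : Fin 3 → ℂ) : complexLorentz x y = nullPairing (x 0 + σ * x 1) (x 0 - σ * x 1) (x 2)
      (y 0 + σ * y 1) (y 0 - σ * y 1) (y 2) := by
  have hσ2 : σ ^ 2 = -1 := by rcases hσ with rfl | rfl <;> simp
  simp only [complexLorentz, nullPairing]
  linear_combination (x 1 * y 1) * hσ2

/-- The coefficient of the planar projection `φ₁ ε₁ + φ₂ ε₂ - φ₃ ε₃` of the Weierstrass data on the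
strip, where `ε = e₁ + i e₂`. -/
def planarForm (φ : Fin 3 → ℂ → ℂ) (e₁ e₂ : L3) (w : ℂ) : ℂ :=
  complexLorentz (fun j => expPullback (φ j) w) (complexFrame e₁ e₂)

namespace IsWeierstrassData

variable {Y : ℂ → L3} {p₀ : L3} {r : ℝ} {g : ℂ → ℂ} {φ : Fin 3 → ℂ → ℂ}

theorem conj_planarForm_axisReflection (W : IsWeierstrassData Y p₀ r g φ) (hr : 0 < r)
    (hY : ∀ z : ℂ, ‖z‖ = 1 → Y z = p₀) (e₁ e₂ : L3) {w : ℂ} (hw : w ∈ strip (-Real.log r)) :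
    (starRingEnd ℂ) (planarForm φ e₁ e₂ (axisReflection w))
      = complexLorentz (fun j => expPullback (φ j) w)
        fun j => (starRingEnd ℂ) (complexFrame e₁ e₂ j) := by
  simp only [planarForm, complexLorentz, W.expPullback_axisReflection hr hY _ hw, map_sub, map_add,
    map_mul, Complex.conj_conj]

theorem hasFDerivAt_planarCoord_comp_exp (W : IsWeierstrassData Y p₀ r g φ) (hr : 0 < r)
    (hY : ∀ z : ℂ, ‖z‖ = 1 → Y z = p₀) (e₁ e₂ : L3) {w : ℂ} (hw : w ∈ strip (-Real.log r)) :
    HasFDerivAt (fun w => planarCoord e₁ e₂ (schwarzExtension Y p₀ (Complex.exp w) - p₀))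
      (planarDifferential (planarForm φ e₁ e₂ w)
        ((starRingEnd ℂ) (planarForm φ e₁ e₂ (axisReflection w)))) w := by
  rw [W.conj_planarForm_axisReflection hr hY e₁ e₂ hw]
  exact hasFDerivAt_planarCoord e₁ e₂ fun j => W.hasFDerivAt_comp_exp hr j hw

theorem hasStrictFDerivAt_planarCoord (W : IsWeierstrassData Y p₀ r g φ) (hr : 0 < r) (hr1 : r < 1)
    (e₁ e₂ : L3) {z : ℂ} (hz : z ∈ openAnnulus r 1) :
    HasStrictFDerivAt (fun z => planarCoord e₁ e₂ (Y z - p₀))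
      (planarDifferential (complexLorentz (fun j => φ j z) (complexFrame e₁ e₂))
        (complexLorentz (fun j => φ j z) fun j => (starRingEnd ℂ) (complexFrame e₁ e₂ j))) z := by
  have hsub : openAnnulus r 1 ⊆ openAnnulus r (1 / r) := fun z hz =>
    ⟨hz.1, hz.2.trans (by rw [one_div]; exact (one_lt_inv₀ hr).2 hr1)⟩
  refine hasStrictFDerivAt_of_hasFDerivAt_of_continuousAt
    (f' := fun z => planarDifferential (complexLorentz (fun j => φ j z) (complexFrame e₁ e₂))
      (complexLorentz (fun j => φ j z) fun j => (starRingEnd ℂ) (complexFrame e₁ e₂ j))) ?_ ?_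
  · filter_upwards [(isOpen_openAnnulus r 1).mem_nhds hz] with y hy
    refine (hasFDerivAt_planarCoord (p₀ := p₀) e₁ e₂ fun j =>
      W.hasFDerivAt j y (hsub hy)).congr_of_eventuallyEq ?_
    filter_upwards [(isOpen_openAnnulus r 1).mem_nhds hy] with x hx
    rw [schwarzExtension_of_le Y p₀ hx.2.le]
  · have hc := fun j => W.continuousAt j (hsub hz)
    have h0 := hc 0
    have h1 := hc 1
    have h2 := hc 2
    unfold planarDifferential complexLorentz
    fun_prop

/-- The planar projection of the surface is a planar branch, whose winding number is the sum of the
degree of the Gauss map and half the number of zeros of the height differential. -/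
theorem exists_isPlanarBranch (W : IsWeierstrassData Y p₀ r g φ) (hr : 0 < r) (hr1 : r < 1)
    (hY : ∀ z : ℂ, ‖z‖ = 1 → Y z = p₀) (hYc : ContinuousOn Y (outerClosedAnnulus r)) {σ : ℂ}
    (hσ : σ = Complex.I ∨ σ = -Complex.I)
    (hN : IsNullData (-Real.log r) (fun w => expPullback (φ 0) w + σ * expPullback (φ 1) w)
      (fun w => expPullback (φ 0) w - σ * expPullback (φ 1) w) (expPullback (φ 2)))
    {e₁ e₂ ν : L3} (hF : IsLorentzFrame e₁ e₂ ν)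
    (hlt : ‖complexFrame e₁ e₂ 0 + σ * complexFrame e₁ e₂ 1‖
        < ‖complexFrame e₁ e₂ 0 - σ * complexFrame e₁ e₂ 1‖) {N : ℕ} {ε : ℝ} (hε : 0 < ε)
    (hw : ∀ x : ℝ, 0 < x → x < ε → HasWinding (fun t =>
        expPullback (φ 0) (x + t * Complex.I) + σ * expPullback (φ 1) (x + t * Complex.I)) N) :
    ∃ r₁, IsPlanarBranch (fun z => planarCoord e₁ e₂ (Y z - p₀)) r r₁ N := by
  have hnull := hF.complexFrame_null hσ
  have ha : ∀ w, planarForm φ e₁ e₂ w = nullPairing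
      (expPullback (φ 0) w + σ * expPullback (φ 1) w)
      (expPullback (φ 0) w - σ * expPullback (φ 1) w) (expPullback (φ 2) w)
      (complexFrame e₁ e₂ 0 + σ * complexFrame e₁ e₂ 1)
      (complexFrame e₁ e₂ 0 - σ * complexFrame e₁ e₂ 1) (complexFrame e₁ e₂ 2) := fun w =>
    complexLorentz_eq_nullPairing hσ _ _
  have hnorm : ∀ w ∈ strip (-Real.log r), w.re < 0 →
      ‖planarForm φ e₁ e₂ w‖ < ‖planarForm φ e₁ e₂ (axisReflection w)‖ := fun w hw hneg => by
    rw [ha, ha]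
    exact hN.norm_nullPairing_lt hnull hlt hw hneg
  let F : ℂ → ℂ := fun w => planarCoord e₁ e₂ (schwarzExtension Y p₀ (Complex.exp w) - p₀)
  obtain ⟨δ, hδ, hδρ, hne, hwind⟩ := exists_ne_zero_and_hasWinding (a := planarForm φ e₁ e₂) (f := F)
    hN.pos
    ((hN.differentiableOn_nullPairing _ _ _).congr fun w _ => ha w)
    (fun w => by simp only [planarForm, expPullback_periodic]) hnorm
    (fun x t hx => by
      have h1 := W.hasFDerivAt_planarCoord_comp_exp hr hY e₁ e₂ (mem_strip_mk (t := t).2 hx)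
      have h2 : HasDerivAt (fun s : ℝ => (s + t * Complex.I : ℂ)) 1 x :=
        (Complex.ofRealCLM.hasDerivAt (x := x)).add_const _
      have h3 := h1.comp_hasDerivAt x h2
      rw [planarDifferential_apply, mul_one, mul_one, Complex.conj_conj] at h3
      have hrefl : axisReflection (x + t * Complex.I) = -x + t * Complex.I := by
        apply Complex.ext <;> simp
      rw [hrefl] at h3
      exact h3)
    (fun t => by
      have h1 : ‖Complex.exp (t * Complex.I)‖ = 1 := Complex.norm_exp_ofReal_mul_I t
      simp only [F]
      rw [schwarzExtension_of_le Y p₀ h1.le, hY _ h1, sub_self, map_zero])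
  let η := min δ (min ε (-Real.log r))
  have hη : 0 < η := lt_min hδ (lt_min hε hN.pos)
  have hηr : η / 2 < -Real.log r :=
    (half_lt_self hη).trans_le ((min_le_right _ _).trans (min_le_right _ _))
  have hFY : ∀ w : ℂ, w.re ≤ 0 → F w = planarCoord e₁ e₂ (Y (Complex.exp w) - p₀) := fun w hw => by
    simp only [F]
    rw [schwarzExtension_of_le Y p₀ (by rw [Complex.norm_exp]; exact Real.exp_le_one_iff.2 hw)]
  have hlog : ∀ ρ : ℝ, Real.exp (-(η / 2)) < ρ → -(η / 2) < Real.log ρ := fun ρ h =>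
    (Real.lt_log_iff_exp_lt ((Real.exp_pos _).trans h)).2 h
  refine ⟨Real.exp (-(η / 2)), ⟨hr, ?_, ?_, ?_, ?_, ?_, ?_, ?_⟩⟩
  · rw [← Real.log_lt_iff_lt_exp hr]; linarith
  · exact Real.exp_lt_one_iff.2 (by linarith)
  · exact (continuous_planarCoord e₁ e₂).comp_continuousOn (hYc.sub continuousOn_const)
  · intro z hz
    rw [hY z hz, sub_self, map_zero]
  · intro z hz
    refine ⟨_, _, ?_, W.hasStrictFDerivAt_planarCoord hr hr1 e₁ e₂ hz⟩
    have hz0 : z ≠ 0 := by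
      rintro rfl; have := hz.1; rw [norm_zero] at this; exact absurd this (not_lt.2 hr.le)
    have hzn : 0 < ‖z‖ := norm_pos_iff.2 hz0
    have hexp := Complex.exp_log hz0
    have hstrip : Complex.log z ∈ strip (-Real.log r) := (exp_mem_openAnnulus_iff hr).1 (by
      rw [hexp]; exact ⟨hz.1, hz.2.trans (by rw [one_div]; exact (one_lt_inv₀ hr).2 hr1)⟩)
    have h1 := hnorm _ hstrip (by rw [Complex.log_re]; exact Real.log_neg hzn hz.2)
    rw [← RCLike.norm_conj (planarForm φ e₁ e₂ (axisReflection _)),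
      W.conj_planarForm_axisReflection hr hY e₁ e₂ hstrip] at h1
    have e1 : ∀ y : Fin 3 → ℂ, complexLorentz (fun j => expPullback (φ j) (Complex.log z)) y
        = z * complexLorentz (fun j => φ j z) y := fun y => by
      simp only [complexLorentz, expPullback, hexp]; ring
    rw [planarForm, e1, e1, norm_mul, norm_mul] at h1
    exact lt_of_mul_lt_mul_left h1 hzn.le
  · intro z hz
    have hz0 : z ≠ 0 := by
      rintro rfl
      have := hz.1; rw [norm_zero] at this; exact absurd this (not_lt.2 (Real.exp_pos _).le)
    have hneg : (Complex.log z).re < 0 := by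
      rw [Complex.log_re]; exact Real.log_neg (norm_pos_iff.2 hz0) hz.2
    have h1 := hne (Complex.log z) (by
      rw [Complex.log_re]
      have := hlog _ hz.1
      have h2 : η ≤ δ := min_le_left _ _
      linarith) hneg
    rwa [hFY _ hneg.le, Complex.exp_log hz0] at h1
  · intro ρ hρ hρ1
    have hρ0 : 0 < ρ := (Real.exp_pos _).trans hρ
    have h1 := hlog ρ hρ
    have h2 := Real.log_neg hρ0 hρ1
    have hηδ : η ≤ δ := min_le_left _ _
    have hηε : η ≤ ε := (min_le_right _ _).trans (min_le_left _ _)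
    have hηr' : η ≤ -Real.log r := (min_le_right _ _).trans (min_le_right _ _)
    have h3 := hwind (-Real.log ρ) (by linarith) (by linarith) N (by
      have h4 := hN.hasWinding_nullPairing hnull hlt (x := -Real.log ρ) (by linarith) (by linarith)
        (hw _ (by linarith) (by linarith))
      simpa only [ha] using h4)
    convert h3 using 2 with t
    rw [hFY _ (by simpa using h2.le)]
    congr 3
    rw [Complex.exp_add]
    push_cast
    rw [neg_neg, Complex.ofReal_log hρ0.le, Complex.exp_log (by exact_mod_cast hρ0.ne')]

end IsWeierstrassData

/-! ### The projection to the plane is a covering -/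

/-- The parametrization of the plane through `p₀` with orthonormal basis `e₁, e₂`. -/
def planeParam (p₀ e₁ e₂ : L3) (y : ℂ) : L3 := p₀ + (y.re • e₁ + y.im • e₂)

/-- An orthonormal frame adapted to a plane. -/
structure IsAdaptedFrame (P : AffineSubspace ℝ L3) (e₁ e₂ ν : L3) : Prop
    extends IsLorentzFrame e₁ e₂ ν where
  mem_1 : e₁ ∈ P.direction
  mem_2 : e₂ ∈ P.direction
  mem_iff : ∀ v, v ∈ P.direction ↔ lorentz v ν = 0

namespace IsAdaptedFrame

variable {P : AffineSubspace ℝ L3} {p₀ e₁ e₂ ν : L3}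

theorem planeParam_sub_mem (h : IsAdaptedFrame P e₁ e₂ ν) (p₀ : L3) (y : ℂ) :
    planeParam p₀ e₁ e₂ y - p₀ ∈ P.direction := by
  rw [planeParam, add_sub_cancel_left]
  exact P.direction.add_mem (P.direction.smul_mem _ h.mem_1) (P.direction.smul_mem _ h.mem_2)

theorem planarCoord_planeParam_sub (h : IsAdaptedFrame P e₁ e₂ ν) (p₀ : L3) (y : ℂ) :
    planarCoord e₁ e₂ (planeParam p₀ e₁ e₂ y - p₀) = y := by
  rw [planeParam, add_sub_cancel_left, planarCoord_apply]
  simp [h.inner_11, h.inner_22, h.inner_12, lorentz_comm e₂ e₁]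

theorem planeParam_planarCoord (h : IsAdaptedFrame P e₁ e₂ ν) {p : L3}
    (hp : p - p₀ ∈ P.direction) : planeParam p₀ e₁ e₂ (planarCoord e₁ e₂ (p - p₀)) = p := by
  have h1 := h.eq_sum (p - p₀)
  rw [(h.mem_iff _).1 hp, zero_smul, sub_zero] at h1
  rw [planeParam, planarCoord_apply]
  simp only [Complex.add_re, Complex.add_im, Complex.ofReal_re, Complex.ofReal_im, Complex.mul_re,
    Complex.mul_im, Complex.I_re, Complex.I_im]
  simp only [mul_zero, mul_one, sub_zero, add_zero, zero_add]
  rw [← h1, add_sub_cancel]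

theorem lorentz_eq_norm_planarCoord (h : IsAdaptedFrame P e₁ e₂ ν) {v : L3}
    (hv : v ∈ P.direction) : lorentz v v = ‖planarCoord e₁ e₂ v‖ ^ 2 := by
  have h1 := h.eq_sum v
  rw [(h.mem_iff _).1 hv, zero_smul, sub_zero] at h1
  rw [planarCoord_apply, Complex.sq_norm, Complex.normSq_apply]
  conv_lhs => rw [h1]
  simp [h.inner_11, h.inner_22, h.inner_12, lorentz_comm e₂ e₁]

theorem isEmbedding_planeParam (h : IsAdaptedFrame P e₁ e₂ ν) (p₀ : L3) :
    IsEmbedding (planeParam p₀ e₁ e₂) := by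
  refine Function.LeftInverse.isEmbedding (f := fun p => planarCoord e₁ e₂ (p - p₀))
    (h.planarCoord_planeParam_sub p₀) ?_ ?_
  · exact (continuous_planarCoord e₁ e₂).comp (continuous_id.sub continuous_const)
  · unfold planeParam; fun_prop

theorem lorentzProj_eq (h : IsAdaptedFrame P e₁ e₂ ν) (hP : IsSpacelikePlane P) (p : L3) :
    lorentzProj P hP p₀ p = planeParam p₀ e₁ e₂ (planarCoord e₁ e₂ (p - p₀)) := by
  set y := planarCoord e₁ e₂ (p - p₀) with hy
  have hmem : y.re • e₁ + y.im • e₂ ∈ P.direction := by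
    simpa [planeParam] using h.planeParam_sub_mem p₀ y
  have hre : y.re = lorentz (p - p₀) e₁ := by rw [hy, planarCoord_apply]; simp
  have him : y.im = lorentz (p - p₀) e₂ := by rw [hy, planarCoord_apply]; simp
  have hsplit : p - p₀ = (y.re • e₁ + y.im • e₂) + -(lorentz (p - p₀) ν • ν) := by
    rw [hre, him, ← sub_eq_add_neg]; exact h.eq_sum _
  have horth : -(lorentz (p - p₀) ν • ν) ∈ lorentz.orthogonal P.direction := by
    refine Submodule.neg_mem _ (Submodule.smul_mem _ _ fun n hn => ?_)
    exact (h.mem_iff n).1 hn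
  rw [lorentzProj, planeParam]
  conv_lhs => rw [hsplit]
  rw [map_add, Submodule.projectionOnto_apply_of_mem_left _ hmem,
    Submodule.projectionOnto_apply_of_mem_right _ horth, add_zero]

theorem planeDisc_eq (h : IsAdaptedFrame P e₁ e₂ ν) (hp₀ : p₀ ∈ P) {s : ℝ} (hs : 0 ≤ s) :
    planeDisc P p₀ s = planeParam p₀ e₁ e₂ '' closedBall 0 s := by
  have hmem : ∀ p, p ∈ P ↔ p - p₀ ∈ P.direction := fun p =>
    (AffineSubspace.vsub_right_mem_direction_iff_mem hp₀ p).symm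
  ext p
  constructor
  · rintro ⟨hp, hle⟩
    rw [hmem] at hp
    refine ⟨_, ?_, h.planeParam_planarCoord hp⟩
    rw [h.lorentz_eq_norm_planarCoord hp] at hle
    rw [mem_closedBall_zero_iff]
    exact le_of_sq_le_sq hle hs
  · rintro ⟨y, hy, rfl⟩
    have h1 := h.planeParam_sub_mem p₀ y
    refine ⟨(hmem _).2 h1, ?_⟩
    rw [h.lorentz_eq_norm_planarCoord h1, h.planarCoord_planeParam_sub]
    exact pow_le_pow_left₀ (norm_nonneg _) (mem_closedBall_zero_iff.1 hy) 2

theorem planeParam_zero (p₀ e₁ e₂ : L3) : planeParam p₀ e₁ e₂ 0 = p₀ := by simp [planeParam]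

end IsAdaptedFrame

theorem IsSpacelikePlane.exists_adaptedFrame {P : AffineSubspace ℝ L3} (hP : IsSpacelikePlane P)
    {σ : ℂ} (hσ : σ = Complex.I ∨ σ = -Complex.I) : ∃ e₁ e₂ ν, IsAdaptedFrame P e₁ e₂ ν ∧
      ‖complexFrame e₁ e₂ 0 + σ * complexFrame e₁ e₂ 1‖
        < ‖complexFrame e₁ e₂ 0 - σ * complexFrame e₁ e₂ 1‖ := by
  obtain ⟨e₁, e₂, ν, h1, h2, hF, hiff⟩ := hP.exists_frame
  obtain ⟨e₁', e₂', ⟨rfl, rfl⟩ | ⟨rfl, rfl⟩, hlt⟩ := hF.exists_norm_lt hσ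
  · exact ⟨_, _, ν, ⟨hF, h1, h2, hiff⟩, hlt⟩
  · exact ⟨_, _, ν, ⟨hF.swap, h2, h1, hiff⟩, hlt⟩

/-- If the planar projection, in coordinates, has winding number `N` near the circle, then the
orthogonal projection to the plane is a covering with `N` sheets over small punctured discs. -/
theorem IsPlanarBranch.exists_isCoveringOfDegree {Y : ℂ → L3} {p₀ e₁ e₂ ν : L3} {r r₁ : ℝ} {N : ℕ}
    (h : IsPlanarBranch (fun z => planarCoord e₁ e₂ (Y z - p₀)) r r₁ N)
    {P : AffineSubspace ℝ L3} (hP : IsSpacelikePlane P) (hp₀ : p₀ ∈ P)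
    (hF : IsAdaptedFrame P e₁ e₂ ν) :
    ∃ s₀ : ℝ, 0 < s₀ ∧ ∀ s : ℝ, 0 < s → s ≤ s₀ →
      IsCoveringOfDegree (lorentzProj P hP p₀ ∘ Y)
        (connectedComponentIn {z ∈ outerClosedAnnulus r |
          lorentzProj P hP p₀ (Y z) ∈ planeDisc P p₀ s} 1 \ sphere 0 1)
        (planeDisc P p₀ s \ {p₀}) N := by
  set f : ℂ → ℂ := fun z => planarCoord e₁ e₂ (Y z - p₀) with hf
  obtain ⟨ρ, hρ, hρ1⟩ := exists_between h.lt_one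
  have hrρ : r < ρ := h.r_lt.trans hρ
  have hρ0 : 0 < ρ := h.r_pos.trans hrρ
  obtain ⟨s₀, hs₀, hmin⟩ := h.exists_pos_forall_lt_norm hρ hρ1
  refine ⟨s₀, hs₀, fun s hs hss₀ => ?_⟩
  have hlt : ∀ z : ℂ, ‖z‖ = ρ → s < ‖f z‖ := fun z hz =>
    hss₀.trans_lt (hmin z hz.ge hz.le)
  have hset : {z ∈ outerClosedAnnulus r | lorentzProj P hP p₀ (Y z) ∈ planeDisc P p₀ s}
      = {z ∈ outerClosedAnnulus r | ‖f z‖ ≤ s} := by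
    ext z
    refine and_congr_right fun _ => ?_
    rw [hF.lorentzProj_eq, hF.planeDisc_eq hp₀ hs.le, (hF.isEmbedding_planeParam p₀).injective.mem_set_image,
      mem_closedBall_zero_iff]
  have hcomp : connectedComponentIn {z ∈ outerClosedAnnulus r | ‖f z‖ ≤ s} 1
      = {z : ℂ | (ρ ≤ ‖z‖ ∧ ‖z‖ ≤ 1) ∧ ‖f z‖ ≤ s} := by
    refine connectedComponentIn_eq_of_separation (U := {z : ℂ | ‖z‖ < ρ}) (V := {z : ℂ | ρ < ‖z‖})
      (h.isPreconnected_sublevel hρ hρ1 hs.le hlt) ?_ ?_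
      (isOpen_lt continuous_norm continuous_const) (isOpen_lt continuous_const continuous_norm)
      ?_ ?_ ?_ (by simpa using hρ1)
    · exact fun z hz => ⟨⟨hrρ.trans_le hz.1.1, hz.1.2⟩, hz.2⟩
    · refine ⟨by simpa using hρ1.le, ?_⟩
      rw [h.circle 1 (by simp), norm_zero]; exact hs.le
    · rw [Set.disjoint_left]
      intro z hz hz'
      exact absurd (show ‖z‖ < ρ from hz) (not_lt.2 (le_of_lt hz'))
    · intro z hz
      rcases lt_trichotomy ‖z‖ ρ with h1 | h1 | h1
      · exact Or.inl h1
      · exact absurd hz.2 (not_le.2 (hlt z h1))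
      · exact Or.inr h1
    · exact fun z hz => ⟨⟨le_of_lt hz.2, hz.1.1.2⟩, hz.1.2⟩
  have hdiff : {z : ℂ | (ρ ≤ ‖z‖ ∧ ‖z‖ ≤ 1) ∧ ‖f z‖ ≤ s} \ sphere 0 1
      = {z : ℂ | z ∈ openAnnulus ρ 1 ∧ ‖f z‖ ≤ s} := by
    ext z
    simp only [Set.mem_sdiff, mem_sphere_zero_iff_norm]
    constructor
    · rintro ⟨⟨⟨h1, h2⟩, h3⟩, h4⟩
      exact ⟨⟨lt_of_le_of_ne h1 fun h5 => absurd h3 (not_le.2 (hlt z h5.symm)),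
        lt_of_le_of_ne h2 h4⟩, h3⟩
    · rintro ⟨⟨h1, h2⟩, h3⟩
      exact ⟨⟨⟨h1.le, h2.le⟩, h3⟩, h2.ne⟩
  have htarget : planeDisc P p₀ s \ {p₀} = planeParam p₀ e₁ e₂ '' (closedBall 0 s \ {0}) := by
    rw [image_sdiff (hF.isEmbedding_planeParam p₀).injective, image_singleton,
      IsAdaptedFrame.planeParam_zero, hF.planeDisc_eq hp₀ hs.le]
  rw [hset, hcomp, hdiff, htarget]
  obtain ⟨hmaps, hcov⟩ := h.isCoveringMap_restrict hρ hlt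
  refine isCoveringOfDegree_of_eqOn (planeParam p₀ e₁ e₂) (hF.isEmbedding_planeParam p₀)
    (fun z _ => hF.lorentzProj_eq hP (Y z)) hmaps hcov fun y hy => ?_
  have hys : ‖y‖ ≤ s := mem_closedBall_zero_iff.1 hy.1
  rw [← h.encard_preimage hρ hρ1 hy.2 fun z hz => hys.trans_lt (hlt z hz)]
  congr 1
  ext z
  constructor
  · rintro ⟨⟨h1, -⟩, h2⟩; exact ⟨h1, h2⟩
  · rintro ⟨h1, h2⟩; exact ⟨⟨h1, by rw [h2]; exact hys⟩, h2⟩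

/-! ### Embeddedness -/

theorem isPreconnected_openAnnulus {a b : ℝ} (ha : 0 < a) (hb : 0 < b) :
    IsPreconnected (openAnnulus a b) := by
  have h1 : openAnnulus a b =
      Complex.exp '' ({w : ℂ | Real.log a < w.re} ∩ {w : ℂ | w.re < Real.log b}) := by
    ext z
    constructor
    · intro hz
      have hn : 0 < ‖z‖ := ha.trans hz.1
      refine ⟨Complex.log z, ⟨?_, ?_⟩, Complex.exp_log (norm_pos_iff.1 hn)⟩
      · show Real.log a < (Complex.log z).re
        rw [Complex.log_re]; exact Real.log_lt_log ha hz.1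
      · show (Complex.log z).re < Real.log b
        rw [Complex.log_re]; exact Real.log_lt_log hn hz.2
    · rintro ⟨w, ⟨hw1, hw2⟩, rfl⟩
      refine ⟨?_, ?_⟩ <;> rw [Complex.norm_exp]
      · exact (Real.log_lt_iff_lt_exp ha).1 hw1
      · exact (Real.lt_log_iff_exp_lt hb).1 hw2
  rw [h1]
  exact ((convex_halfSpace_re_gt _).inter (convex_halfSpace_re_lt _)).isPreconnected.image _
    Complex.continuous_exp.continuousOn

namespace IsPlanarBranch

variable {f : ℂ → ℂ} {r r₁ : ℝ} {N : ℕ}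

theorem exists_injOn_nhds (h : IsPlanarBranch f r r₁ N) {z : ℂ} (hz : z ∈ openAnnulus r 1) :
    ∃ U ∈ 𝓝 z, InjOn f U := by
  obtain ⟨e, he, hfe⟩ := h.isLocalHomeomorphOn z hz
  exact ⟨e.source, e.open_source.mem_nhds he, by rw [hfe]; exact e.injOn⟩

/-- If a height function separates the points in the fibres of the planar map, then the map has at
most one sheet: the points of greatest height in their fibres form an open and closed set, and so do
the other ones, while the collar is connected. -/
theorem le_one_of_separates (h : IsPlanarBranch f r r₁ N) {H : ℂ → ℝ}
    (hH : ContinuousOn H (openAnnulus r 1)) {r₀ : ℝ} (hr₀ : r₀ < 1)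
    (hinj : ∀ z ∈ openAnnulus r₀ 1, ∀ z' ∈ openAnnulus r₀ 1, f z = f z' → H z = H z' → z = z') :
    N ≤ 1 := by
  by_contra hN
  obtain ⟨ρ, hρ, hρ1⟩ := exists_between (max_lt h.lt_one hr₀)
  have hr₁ρ : r₁ < ρ := (le_max_left _ _).trans_lt hρ
  have hr₀ρ : r₀ < ρ := (le_max_right _ _).trans_lt hρ
  have hrρ : r < ρ := h.r_lt.trans hr₁ρ
  have hsub : openAnnulus ρ 1 ⊆ openAnnulus r 1 := openAnnulus_mono hrρ.le
  have hHc : ∀ z ∈ openAnnulus ρ 1, ContinuousAt H z := fun z hz =>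
    hH.continuousAt ((isOpen_openAnnulus _ _).mem_nhds (hsub hz))
  have hfc : ∀ z ∈ openAnnulus ρ 1, ContinuousAt f z := fun z hz =>
    (h.map_nhds (hsub hz)).le
  obtain ⟨m, hm, hmin⟩ := h.exists_pos_forall_lt_norm hr₁ρ hρ1
  obtain ⟨b, hρb, hb1, hb⟩ := h.exists_forall_norm_lt hrρ hρ1 hm
  obtain ⟨m', hm', hmin'⟩ := h.exists_pos_forall_lt_norm hr₁ρ hb1
  have hb0 : 0 < b := h.r_pos.trans (hrρ.trans hρb)
  let S : Set ℂ := {z | z ∈ openAnnulus ρ 1 ∧ ∃ z' ∈ openAnnulus ρ 1, f z' = f z ∧ H z < H z'}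
  -- `S` consists of the points above which a fibre has a higher point; it is open as `f` is open
  have hSopen : IsOpen S := by
    rw [isOpen_iff_mem_nhds]
    rintro z ⟨hz, z', hz', hf, hlt⟩
    obtain ⟨c, hc1, hc2⟩ := exists_between hlt
    have h1 : ∀ᶠ w' in 𝓝 z', w' ∈ openAnnulus ρ 1 ∧ c < H w' :=
      (eventually_mem_set.2 ((isOpen_openAnnulus _ _).mem_nhds hz')).and
        ((hHc z' hz').eventually (lt_mem_nhds hc2))
    have h2 : f '' {w' | w' ∈ openAnnulus ρ 1 ∧ c < H w'} ∈ 𝓝 (f z) := by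
      rw [← hf, ← h.map_nhds (hsub hz')]
      exact image_mem_map h1
    filter_upwards [(isOpen_openAnnulus _ _).mem_nhds hz, (hfc z hz) h2,
      (hHc z hz).eventually (gt_mem_nhds hc1)] with w hw1 hw2 hw3
    obtain ⟨w', ⟨hw', hcw⟩, hfw⟩ := hw2
    exact ⟨hw1, w', hw', hfw, lt_trans hw3 hcw⟩
  let Q := openAnnulus b 1
  have hQρ : Q ⊆ openAnnulus ρ 1 := openAnnulus_mono hρb.le
  -- if points `w` of `S` tend to `z`, take points `w'` higher in their fibres and a limit `z'` of these;
  -- were `z` highest in its fibre, then `z' = z`, against the injectivity of `f` near `z`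
  have hTopen : IsOpen (Q \ S) := by
    rw [isOpen_iff_mem_nhds]
    rintro z ⟨hz, hzS⟩
    by_contra hcon
    have hfreq : ∃ᶠ w in 𝓝 z, w ∈ S := by
      intro hev
      exact hcon (by
        filter_upwards [hev, (isOpen_openAnnulus _ _).mem_nhds hz] with w hw hwQ
        exact ⟨hwQ, hw⟩)
    obtain ⟨w, hwz, hwS⟩ := exists_seq_forall_of_frequently hfreq
    choose hwA w' hw'A hff hHlt using hwS
    obtain ⟨z', hz'K, ψ, hψ, hlim⟩ := (isCompact_closedAnnulus ρ).tendsto_subseq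
      (x := w') fun n => ⟨(hw'A n).1.le, (hw'A n).2.le⟩
    have hwψ : Tendsto (w ∘ ψ) atTop (𝓝 z) := hwz.comp hψ.tendsto_atTop
    have hfw : Tendsto (f ∘ (w' ∘ ψ)) atTop (𝓝 (f z)) := by
      have : f ∘ (w' ∘ ψ) = f ∘ (w ∘ ψ) := funext fun n => hff (ψ n)
      rw [this]
      exact (hfc z (hQρ hz)).tendsto.comp hwψ
    have hfz' : f z' = f z := by
      have h1 := (h.continuousOn_closedAnnulus hrρ z' hz'K).tendsto
      have h2 : Tendsto (w' ∘ ψ) atTop (𝓝[{z : ℂ | ρ ≤ ‖z‖ ∧ ‖z‖ ≤ 1}] z') :=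
        tendsto_nhdsWithin_iff.2 ⟨hlim, Eventually.of_forall fun n =>
          ⟨(hw'A _).1.le, (hw'A _).2.le⟩⟩
      exact tendsto_nhds_unique (h1.comp h2) hfw
    have hz'A : z' ∈ openAnnulus ρ 1 := by
      refine ⟨lt_of_le_of_ne hz'K.1 fun h1 => ?_, lt_of_le_of_ne hz'K.2 fun h1 => ?_⟩
      · have h2 := hmin z' hz'K.1 h1.ge
        rw [hfz'] at h2
        exact absurd (hb z hz.1.le hz.2.le) (not_lt.2 h2.le)
      · have h2 := h.circle z' h1
        rw [hfz'] at h2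
        exact h.ne_zero z (openAnnulus_mono hr₁ρ.le (hQρ hz)) h2
    have hle : H z ≤ H z' := le_of_tendsto_of_tendsto'
      ((hHc z (hQρ hz)).tendsto.comp hwψ) ((hHc z' hz'A).tendsto.comp hlim)
      fun n => (hHlt (ψ n)).le
    have hge : H z' ≤ H z := by
      by_contra h1
      exact hzS ⟨hQρ hz, z', hz'A, hfz', not_le.1 h1⟩
    have hzz : z' = z := hinj z' (openAnnulus_mono hr₀ρ.le hz'A) z
      (openAnnulus_mono hr₀ρ.le (hQρ hz)) hfz' (le_antisymm hge hle)
    rw [hzz] at hlim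
    obtain ⟨U, hU, hUinj⟩ := h.exists_injOn_nhds (hsub (hQρ hz))
    obtain ⟨n, hn1, hn2⟩ := ((hwψ.eventually hU).and (hlim.eventually hU)).exists
    have := hUinj hn1 hn2 (hff (ψ n)).symm
    have h3 := hHlt (ψ n)
    simp only [Function.comp_apply] at this
    rw [this] at h3
    exact lt_irrefl _ h3
  -- a value so small that its whole fibre lies in the collar
  let y : ℂ := ((min m m' / 2 : ℝ) : ℂ)
  have hmm : 0 < min m m' := lt_min hm hm'
  have hyn : ‖y‖ = min m m' / 2 := by
    rw [Complex.norm_real, Real.norm_of_nonneg (half_pos hmm).le]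
  have hy0 : y ≠ 0 := by rw [← norm_pos_iff, hyn]; exact half_pos hmm
  have hyl : ‖y‖ < min m m' := by rw [hyn]; exact half_lt_self hmm
  have hcard := h.encard_preimage hr₁ρ hρ1 hy0 fun z hz =>
    (hyl.trans_le (min_le_left _ _)).trans (hmin z hz.ge hz.le)
  set Fib := {z | z ∈ openAnnulus ρ 1 ∧ f z = y} with hFib
  have hFQ : ∀ z ∈ Fib, z ∈ Q := fun z hz => by
    refine ⟨?_, hz.1.2⟩
    by_contra hcon
    have h1 := hmin' z hz.1.1.le (not_lt.1 hcon)
    rw [hz.2] at h1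
    exact absurd (hyl.trans_le (min_le_right _ _)) (not_lt.2 h1.le)
  have hfin : Fib.Finite := by
    rw [← Set.encard_ne_top_iff, hcard]; exact ENat.natCast_ne_top N
  have h2 : 1 < Fib.encard := by rw [hcard]; exact_mod_cast not_le.1 hN
  obtain ⟨z₁, z₂, hz₁, hz₂, hne⟩ := Set.one_lt_encard_iff.1 h2
  obtain ⟨zm, hzm, hmax⟩ := Set.exists_max_image Fib H hfin ⟨z₁, hz₁⟩
  have htop : zm ∈ Q \ S := by
    refine ⟨hFQ zm hzm, ?_⟩
    rintro ⟨-, z', hz', hfz', hlt⟩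
    exact absurd (hmax z' ⟨hz', hfz'.trans hzm.2⟩) (not_le.2 hlt)
  have hother : ∃ z ∈ Fib, z ≠ zm := by
    by_cases h3 : z₁ = zm
    · exact ⟨z₂, hz₂, fun h4 => hne (h3.trans h4.symm)⟩
    · exact ⟨z₁, hz₁, h3⟩
  obtain ⟨z, hz, hzne⟩ := hother
  have hzS : z ∈ S := by
    refine ⟨hz.1, zm, hzm.1, hzm.2.trans hz.2.symm, lt_of_le_of_ne (hmax z hz) fun h4 => hzne ?_⟩
    exact hinj z (openAnnulus_mono hr₀ρ.le hz.1) zm (openAnnulus_mono hr₀ρ.le hzm.1)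
      (hz.2.trans hzm.2.symm) h4
  obtain ⟨x, -, hx1, hx2⟩ := isPreconnected_openAnnulus hb0 one_pos (Q \ S) S hTopen hSopen
    (fun x hx => by
      by_cases hxS : x ∈ S
      · exact Or.inr hxS
      · exact Or.inl ⟨hx, hxS⟩) ⟨zm, hFQ zm hzm, htop⟩ ⟨z, hFQ z hz, hzS⟩
  exact hx1.2 hx2

/-- With a single sheet, the map is injective near the unit circle. -/
theorem exists_injOn (h : IsPlanarBranch f r r₁ 1) :
    ∃ b, r₁ < b ∧ b < 1 ∧ InjOn f (openAnnulus b 1) := by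
  obtain ⟨ρ, hρ, hρ1⟩ := exists_between h.lt_one
  obtain ⟨m, hm, hmin⟩ := h.exists_pos_forall_lt_norm hρ hρ1
  obtain ⟨b, hρb, hb1, hb⟩ := h.exists_forall_norm_lt (h.r_lt.trans hρ) hρ1 hm
  refine ⟨b, hρ.trans hρb, hb1, fun z hz z' hz' heq => ?_⟩
  have hcard := h.encard_preimage hρ hρ1 (h.ne_zero z (openAnnulus_mono (hρ.trans hρb).le hz))
    fun w hw => (hb z hz.1.le hz.2.le).trans (hmin w hw.ge hw.le)
  obtain ⟨x, hx⟩ := Set.encard_eq_one.1 (by exact_mod_cast hcard)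
  have h1 : z ∈ ({x} : Set ℂ) := by rw [← hx]; exact ⟨openAnnulus_mono hρb.le hz, rfl⟩
  have h2 : z' ∈ ({x} : Set ℂ) := by rw [← hx]; exact ⟨openAnnulus_mono hρb.le hz', heq.symm⟩
  exact h1.trans h2.symm

theorem isOpenEmbedding_domRestrict (h : IsPlanarBranch f r r₁ N) {b : ℝ} (hb : r ≤ b)
    (hinj : InjOn f (openAnnulus b 1)) : IsOpenEmbedding ((openAnnulus b 1).domRestrict f) := by
  have hsub : openAnnulus b 1 ⊆ openAnnulus r 1 := openAnnulus_mono hb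
  refine .of_continuous_injective_isOpenMap ?_ (injOn_iff_injective.1 hinj) ?_
  · exact continuousOn_iff_continuous_domRestrict.1
      (h.continuousOn.mono fun z hz => ⟨(hsub hz).1, hz.2.le⟩)
  · rw [isOpenMap_iff_nhds_le]
    intro z
    rw [domRestrict_eq, ← map_map, (isOpen_openAnnulus b 1).isOpenEmbedding_subtypeVal.map_nhds_eq z,
      h.map_nhds (hsub z.2)]
    exact le_rfl

end IsPlanarBranch

/-! ### The height over the plane near a conelike singularity -/

/-- The pairing of null vectors does not vanish even if one of them is degenerate (`‖A‖ = ‖B‖`), as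
the data are on the imaginary axis. -/
theorem nullPairing_ne_zero {A B C p q e : ℂ} (h : A * B = C ^ 2) (h' : q * p = e ^ 2)
    (hAB : ‖B‖ ≤ ‖A‖) (hA : A ≠ 0) (hpq : ‖p‖ < ‖q‖) : nullPairing A B C p q e ≠ 0 := by
  obtain ⟨x, y, rfl, rfl, rfl⟩ := exists_sq_eq_mul_eq h
  obtain ⟨u, t, rfl, rfl, rfl⟩ := exists_sq_eq_mul_eq h'
  rw [nullPairing_sq]
  simp only [norm_pow] at hAB hpq
  have hyx : ‖y‖ ≤ ‖x‖ := le_of_sq_le_sq hAB (norm_nonneg _)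
  have htu : ‖t‖ < ‖u‖ := lt_of_pow_lt_pow_left₀ 2 (norm_nonneg _) hpq
  have hx : 0 < ‖x‖ := norm_pos_iff.2 fun h0 => hA (by rw [h0]; simp)
  refine div_ne_zero (pow_ne_zero _ (sub_ne_zero.2 fun heq => ?_)) two_ne_zero
  have := congrArg norm heq
  rw [norm_mul, norm_mul] at this
  nlinarith [norm_nonneg t, norm_nonneg y]

/-- The coefficient on the strip of the differential of the height `-⟨Y - p₀, ν⟩`. -/
def heightForm (φ : Fin 3 → ℂ → ℂ) (ν : L3) (w : ℂ) : ℂ :=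
  -complexLorentz (fun j => expPullback (φ j) w) fun j => (ν j : ℂ)

theorem hasFDerivAt_height {Z : ℂ → L3} {p₀ : L3} {c : Fin 3 → ℂ} {z : ℂ} (ν : L3)
    (h : ∀ j, HasFDerivAt (fun w => Z w j)
      (Complex.reCLM.comp (c j • ContinuousLinearMap.id ℝ ℂ)) z) :
    HasFDerivAt (fun w => -lorentz (Z w - p₀) ν)
      (Complex.reCLM.comp (-complexLorentz c (fun j => (ν j : ℂ)) • ContinuousLinearMap.id ℝ ℂ)) z := by
  have h1 := fun j => ((h j).sub_const (p₀ j)).mul_const (ν j)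
  have h2 := (((h1 0).add (h1 1)).sub (h1 2)).neg
  refine (h2.congr_of_eventuallyEq (Eventually.of_forall fun w => ?_)).congr_fderiv ?_
  · simp only [lorentz_apply]
    rfl
  · refine ContinuousLinearMap.ext fun v => ?_
    simp [complexLorentz]
    ring

/-- For a null vector `x`, the relation `⟨x, x⟩ = 0` in the frame reads
`⟨x, e⟩ ⟨x, conj e⟩ = ⟨x, ν⟩²` with `e` the complex frame vector. -/
theorem IsLorentzFrame.complexLorentz_mul {e₁ e₂ ν : L3} (h : IsLorentzFrame e₁ e₂ ν)
    {x : Fin 3 → ℂ} (hx : x 0 ^ 2 + x 1 ^ 2 = x 2 ^ 2) :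
    complexLorentz x (complexFrame e₁ e₂)
      * (complexLorentz x fun j => (starRingEnd ℂ) (complexFrame e₁ e₂ j))
      = (-complexLorentz x fun j => (ν j : ℂ)) ^ 2 := by
  obtain ⟨h00, h11, h22, h01, h02, h12⟩ := h.completeness
  have c00 : (e₁ 0 * e₁ 0 + e₂ 0 * e₂ 0 - ν 0 * ν 0 : ℂ) = 1 := by exact_mod_cast h00
  have c11 : (e₁ 1 * e₁ 1 + e₂ 1 * e₂ 1 - ν 1 * ν 1 : ℂ) = 1 := by exact_mod_cast h11
  have c22 : (e₁ 2 * e₁ 2 + e₂ 2 * e₂ 2 - ν 2 * ν 2 : ℂ) = -1 := by exact_mod_cast h22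
  have c01 : (e₁ 0 * e₁ 1 + e₂ 0 * e₂ 1 - ν 0 * ν 1 : ℂ) = 0 := by exact_mod_cast h01
  have c02 : (e₁ 0 * e₁ 2 + e₂ 0 * e₂ 2 - ν 0 * ν 2 : ℂ) = 0 := by exact_mod_cast h02
  have c12 : (e₁ 1 * e₁ 2 + e₂ 1 * e₂ 2 - ν 1 * ν 2 : ℂ) = 0 := by exact_mod_cast h12
  have hsplit : complexLorentz x (complexFrame e₁ e₂)
      * (complexLorentz x fun j => (starRingEnd ℂ) (complexFrame e₁ e₂ j))
      = (complexLorentz x fun j => (e₁ j : ℂ)) ^ 2 + (complexLorentz x fun j => (e₂ j : ℂ)) ^ 2 := by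
    simp only [complexLorentz, complexFrame, map_add, map_mul, Complex.conj_ofReal, Complex.conj_I]
    linear_combination (-(x 0 * e₂ 0 + x 1 * e₂ 1 - x 2 * e₂ 2) ^ 2 : ℂ) * Complex.I_sq
  rw [hsplit]
  simp only [complexLorentz]
  linear_combination x 0 ^ 2 * c00 + x 1 ^ 2 * c11 + x 2 ^ 2 * c22 + 2 * x 0 * x 1 * c01
    - 2 * x 0 * x 2 * c02 - 2 * x 1 * x 2 * c12 + hx

theorem mul_I_mem_strip {r : ℝ} (hr : 0 < r) (hr1 : r < 1) (t : ℝ) :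
    (t * Complex.I : ℂ) ∈ strip (-Real.log r) := by
  show |(t * Complex.I : ℂ).re| < -Real.log r
  have := Real.log_neg hr hr1
  simpa using this

/-- If the height differential has no zeros on the circle, then no planar projection of the data
does. -/
theorem planarForm_ne_zero {r : ℝ} {φ : Fin 3 → ℂ → ℂ} (hr : 0 < r) (hr1 : r < 1) {σ : ℂ}
    (hσ : σ = Complex.I ∨ σ = -Complex.I)
    (hN : IsNullData (-Real.log r) (fun w => expPullback (φ 0) w + σ * expPullback (φ 1) w)
      (fun w => expPullback (φ 0) w - σ * expPullback (φ 1) w) (expPullback (φ 2)))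
    {e₁ e₂ ν : L3} (hF : IsLorentzFrame e₁ e₂ ν)
    (hlt : ‖complexFrame e₁ e₂ 0 + σ * complexFrame e₁ e₂ 1‖
        < ‖complexFrame e₁ e₂ 0 - σ * complexFrame e₁ e₂ 1‖)
    (hφ : ∀ z ∈ sphere (0 : ℂ) 1, φ 2 z ≠ 0) (t : ℝ) :
    planarForm φ e₁ e₂ (t * Complex.I) ≠ 0 := by
  have hmem := mul_I_mem_strip hr hr1 t
  have hnull := hN.null _ hmem
  have hC : expPullback (φ 2) (t * Complex.I) ≠ 0 :=
    mul_ne_zero (Complex.exp_ne_zero _) (hφ _ (by simp [Complex.norm_exp_ofReal_mul_I]))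
  have hrefl := hN.reflection_A _ hmem
  rw [axisReflection_of_re_eq_zero (by simp)] at hrefl
  rw [planarForm, complexLorentz_eq_nullPairing hσ]
  refine nullPairing_ne_zero hnull (hF.complexFrame_null hσ) ?_ ?_ hlt
  · have := congrArg norm hrefl
    rw [RCLike.norm_conj] at this
    exact this.ge
  · intro h0
    simp only [h0, zero_mul] at hnull
    exact hC (pow_eq_zero_iff two_ne_zero |>.1 hnull.symm)

namespace IsWeierstrassData

variable {Y : ℂ → L3} {p₀ : L3} {r : ℝ} {g : ℂ → ℂ} {φ : Fin 3 → ℂ → ℂ}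

theorem heightForm_axisReflection (W : IsWeierstrassData Y p₀ r g φ) (hr : 0 < r)
    (hY : ∀ z : ℂ, ‖z‖ = 1 → Y z = p₀) (ν : L3) {w : ℂ} (hw : w ∈ strip (-Real.log r)) :
    heightForm φ ν (axisReflection w) = (starRingEnd ℂ) (heightForm φ ν w) := by
  simp only [heightForm, complexLorentz, W.expPullback_axisReflection hr hY _ hw, map_sub, map_add,
    map_mul, map_neg, Complex.conj_ofReal]

theorem planarForm_mul (W : IsWeierstrassData Y p₀ r g φ) (hr : 0 < r)
    (hY : ∀ z : ℂ, ‖z‖ = 1 → Y z = p₀) {e₁ e₂ ν : L3} (hF : IsLorentzFrame e₁ e₂ ν) {w : ℂ}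
    (hw : w ∈ strip (-Real.log r)) :
    planarForm φ e₁ e₂ w * (starRingEnd ℂ) (planarForm φ e₁ e₂ (axisReflection w))
      = heightForm φ ν w ^ 2 := by
  rw [W.conj_planarForm_axisReflection hr hY e₁ e₂ hw]
  exact hF.complexLorentz_mul (W.expPullback_sq_add_sq hr hw)

/-- On the axis the surface is lightlike: height and planar projection have derivatives of the same
size. -/
theorem heightForm_axis (W : IsWeierstrassData Y p₀ r g φ) (hr : 0 < r) (hr1 : r < 1)
    (hY : ∀ z : ℂ, ‖z‖ = 1 → Y z = p₀) {e₁ e₂ ν : L3} (hF : IsLorentzFrame e₁ e₂ ν) (t : ℝ) :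
    (heightForm φ ν (t * Complex.I)).im = 0 ∧
      |(heightForm φ ν (t * Complex.I)).re| = ‖planarForm φ e₁ e₂ (t * Complex.I)‖ := by
  have hmem := mul_I_mem_strip hr hr1 t
  have h1 := W.heightForm_axisReflection hr hY ν hmem
  have h2 := W.planarForm_mul hr hY hF hmem
  rw [axisReflection_of_re_eq_zero (by simp)] at h1 h2
  have him : (heightForm φ ν (t * Complex.I)).im = 0 := Complex.conj_eq_iff_im.1 h1.symm
  refine ⟨him, ?_⟩
  have hre : heightForm φ ν (t * Complex.I) = ((heightForm φ ν (t * Complex.I)).re : ℂ) :=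
    Complex.ext (by simp) (by simpa using him)
  rw [hre, Complex.mul_conj, Complex.normSq_eq_norm_sq] at h2
  have h3 : ‖planarForm φ e₁ e₂ (t * Complex.I)‖ ^ 2 = (heightForm φ ν (t * Complex.I)).re ^ 2 := by
    exact_mod_cast h2
  rw [← abs_of_nonneg (norm_nonneg (planarForm φ e₁ e₂ _))]
  exact ((sq_eq_sq_iff_abs_eq_abs _ _).1 h3).symm

theorem continuousOn_heightForm (W : IsWeierstrassData Y p₀ r g φ) (hr : 0 < r) (ν : L3) :
    ContinuousOn (heightForm φ ν) (strip (-Real.log r)) := by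
  have hc := fun j => (differentiableOn_expPullback hr (W.holomorphic j)).continuousOn
  exact ((((hc 0).mul continuousOn_const).add ((hc 1).mul continuousOn_const)).sub
    ((hc 2).mul continuousOn_const)).neg

theorem continuousOn_planarForm (W : IsWeierstrassData Y p₀ r g φ) (hr : 0 < r) (e₁ e₂ : L3) :
    ContinuousOn (planarForm φ e₁ e₂) (strip (-Real.log r)) := by
  have hc := fun j => (differentiableOn_expPullback hr (W.holomorphic j)).continuousOn
  exact (((hc 0).mul continuousOn_const).add ((hc 1).mul continuousOn_const)).sub
    ((hc 2).mul continuousOn_const)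

/-- After a choice of the unit normal, the surface leaves its singularity on the upper side of the
plane. -/
theorem exists_adaptedFrame_heightForm_neg (W : IsWeierstrassData Y p₀ r g φ) (hr : 0 < r)
    (hr1 : r < 1) (hY : ∀ z : ℂ, ‖z‖ = 1 → Y z = p₀) {P : AffineSubspace ℝ L3} {e₁ e₂ ν : L3}
    (hF : IsAdaptedFrame P e₁ e₂ ν) (ha : ∀ t : ℝ, planarForm φ e₁ e₂ (t * Complex.I) ≠ 0) :
    ∃ ν', IsAdaptedFrame P e₁ e₂ ν' ∧ ∀ t : ℝ,
      heightForm φ ν' (t * Complex.I) = -(‖planarForm φ e₁ e₂ (t * Complex.I)‖ : ℂ) := by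
  have hcont : Continuous fun t : ℝ => (heightForm φ ν (t * Complex.I)).re :=
    Complex.continuous_re.comp ((W.continuousOn_heightForm hr ν).comp_continuous (by fun_prop)
      (mul_I_mem_strip hr hr1))
  have hne : ∀ t : ℝ, (heightForm φ ν (t * Complex.I)).re ≠ 0 := fun t h0 => by
    have := (W.heightForm_axis hr hr1 hY hF.toIsLorentzFrame t).2
    rw [h0, abs_zero] at this
    exact ha t (norm_eq_zero.1 this.symm)
  have hsign : (∀ t : ℝ, (heightForm φ ν (t * Complex.I)).re < 0) ∨
      ∀ t : ℝ, 0 < (heightForm φ ν (t * Complex.I)).re := by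
    by_contra! hcon
    obtain ⟨⟨t, ht⟩, ⟨s, hs⟩⟩ := hcon
    obtain ⟨x, hx⟩ := mem_range_of_exists_le_of_exists_ge hcont ⟨s, hs⟩ ⟨t, ht⟩
    exact hne x hx
  have hkey : ∀ ν' : L3, IsAdaptedFrame P e₁ e₂ ν' →
      (∀ t : ℝ, (heightForm φ ν' (t * Complex.I)).re < 0) → ∀ t : ℝ,
      heightForm φ ν' (t * Complex.I) = -(‖planarForm φ e₁ e₂ (t * Complex.I)‖ : ℂ) := by
    intro ν' hF' hneg t
    obtain ⟨h1, h2⟩ := W.heightForm_axis hr hr1 hY hF'.toIsLorentzFrame t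
    rw [abs_of_neg (hneg t)] at h2
    rw [← h2]
    apply Complex.ext <;> simp [h1]
  rcases hsign with h | h
  · exact ⟨ν, hF, hkey ν hF h⟩
  · have hF' : IsAdaptedFrame P e₁ e₂ (-ν) :=
      ⟨hF.toIsLorentzFrame.neg_normal, hF.mem_1, hF.mem_2, fun v => by
        rw [hF.mem_iff, map_neg, neg_eq_zero]⟩
    refine ⟨-ν, hF', hkey _ hF' fun t => ?_⟩
    have : heightForm φ (-ν) (t * Complex.I) = -heightForm φ ν (t * Complex.I) := by
      simp [heightForm, complexLorentz]; ring
    rw [this, Complex.neg_re]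
    exact neg_neg_of_pos (h t)

end IsWeierstrassData

/-! ### Graphs over the plane of a branch with a single sheet -/

/-- The real linear form on the plane with gradient `p`. -/
def gradForm (p : ℂ) : ℂ →L[ℝ] ℝ :=
  Complex.reCLM.comp ((starRingEnd ℂ) p • ContinuousLinearMap.id ℝ ℂ)

theorem gradForm_apply (p v : ℂ) : gradForm p v = ((starRingEnd ℂ) p * v).re := rfl

/-- The gradient, with respect to a planar map with differential `planarDifferential a b`, of a
function with differential `v ↦ Re (c v)`, provided that `a b = c²`. -/
def planarGradient (a b c : ℂ) : ℂ := 2 * (starRingEnd ℂ) c * a / (‖a‖ * (‖a‖ + ‖b‖) : ℝ)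

/-- Chain rule: `planarGradient` is the gradient of the height as a function on the plane. -/
theorem gradForm_comp_planarDifferential {a b c : ℂ} (h : a * b = c ^ 2) (ha : a ≠ 0) :
    (gradForm (planarGradient a b c)).comp (planarDifferential a b)
      = Complex.reCLM.comp (c • ContinuousLinearMap.id ℝ ℂ) := by
  have ha' : 0 < ‖a‖ := norm_pos_iff.2 ha
  have hD : (‖a‖ * (‖a‖ + ‖b‖) : ℝ) ≠ 0 := by positivity
  have hDc : ((‖a‖ * (‖a‖ + ‖b‖) : ℝ) : ℂ) ≠ 0 := by exact_mod_cast hD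
  have hcc : (starRingEnd ℂ) c * c = (‖a‖ * ‖b‖ : ℝ) := by
    rw [Complex.conj_mul', ← norm_mul, h, norm_pow]; push_cast; rfl
  have haa : (starRingEnd ℂ) a * a = (‖a‖ ^ 2 : ℝ) := by rw [Complex.conj_mul']; push_cast; rfl
  have key : (starRingEnd ℂ) (planarGradient a b c) * a + planarGradient a b c * b = 2 * c := by
    simp only [planarGradient, map_div₀, map_mul, Complex.conj_conj, Complex.conj_ofReal, map_ofNat]
    rw [div_mul_eq_mul_div, div_mul_eq_mul_div, ← add_div, div_eq_iff hDc]
    push_cast at hcc haa ⊢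
    linear_combination 2 * c * haa + 2 * (starRingEnd ℂ) c * h + 2 * c * hcc
  refine ContinuousLinearMap.ext fun v => ?_
  have h1 : gradForm (planarGradient a b c) (planarDifferential a b v)
      = (((starRingEnd ℂ) (planarGradient a b c) * a + planarGradient a b c * b) * v / 2).re := by
    have h2 : ((starRingEnd ℂ) (planarGradient a b c) * (starRingEnd ℂ) (b * v)).re
        = (planarGradient a b c * (b * v)).re := by rw [← map_mul, Complex.conj_re]
    rw [gradForm_apply, planarDifferential_apply]
    have e1 : (starRingEnd ℂ) (planarGradient a b c) * ((a * v + (starRingEnd ℂ) (b * v)) / 2)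
        = ((starRingEnd ℂ) (planarGradient a b c) * (a * v)
          + (starRingEnd ℂ) (planarGradient a b c) * (starRingEnd ℂ) (b * v)) / ((2 : ℝ) : ℂ) := by
      push_cast; ring
    have e2 : ((starRingEnd ℂ) (planarGradient a b c) * a + planarGradient a b c * b) * v / 2
        = ((starRingEnd ℂ) (planarGradient a b c) * (a * v) + planarGradient a b c * (b * v))
          / ((2 : ℝ) : ℂ) := by
      push_cast; ring
    rw [e1, e2, Complex.div_ofReal_re, Complex.div_ofReal_re, Complex.add_re, Complex.add_re, h2]
  rw [ContinuousLinearMap.comp_apply, h1, key]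
  have e3 : 2 * c * v / 2 = c * v := by ring
  rw [e3]
  rfl

/-- At points of the circle the gradient of the height is a unit vector, as for the light cone. -/
theorem planarGradient_axis {a : ℂ} (ha : a ≠ 0) :
    planarGradient a ((starRingEnd ℂ) a) (-(‖a‖ : ℂ)) = -a / ‖a‖ := by
  have ha' : (‖a‖ : ℂ) ≠ 0 := by exact_mod_cast norm_ne_zero_iff.2 ha
  simp only [planarGradient, map_neg, Complex.conj_ofReal, RCLike.norm_conj]
  push_cast
  field_simp
  ring

/-- If the planar map has a single sheet, a function `H` on the annulus that vanishes on the circle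
descends to a function `U` on a neighbourhood of the origin. The bounds on `H` and on its gradient `p`
near the circle become the asymptotics of `U` at the origin. -/
theorem IsPlanarBranch.exists_graph {f : ℂ → ℂ} {r r₁ : ℝ} (h : IsPlanarBranch f r r₁ 1)
    {H : ℂ → ℝ} {p : ℂ → ℂ} {r₂ : ℝ} (hr₂ : r₂ < 1) (hH0 : ∀ z : ℂ, ‖z‖ = 1 → H z = 0)
    (hd : ∀ z ∈ openAnnulus r₂ 1, ∃ L : ℂ ≃L[ℝ] ℂ, HasStrictFDerivAt f (L : ℂ →L[ℝ] ℂ) z ∧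
      HasFDerivAt H ((gradForm (p z)).comp (L : ℂ →L[ℝ] ℂ)) z)
    (hlim : ∀ η > 0, ∃ b < 1, ∀ z ∈ openAnnulus b 1,
      |H z / ‖f z‖ - 1| < η ∧ ‖p z - f z / ‖f z‖‖ < η) :
    ∃ (r₀ : ℝ) (U : ℂ → ℝ) (q : ℂ → ℂ), r ≤ r₀ ∧ r₀ < 1 ∧ InjOn f (openAnnulus r₀ 1) ∧
      IsOpen (f '' outerClosedAnnulus r₀) ∧ 0 ∈ f '' outerClosedAnnulus r₀ ∧
      ContinuousOn U (f '' outerClosedAnnulus r₀) ∧ (∀ z ∈ outerClosedAnnulus r₀, U (f z) = H z) ∧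
      (∀ y ∈ f '' outerClosedAnnulus r₀, 0 ≤ U y) ∧
      Tendsto (fun y => U y / ‖y‖) (𝓝[≠] 0) (𝓝 1) ∧
      (∀ᶠ y in 𝓝[≠] 0, HasFDerivAt U (gradForm (q y)) y) ∧
      Tendsto (fun y => q y - y / ‖y‖) (𝓝[≠] 0) (𝓝 0) := by
  obtain ⟨b₁, hb₁, hb₁1, hinj₁⟩ := h.exists_injOn
  obtain ⟨b₂, hb₂, hb₂lim⟩ := hlim 1 one_pos
  obtain ⟨r₀, hr₀, hr₀1⟩ := exists_between (max_lt hb₁1 (max_lt hb₂ hr₂))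
  have hb₁r₀ : b₁ < r₀ := (le_max_left _ _).trans_lt hr₀
  have hb₂r₀ : b₂ < r₀ := ((le_max_left _ _).trans (le_max_right _ _)).trans_lt hr₀
  have hr₂r₀ : r₂ < r₀ := ((le_max_right _ _).trans (le_max_right _ _)).trans_lt hr₀
  have hr₁r₀ : r₁ < r₀ := hb₁.trans hb₁r₀
  have hrr₀ : r < r₀ := h.r_lt.trans hr₁r₀
  have hinj : InjOn f (openAnnulus r₀ 1) := hinj₁.mono (openAnnulus_mono hb₁r₀.le)
  have hcase : ∀ z ∈ outerClosedAnnulus r₀, z ∈ openAnnulus r₀ 1 ∨ ‖z‖ = 1 := fun z hz =>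
    (lt_or_eq_of_le hz.2).imp (fun h1 => ⟨hz.1, h1⟩) id
  have hne : ∀ z ∈ openAnnulus r₀ 1, f z ≠ 0 := fun z hz =>
    h.ne_zero z (openAnnulus_mono hr₁r₀.le hz)
  have hone : (1 : ℂ) ∈ outerClosedAnnulus r₀ := ⟨by simpa using hr₀1, by simp⟩
  have h0mem : (0 : ℂ) ∈ f '' outerClosedAnnulus r₀ := ⟨1, hone, h.circle 1 (by simp)⟩
  -- small values are attained close to the circle
  have hsmall : ∀ b < 1, ∀ᶠ y in 𝓝[≠] (0 : ℂ), ∃ z ∈ openAnnulus (max b r₀) 1, f z = y := by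
    intro b hb
    obtain ⟨ρ, hρ, hρ1⟩ := exists_between (max_lt hb₁1 hr₀1)
    have hr₁ρ : r₁ < ρ := hb₁.trans ((le_max_left _ _).trans_lt hρ)
    obtain ⟨b', hb', hb'1⟩ := exists_between (max_lt hb (max_lt hr₀1 hρ1))
    obtain ⟨m, hm, hmin⟩ := h.exists_pos_forall_lt_norm hr₁ρ hb'1
    have hball : ∀ᶠ y in 𝓝[≠] (0 : ℂ), ‖y‖ < m := by
      filter_upwards [nhdsWithin_le_nhds (ball_mem_nhds (0 : ℂ) hm)] with y hy
      simpa using hy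
    have hρb' : ρ < b' := ((le_max_right _ _).trans (le_max_right _ _)).trans_lt hb'
    filter_upwards [hball, self_mem_nhdsWithin] with y hy hy0
    have hcard := h.encard_preimage hr₁ρ hρ1 hy0 fun z hz =>
      hy.trans (hmin z hz.ge (hz.le.trans hρb'.le))
    obtain ⟨z, hz⟩ := Set.encard_eq_one.1 (by exact_mod_cast hcard)
    have hzm : z ∈ {z | z ∈ openAnnulus ρ 1 ∧ f z = y} := by rw [hz]; exact mem_singleton z
    refine ⟨z, ⟨?_, hzm.1.2⟩, hzm.2⟩
    by_contra hcon
    have h1 := hmin z hzm.1.1.le ((not_lt.1 hcon).trans (max_le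
      ((le_max_left _ _).trans hb'.le) (((le_max_left _ _).trans (le_max_right _ _)).trans hb'.le)))
    rw [hzm.2] at h1
    exact absurd hy (not_lt.2 h1.le)
  have himg : ∀ z ∈ openAnnulus r₀ 1, f '' openAnnulus r₀ 1 ∈ 𝓝 (f z) := fun z hz => by
    rw [← h.map_nhds (openAnnulus_mono hrr₀.le hz)]
    exact image_mem_map ((isOpen_openAnnulus _ _).mem_nhds hz)
  have hsub : openAnnulus r₀ 1 ⊆ outerClosedAnnulus r₀ := fun z hz => ⟨hz.1, hz.2.le⟩
  have hopen : IsOpen (f '' outerClosedAnnulus r₀) := by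
    rw [isOpen_iff_mem_nhds]
    rintro _ ⟨z, hz, rfl⟩
    rcases hcase z hz with h1 | h1
    · exact mem_of_superset (himg z h1) (image_mono hsub)
    · rw [h.circle z h1]
      have h2 := hsmall 0 one_pos
      rw [eventually_nhdsWithin_iff] at h2
      filter_upwards [h2] with y hy
      by_cases hy0 : y = 0
      · rw [hy0]; exact h0mem
      · obtain ⟨x, hx, rfl⟩ := hy hy0
        exact ⟨x, hsub (openAnnulus_mono (le_max_right _ _) hx), rfl⟩
  let inv : ℂ → ℂ := Function.invFunOn f (outerClosedAnnulus r₀)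
  have hinv : ∀ z ∈ openAnnulus r₀ 1, inv (f z) = z := by
    intro z hz
    have hex : ∃ x ∈ outerClosedAnnulus r₀, f x = f z := ⟨z, hsub hz, rfl⟩
    have h1 := Function.invFunOn_mem hex
    have h2 := Function.invFunOn_eq hex
    rcases hcase _ h1 with h3 | h3
    · exact hinj h3 hz h2
    · exact absurd (h2.symm.trans (h.circle _ h3)) (hne z hz)
  have hinv0 : ‖inv 0‖ = 1 := by
    have h1 := Function.invFunOn_mem h0mem
    have h2 := Function.invFunOn_eq h0mem
    rcases hcase _ h1 with h3 | h3
    · exact absurd h2 (hne _ h3)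
    · exact h3
  let U : ℂ → ℝ := fun y => H (inv y)
  let q : ℂ → ℂ := fun y => p (inv y)
  have hU : ∀ z ∈ outerClosedAnnulus r₀, U (f z) = H z := by
    intro z hz
    rcases hcase z hz with h1 | h1
    · simp only [U, hinv z h1]
    · simp only [U, h.circle z h1, hH0 z h1, hH0 _ hinv0]
  have hder : ∀ z ∈ openAnnulus r₀ 1, HasFDerivAt U (gradForm (q (f z))) (f z) := by
    intro z hz
    obtain ⟨L, hL, hHL⟩ := hd z (openAnnulus_mono hr₂r₀.le hz)
    have h1 := hL.to_localInverse.hasFDerivAt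
    have h2 : hL.localInverse f L z (f z) = z := hL.localInverse_apply_image
    have h3 : HasFDerivAt H ((gradForm (p z)).comp (L : ℂ →L[ℝ] ℂ))
        (hL.localInverse f L z (f z)) := by rwa [h2]
    have h4 := h3.comp (f z) h1
    have hq : q (f z) = p z := by simp only [q, hinv z hz]
    rw [hq]
    refine (h4.congr_of_eventuallyEq ?_).congr_fderiv ?_
    · have h5 : ∀ᶠ y in 𝓝 (f z), hL.localInverse f L z y ∈ openAnnulus r₀ 1 := by
        refine h1.continuousAt.eventually_mem ?_
        rw [h2]; exact (isOpen_openAnnulus _ _).mem_nhds hz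
      filter_upwards [h5, hL.eventually_right_inverse] with y hy1 hy2
      conv_lhs => rw [← hy2]
      rw [hU _ (hsub hy1)]
      rfl
    · refine ContinuousLinearMap.ext fun v => ?_
      simp
  have hratio : ∀ z ∈ openAnnulus r₀ 1, 0 < H z := fun z hz => by
    have h1 := (hb₂lim z (openAnnulus_mono hb₂r₀.le hz)).1
    have h2 : 0 < H z / ‖f z‖ := by linarith [(abs_lt.1 h1).1]
    exact (div_pos_iff_of_pos_right (norm_pos_iff.2 (hne z hz))).1 h2
  have hT1 : Tendsto (fun y => U y / ‖y‖) (𝓝[≠] 0) (𝓝 1) := by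
    rw [Metric.tendsto_nhds]
    intro η hη
    obtain ⟨b, hb, hblim⟩ := hlim η hη
    filter_upwards [hsmall b hb] with y hy
    obtain ⟨z, hz, rfl⟩ := hy
    rw [hU z (hsub (openAnnulus_mono (le_max_right _ _) hz)), Real.dist_eq]
    exact (hblim z (openAnnulus_mono (le_max_left _ _) hz)).1
  refine ⟨r₀, U, q, hrr₀.le, hr₀1, hinj, hopen, h0mem, ?_, hU, ?_, hT1, ?_, ?_⟩
  · rintro _ ⟨z, hz, rfl⟩
    rcases hcase z hz with h1 | h1
    · exact (hder z h1).continuousAt.continuousWithinAt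
    · rw [h.circle z h1]
      have hU0 : U 0 = 0 := hH0 _ hinv0
      have h2 : Tendsto U (𝓝[≠] 0) (𝓝 (U 0)) := by
        have h3 : Tendsto (fun y : ℂ => ‖y‖) (𝓝[≠] 0) (𝓝 0) := by
          simpa using (continuous_norm.tendsto (0 : ℂ)).mono_left nhdsWithin_le_nhds
        have h4 := hT1.mul h3
        rw [one_mul] at h4
        rw [hU0]
        refine h4.congr' ?_
        filter_upwards [self_mem_nhdsWithin] with y hy
        exact div_mul_cancel₀ _ (norm_ne_zero_iff.2 hy)
      exact (continuousAt_iff_punctured_nhds.2 h2).continuousWithinAt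
  · rintro _ ⟨z, hz, rfl⟩
    rw [hU z hz]
    rcases hcase z hz with h1 | h1
    · exact (hratio z h1).le
    · exact (hH0 z h1).ge
  · filter_upwards [hsmall 0 one_pos] with y hy
    obtain ⟨z, hz, rfl⟩ := hy
    exact hder z (openAnnulus_mono (le_max_right _ _) hz)
  · rw [Metric.tendsto_nhds]
    intro η hη
    obtain ⟨b, hb, hblim⟩ := hlim η hη
    filter_upwards [hsmall b hb] with y hy
    obtain ⟨z, hz, rfl⟩ := hy
    rw [dist_zero_right]
    simp only [q, hinv z (openAnnulus_mono (le_max_right _ _) hz)]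
    exact (hblim z (openAnnulus_mono (le_max_left _ _) hz)).2

/-! ### The asymptotics at a conelike singularity -/

/-- A function that vanishes on the imaginary axis, divided by the signed distance to the axis, tends to its
derivative in the normal direction. The derivative must be strict, as `w` may approach the point
tangentially. -/
theorem tendsto_re_inv_smul {E : Type*} [NormedAddCommGroup E] [NormedSpace ℝ E] {G : ℂ → E}
    {L : ℂ →L[ℝ] E} {t : ℝ} (hG : HasStrictFDerivAt G L (t * Complex.I))
    (h0 : ∀ s : ℝ, G (s * Complex.I) = 0) :
    Tendsto (fun w : ℂ => w.re⁻¹ • G w) (𝓝[{w | w.re < 0}] (t * Complex.I)) (𝓝 (L 1)) := by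
  have hpath : Tendsto (fun w : ℂ => (w, (w.im * Complex.I : ℂ)))
      (𝓝[{w | w.re < 0}] (t * Complex.I)) (𝓝 ((t * Complex.I : ℂ), (t * Complex.I : ℂ))) := by
    have hc : Continuous fun w : ℂ => (w, (w.im * Complex.I : ℂ)) := by fun_prop
    have := hc.tendsto (t * Complex.I)
    simp only [Complex.mul_im, Complex.ofReal_re, Complex.I_im, Complex.ofReal_im, Complex.I_re,
      mul_one, mul_zero, add_zero] at this
    exact this.mono_left nhdsWithin_le_nhds
  rw [Metric.tendsto_nhds]
  intro η hη
  have h1 := hpath.eventually (hG.isLittleO.def (half_pos hη))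
  filter_upwards [h1, self_mem_nhdsWithin] with w hw hre
  have hre : w.re < 0 := hre
  have hsub : w - w.im * Complex.I = w.re • (1 : ℂ) := by
    apply Complex.ext <;> simp
  simp only [h0, sub_zero, hsub, map_smul] at hw
  rw [norm_smul, norm_one, mul_one] at hw
  have hpos : 0 < ‖w.re‖ := norm_pos_iff.2 hre.ne
  have e1 : w.re⁻¹ • G w - L 1 = w.re⁻¹ • (G w - w.re • L 1) := by
    rw [smul_sub, smul_smul, inv_mul_cancel₀ hre.ne, one_smul]
  rw [dist_eq_norm, e1, norm_smul, norm_inv]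
  calc ‖w.re‖⁻¹ * ‖G w - w.re • L 1‖ ≤ ‖w.re‖⁻¹ * (η / 2 * ‖w.re‖) := by gcongr
    _ = η / 2 := by field_simp
    _ < η := half_lt_self hη

/-- A `2πi`-periodic property that holds on the left of each point of the imaginary axis holds near
the unit circle, in the logarithmic coordinate. -/
theorem exists_forall_log_of_periodic {Q : ℂ → Prop}
    (hper : ∀ w, Q (w + 2 * Real.pi * Complex.I) ↔ Q w)
    (hloc : ∀ t : ℝ, ∀ᶠ w in 𝓝[{w : ℂ | w.re < 0}] (t * Complex.I), Q w) :
    ∃ b < 1, ∀ z ∈ openAnnulus b 1, 0 < b ∧ Q (Complex.log z) := by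
  have h1 := eventually_forall_of_periodic (P := fun x t => x < 0 → Q (x + t * Complex.I))
    (fun x t => by
      have : (x + ((t + 2 * Real.pi : ℝ) : ℂ) * Complex.I : ℂ)
          = x + t * Complex.I + 2 * Real.pi * Complex.I := by push_cast; ring
      rw [this, hper])
    (fun t => by
      have h2 := eventually_nhdsWithin_iff.1 (hloc t)
      have hc : Continuous fun z : ℝ × ℝ => (z.1 + z.2 * Complex.I : ℂ) := by fun_prop
      have h3 := hc.tendsto ((0 : ℝ), t)
      simp only [Complex.ofReal_zero, zero_add] at h3
      filter_upwards [h3.eventually h2] with z hz hneg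
      exact hz (show (z.1 + z.2 * Complex.I : ℂ).re < 0 by simpa using hneg))
  obtain ⟨δ, hδ, hδ'⟩ := Metric.eventually_nhds_iff.1 h1
  refine ⟨Real.exp (-δ), Real.exp_lt_one_iff.2 (by linarith), fun z hz => ⟨Real.exp_pos _, ?_⟩⟩
  have hn : 0 < ‖z‖ := (Real.exp_pos _).trans hz.1
  have h2 : -δ < Real.log ‖z‖ := (Real.lt_log_iff_exp_lt hn).2 hz.1
  have h3 := Real.log_neg hn hz.2
  have := hδ' (y := (Complex.log z).re) (by
    rw [Complex.log_re, Real.dist_eq, sub_zero, abs_of_neg h3]; linarith) (Complex.log z).im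
    (by rwa [Complex.log_re])
  rwa [Complex.re_add_im] at this

namespace IsWeierstrassData

variable {Y : ℂ → L3} {p₀ : L3} {r : ℝ} {g : ℂ → ℂ} {φ : Fin 3 → ℂ → ℂ}

/-- Near the circle, the ratio of the height and the planar distance tends to one, and the gradient
of the height tends to the radial unit vector. -/
theorem exists_forall_asymptotic (W : IsWeierstrassData Y p₀ r g φ) (hr : 0 < r) (hr1 : r < 1)
    (hY : ∀ z : ℂ, ‖z‖ = 1 → Y z = p₀) {e₁ e₂ ν : L3}
    (ha : ∀ t : ℝ, planarForm φ e₁ e₂ (t * Complex.I) ≠ 0)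
    (hc : ∀ t : ℝ,
      heightForm φ ν (t * Complex.I) = -(‖planarForm φ e₁ e₂ (t * Complex.I)‖ : ℂ))
    {η : ℝ} (hη : 0 < η) : ∃ b < 1, ∀ z ∈ openAnnulus b 1, 0 < b ∧
      (planarForm φ e₁ e₂ (Complex.log z) ≠ 0 ∧
      |-lorentz (schwarzExtension Y p₀ (Complex.exp (Complex.log z)) - p₀) ν
        / ‖planarCoord e₁ e₂ (schwarzExtension Y p₀ (Complex.exp (Complex.log z)) - p₀)‖ - 1| < η ∧
      ‖planarGradient (planarForm φ e₁ e₂ (Complex.log z))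
          ((starRingEnd ℂ) (planarForm φ e₁ e₂ (axisReflection (Complex.log z))))
          (heightForm φ ν (Complex.log z))
        - planarCoord e₁ e₂ (schwarzExtension Y p₀ (Complex.exp (Complex.log z)) - p₀)
          / ‖planarCoord e₁ e₂ (schwarzExtension Y p₀ (Complex.exp (Complex.log z)) - p₀)‖‖
        < η) := by
  set F : ℂ → ℂ := fun w => planarCoord e₁ e₂ (schwarzExtension Y p₀ (Complex.exp w) - p₀) with hF
  set Z : ℂ → ℝ := fun w => -lorentz (schwarzExtension Y p₀ (Complex.exp w) - p₀) ν with hZ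
  set a := planarForm φ e₁ e₂ with hadef
  set c := heightForm φ ν with hcdef
  refine exists_forall_log_of_periodic (Q := fun w => a w ≠ 0 ∧ |Z w / ‖F w‖ - 1| < η ∧
    ‖planarGradient (a w) ((starRingEnd ℂ) (a (axisReflection w))) (c w) - F w / ‖F w‖‖ < η)
    (fun w => ?_) fun t => ?_
  · have hrefl : axisReflection (w + 2 * Real.pi * Complex.I)
        = axisReflection w + 2 * Real.pi * Complex.I := by
      apply Complex.ext <;> simp
    have e1 : ∀ w, a (w + 2 * Real.pi * Complex.I) = a w := fun w => by
      simp only [hadef, planarForm, expPullback_periodic]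
    have e2 : c (w + 2 * Real.pi * Complex.I) = c w := by
      simp only [hcdef, heightForm, expPullback_periodic]
    have e3 : F (w + 2 * Real.pi * Complex.I) = F w := by simp only [hF, exp_add_two_pi_mul_I]
    have e4 : Z (w + 2 * Real.pi * Complex.I) = Z w := by simp only [hZ, exp_add_two_pi_mul_I]
    rw [hrefl, e1, e1, e2, e3, e4]
  have hmem := mul_I_mem_strip hr hr1 t
  have hnhds : strip (-Real.log r) ∈ 𝓝 (t * Complex.I : ℂ) := (isOpen_strip _).mem_nhds hmem
  have hrefl : axisReflection (t * Complex.I) = t * Complex.I :=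
    axisReflection_of_re_eq_zero (by simp)
  have hac : ContinuousAt a (t * Complex.I) :=
    (W.continuousOn_planarForm hr e₁ e₂).continuousAt hnhds
  have hcc : ContinuousAt c (t * Complex.I) :=
    (W.continuousOn_heightForm hr ν).continuousAt hnhds
  have harc : ContinuousAt (fun w => (starRingEnd ℂ) (a (axisReflection w))) (t * Complex.I) := by
    refine Complex.continuous_conj.continuousAt.comp ?_
    refine ContinuousAt.comp (g := a) ?_ continuous_axisReflection.continuousAt
    rwa [hrefl]
  have haxis : ∀ s : ℝ, schwarzExtension Y p₀ (Complex.exp (s * Complex.I)) = p₀ := fun s => by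
    have h1 : ‖Complex.exp (s * Complex.I)‖ = 1 := Complex.norm_exp_ofReal_mul_I s
    rw [schwarzExtension_of_le Y p₀ h1.le, hY _ h1]
  have hFd : HasStrictFDerivAt F (planarDifferential (a (t * Complex.I))
      ((starRingEnd ℂ) (a (axisReflection (t * Complex.I))))) (t * Complex.I) := by
    refine hasStrictFDerivAt_of_hasFDerivAt_of_continuousAt (f' := fun w =>
      planarDifferential (a w) ((starRingEnd ℂ) (a (axisReflection w)))) ?_ ?_
    · filter_upwards [hnhds] with w hw
      exact W.hasFDerivAt_planarCoord_comp_exp hr hY e₁ e₂ hw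
    · unfold planarDifferential
      exact ((hac.smul continuousAt_const).add
        (continuousAt_const.clm_comp (harc.smul continuousAt_const))).const_smul (1 / 2 : ℝ)
  have hZd : HasStrictFDerivAt Z (Complex.reCLM.comp (c (t * Complex.I) •
      ContinuousLinearMap.id ℝ ℂ)) (t * Complex.I) := by
    refine hasStrictFDerivAt_of_hasFDerivAt_of_continuousAt (f' := fun w =>
      Complex.reCLM.comp (c w • ContinuousLinearMap.id ℝ ℂ)) ?_ ?_
    · filter_upwards [hnhds] with w hw
      exact hasFDerivAt_height ν fun j => W.hasFDerivAt_comp_exp hr j hw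
    · exact continuousAt_const.clm_comp (hcc.smul continuousAt_const)
  have hFl := tendsto_re_inv_smul hFd fun s => by simp only [hF, haxis, sub_self, map_zero]
  have hZl := tendsto_re_inv_smul hZd fun s => by simp [hZ, haxis]
  rw [planarDifferential_apply, hrefl, mul_one, mul_one, Complex.conj_conj, add_self_div_two] at hFl
  have hc1 : (Complex.reCLM.comp (c (t * Complex.I) • ContinuousLinearMap.id ℝ ℂ)) 1
      = -‖a (t * Complex.I)‖ := by
    show (c (t * Complex.I) * 1).re = _
    rw [mul_one, hc t]; simp
  rw [hc1] at hZl
  have ha0 : a (t * Complex.I) ≠ 0 := ha t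
  have han : ‖a (t * Complex.I)‖ ≠ 0 := norm_ne_zero_iff.2 ha0
  have hneg : ∀ᶠ w in 𝓝[{w : ℂ | w.re < 0}] (t * Complex.I), w.re < 0 := self_mem_nhdsWithin
  -- `F / |F|` is the negative of the direction of `F / re w`, because `re w < 0`
  have hdir : Tendsto (fun w => F w / ‖F w‖) (𝓝[{w : ℂ | w.re < 0}] (t * Complex.I))
      (𝓝 (-a (t * Complex.I) / ‖a (t * Complex.I)‖)) := by
    have h1 := hFl.neg.div ((Complex.continuous_ofReal.tendsto _).comp hFl.norm)
      (by exact_mod_cast han)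
    refine h1.congr' ?_
    filter_upwards [hneg] with w hw
    simp only [Pi.div_apply, Function.comp_apply, norm_smul, norm_inv, Real.norm_eq_abs, abs_of_neg hw]
    simp only [Complex.real_smul]
    push_cast
    have hw' : (w.re : ℂ) ≠ 0 := by exact_mod_cast hw.ne
    by_cases h0 : (‖F w‖ : ℂ) = 0
    · simp [h0]
    · field_simp
  have hrat : Tendsto (fun w => Z w / ‖F w‖) (𝓝[{w : ℂ | w.re < 0}] (t * Complex.I)) (𝓝 1) := by
    have h1 := hZl.neg.div hFl.norm han
    rw [neg_neg, div_self han] at h1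
    refine h1.congr' ?_
    filter_upwards [hneg] with w hw
    simp only [Pi.div_apply, norm_smul, norm_inv, Real.norm_eq_abs, abs_of_neg hw, smul_eq_mul]
    have hw' := hw.ne
    by_cases h0 : ‖F w‖ = 0
    · simp [h0]
    · field_simp
  have hgrad : Tendsto (fun w => planarGradient (a w) ((starRingEnd ℂ) (a (axisReflection w))) (c w))
      (𝓝[{w : ℂ | w.re < 0}] (t * Complex.I)) (𝓝 (-a (t * Complex.I) / ‖a (t * Complex.I)‖)) := by
    have h1 : ContinuousAt (fun w =>
        planarGradient (a w) ((starRingEnd ℂ) (a (axisReflection w))) (c w)) (t * Complex.I) := by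
      unfold planarGradient
      refine ContinuousAt.div ?_ ?_ ?_
      · exact (continuousAt_const.mul (Complex.continuous_conj.continuousAt.comp hcc)).mul hac
      · exact Complex.continuous_ofReal.continuousAt.comp
          (hac.norm.mul (hac.norm.add harc.norm))
      · have : 0 < ‖a (t * Complex.I)‖ := norm_pos_iff.2 ha0
        have h2 : ‖a (t * Complex.I)‖ * (‖a (t * Complex.I)‖
          + ‖(starRingEnd ℂ) (a (axisReflection (t * Complex.I)))‖) ≠ 0 := by positivity
        exact_mod_cast h2
    have h2 := h1.tendsto
    rw [hrefl, hc t, planarGradient_axis ha0] at h2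
    exact h2.mono_left nhdsWithin_le_nhds
  have hdiff := hgrad.sub hdir
  rw [sub_self] at hdiff
  have e1 : ∀ᶠ w in 𝓝[{w : ℂ | w.re < 0}] (t * Complex.I), a w ≠ 0 :=
    nhdsWithin_le_nhds (hac.eventually_ne ha0)
  filter_upwards [e1, Metric.tendsto_nhds.1 hrat η hη, Metric.tendsto_nhds.1 hdiff η hη]
    with w h1 h2 h3
  refine ⟨h1, by rwa [Real.dist_eq] at h2, by rwa [dist_zero_right] at h3⟩

end IsWeierstrassData

theorem planarGradient_mul {z : ℂ} (hz : z ≠ 0) (a b c : ℂ) :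
    planarGradient (z * a) (z * b) (z * c) = planarGradient a b c := by
  have hn : (‖z‖ : ℂ) ≠ 0 := by exact_mod_cast norm_ne_zero_iff.2 hz
  have h1 : (starRingEnd ℂ) z * z = (‖z‖ : ℂ) ^ 2 := Complex.conj_mul' z
  simp only [planarGradient, norm_mul, map_mul]
  push_cast
  have e1 : 2 * ((starRingEnd ℂ) z * (starRingEnd ℂ) c) * (z * a)
      = (‖z‖ : ℂ) ^ 2 * (2 * (starRingEnd ℂ) c * a) := by rw [← h1]; ring
  have e2 : (‖z‖ * ‖a‖ * (‖z‖ * ‖a‖ + ‖z‖ * ‖b‖) : ℂ)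
      = (‖z‖ : ℂ) ^ 2 * (‖a‖ * (‖a‖ + ‖b‖)) := by ring
  rw [e1, e2, mul_div_mul_left _ _ (pow_ne_zero 2 hn)]

theorem hasFDerivAt_norm_complex {y : ℂ} (hy : y ≠ 0) :
    HasFDerivAt (fun x : ℂ => ‖x‖) (gradForm (y / ‖y‖)) y := by
  have hn : ‖y‖ ≠ 0 := norm_ne_zero_iff.2 hy
  have h1 := ((hasFDerivAt_id (𝕜 := ℝ) y).norm_sq).sqrt (pow_ne_zero 2 hn)
  simp only [id, Real.sqrt_sq (norm_nonneg _)] at h1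
  refine h1.congr_fderiv (ContinuousLinearMap.ext fun v => ?_)
  have e1 : (starRingEnd ℂ) (y / ‖y‖) * v = (starRingEnd ℂ) y * v / ((‖y‖ : ℝ) : ℂ) := by
    rw [map_div₀, Complex.conj_ofReal]; ring
  rw [gradForm_apply, e1, Complex.div_ofReal_re]
  simp [Complex.inner]
  field_simp

theorem gradForm_sub (p q : ℂ) : gradForm (p - q) = gradForm p - gradForm q := by
  refine ContinuousLinearMap.ext fun v => ?_
  simp only [sub_apply, gradForm_apply, map_sub, sub_mul, Complex.sub_re]

/-- The orthonormal coordinates on the direction of a plane. -/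
def IsAdaptedFrame.coordEquiv {P : AffineSubspace ℝ L3} {e₁ e₂ ν : L3}
    (h : IsAdaptedFrame P e₁ e₂ ν) : P.direction ≃L[ℝ] ℂ :=
  LinearEquiv.toContinuousLinearEquiv
    { (planarCoord e₁ e₂).comp P.direction.subtype with
      invFun := fun y => ⟨y.re • e₁ + y.im • e₂,
        P.direction.add_mem (P.direction.smul_mem _ h.mem_1) (P.direction.smul_mem _ h.mem_2)⟩
      left_inv := fun w => by
        have h1 := h.planeParam_planarCoord (p₀ := 0) (p := (w : L3)) (by simp)
        rw [planeParam, zero_add, sub_zero] at h1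
        exact Subtype.ext h1
      right_inv := fun y => by
        have h1 := h.planarCoord_planeParam_sub 0 y
        rw [planeParam, zero_add, sub_zero] at h1
        exact h1 }

theorem IsAdaptedFrame.coordEquiv_apply {P : AffineSubspace ℝ L3} {e₁ e₂ ν : L3}
    (h : IsAdaptedFrame P e₁ e₂ ν) (w : P.direction) :
    h.coordEquiv w = planarCoord e₁ e₂ (w : L3) := rfl

theorem IsAdaptedFrame.coe_coordEquiv_symm {P : AffineSubspace ℝ L3} {e₁ e₂ ν : L3}
    (h : IsAdaptedFrame P e₁ e₂ ν) (y : ℂ) :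
    ((h.coordEquiv.symm y : P.direction) : L3) = y.re • e₁ + y.im • e₂ := rfl

/-- A function on the plane whose graph, in orthonormal coordinates, is asymptotic to the half cone
in the `C¹` sense. -/
theorem IsAdaptedFrame.isAsymptoticToHalfCone {P : AffineSubspace ℝ L3} {e₁ e₂ ν : L3}
    (h : IsAdaptedFrame P e₁ e₂ ν) {U : ℂ → ℝ} {q : ℂ → ℂ}
    (h1 : Tendsto (fun y => U y / ‖y‖) (𝓝[≠] 0) (𝓝 1))
    (h2 : ∀ᶠ y in 𝓝[≠] 0, HasFDerivAt U (gradForm (q y)) y)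
    (h3 : Tendsto (fun y => q y - y / ‖y‖) (𝓝[≠] 0) (𝓝 0)) :
    IsAsymptoticToHalfCone P.direction fun w => U (h.coordEquiv w) := by
  have hT : Tendsto h.coordEquiv (𝓝[≠] 0) (𝓝[≠] 0) := by
    refine tendsto_nhdsWithin_iff.2 ⟨?_, ?_⟩
    · have := h.coordEquiv.continuous.tendsto 0
      rw [map_zero] at this
      exact this.mono_left nhdsWithin_le_nhds
    · filter_upwards [self_mem_nhdsWithin] with w hw h0
      exact hw (h.coordEquiv.map_eq_zero_iff.1 h0)
  have hcone : ∀ w, coneHeight P.direction w = ‖h.coordEquiv w‖ := fun w => by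
    rw [coneHeight, h.lorentz_eq_norm_planarCoord w.2, Real.sqrt_sq (norm_nonneg _),
      h.coordEquiv_apply]
  have hd : ∀ᶠ w in 𝓝[≠] (0 : P.direction), HasFDerivAt (fun w => U (h.coordEquiv w))
      ((gradForm (q (h.coordEquiv w))).comp (h.coordEquiv : P.direction →L[ℝ] ℂ)) w := by
    filter_upwards [hT.eventually h2] with w hw
    exact hw.comp w h.coordEquiv.hasFDerivAt
  refine ⟨?_, hd.mono fun w hw => hw.differentiableAt, ?_⟩
  · refine (h1.comp hT).congr fun w => ?_
    rw [hcone]; rfl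
  · have hc : Continuous fun p : ℂ =>
        (gradForm p).comp (h.coordEquiv : P.direction →L[ℝ] ℂ) := by
      unfold gradForm
      exact (continuous_const.clm_comp
        (Complex.continuous_conj.smul continuous_const)).clm_comp continuous_const
    have h4 := (hc.tendsto 0).comp (h3.comp hT)
    have h0 : (gradForm 0).comp (h.coordEquiv : P.direction →L[ℝ] ℂ) = 0 := by
      refine ContinuousLinearMap.ext fun v => ?_
      simp [gradForm_apply]
    rw [h0] at h4
    refine h4.congr' ?_
    filter_upwards [hd, self_mem_nhdsWithin] with w hw hw0
    have hne : h.coordEquiv w ≠ 0 := fun h0 => hw0 (h.coordEquiv.map_eq_zero_iff.1 h0)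
    have h5 : HasFDerivAt (coneHeight P.direction)
        ((gradForm (h.coordEquiv w / ‖h.coordEquiv w‖)).comp
          (h.coordEquiv : P.direction →L[ℝ] ℂ)) w := by
      have h6 := (hasFDerivAt_norm_complex hne).comp w h.coordEquiv.hasFDerivAt
      exact h6.congr_of_eventuallyEq (Eventually.of_forall hcone)
    rw [hw.fderiv, h5.fderiv, Function.comp_apply, Function.comp_apply, gradForm_sub,
      ContinuousLinearMap.sub_comp]

/-- With a single sheet the surface is embedded near the singularity. -/
theorem IsPlanarBranch.isEmbedding {Y : ℂ → L3} {p₀ e₁ e₂ : L3} {r r₁ b : ℝ} {N : ℕ}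
    (h : IsPlanarBranch (fun z => planarCoord e₁ e₂ (Y z - p₀)) r r₁ N) (hb : r ≤ b)
    (hYc : ContinuousOn Y (outerClosedAnnulus r))
    (hinj : InjOn (fun z => planarCoord e₁ e₂ (Y z - p₀)) (openAnnulus b 1)) :
    IsEmbedding ((openAnnulus b 1).domRestrict Y) := by
  have h1 := (h.isOpenEmbedding_domRestrict hb hinj).isEmbedding
  refine IsEmbedding.of_comp (g := fun x => planarCoord e₁ e₂ (x - p₀)) ?_ ?_ h1
  · exact continuousOn_iff_continuous_domRestrict.1
      (hYc.mono fun z hz => ⟨hb.trans_lt hz.1, hz.2.le⟩)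
  · exact (continuous_planarCoord e₁ e₂).comp (continuous_id.sub continuous_const)

namespace IsWeierstrassData

variable {Y : ℂ → L3} {p₀ : L3} {r : ℝ} {g : ℂ → ℂ} {φ : Fin 3 → ℂ → ℂ}

/-- A surface whose projection has a single sheet, with Weierstrass data free of zeros on the circle,
is embedded near the circle and is a conelike graph. The normal is chosen such that the height has
derivative `-‖planarForm‖` across the circle, so that it is positive inside. -/
theorem exists_isConelikeGraph (W : IsWeierstrassData Y p₀ r g φ) (hr : 0 < r) (hr1 : r < 1)
    (hY : ∀ z : ℂ, ‖z‖ = 1 → Y z = p₀) (hYc : ContinuousOn Y (outerClosedAnnulus r))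
    {P : AffineSubspace ℝ L3} {e₁ e₂ ν : L3} (hF : IsAdaptedFrame P e₁ e₂ ν) {r₁ : ℝ}
    (h : IsPlanarBranch (fun z => planarCoord e₁ e₂ (Y z - p₀)) r r₁ 1)
    (ha : ∀ t : ℝ, planarForm φ e₁ e₂ (t * Complex.I) ≠ 0) :
    ∃ r₀ : ℝ, r ≤ r₀ ∧ r₀ < 1 ∧ IsEmbedding ((openAnnulus r₀ 1).domRestrict Y) ∧
      IsConelikeGraph P p₀ (Y '' outerClosedAnnulus r₀) := by
  obtain ⟨ν', hF', hc⟩ := W.exists_adaptedFrame_heightForm_neg hr hr1 hY hF ha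
  have hsub : openAnnulus r 1 ⊆ openAnnulus r (1 / r) := fun z hz =>
    ⟨hz.1, hz.2.trans (by rw [one_div]; exact (one_lt_inv₀ hr).2 hr1)⟩
  obtain ⟨b₀, hb₀, hlim₀⟩ := W.exists_forall_asymptotic hr hr1 hY ha hc one_pos
  set f : ℂ → ℂ := fun z => planarCoord e₁ e₂ (Y z - p₀) with hf
  obtain ⟨r₀, U, q, hr₀, hr₀1, hinj, hopen, h0, hUc, hU, hUnn, hU1, hU2, hU3⟩ := h.exists_graph
    (H := fun z => -lorentz (Y z - p₀) ν')
    (p := fun z => planarGradient (planarForm φ e₁ e₂ (Complex.log z))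
      ((starRingEnd ℂ) (planarForm φ e₁ e₂ (axisReflection (Complex.log z))))
      (heightForm φ ν' (Complex.log z))) (r₂ := max r b₀) (max_lt hr1 hb₀)
    (fun z hz => by rw [hY z hz]; simp)
    (fun z hz => by
      have hz₁ : z ∈ openAnnulus r 1 := openAnnulus_mono (le_max_left _ _) hz
      have hz₂ := hsub hz₁
      have hz0 : z ≠ 0 := by
        rintro rfl; have := hz₁.1; rw [norm_zero] at this; exact absurd this (not_lt.2 hr.le)
      have hexp := Complex.exp_log hz0
      have hstrip : Complex.log z ∈ strip (-Real.log r) :=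
        (exp_mem_openAnnulus_iff hr).1 (by rw [hexp]; exact hz₂)
      have e1 : ∀ y : Fin 3 → ℂ, complexLorentz (fun j => expPullback (φ j) (Complex.log z)) y
          = z * complexLorentz (fun j => φ j z) y := fun y => by
        simp only [complexLorentz, expPullback, hexp]; ring
      have hα := (hlim₀ z (openAnnulus_mono (le_max_right _ _) hz)).2.1
      rw [planarForm, e1] at hα
      obtain ⟨a, b, hab, hd⟩ := h.hasStrictFDerivAt z hz₁
      have hd' := W.hasStrictFDerivAt_planarCoord hr hr1 e₁ e₂ hz₁
      refine ⟨planarEquiv hab, by rwa [coe_planarEquiv], ?_⟩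
      rw [coe_planarEquiv, hd.hasFDerivAt.unique hd'.hasFDerivAt,
        W.conj_planarForm_axisReflection hr hY e₁ e₂ hstrip, planarForm, heightForm, e1, e1, e1,
        ← mul_neg, planarGradient_mul hz0, gradForm_comp_planarDifferential
          (hF'.complexLorentz_mul (W.sq_add_sq hz₂)) (right_ne_zero_of_mul hα)]
      refine (hasFDerivAt_height (p₀ := p₀) ν' fun j =>
        W.hasFDerivAt j z hz₂).congr_of_eventuallyEq ?_
      filter_upwards [(isOpen_openAnnulus r 1).mem_nhds hz₁] with x hx
      rw [schwarzExtension_of_le Y p₀ hx.2.le])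
    (fun η hη => by
      obtain ⟨b, hb, hlim⟩ := W.exists_forall_asymptotic hr hr1 hY ha hc hη
      refine ⟨b, hb, fun z hz => ?_⟩
      obtain ⟨hb0, -, h1, h2⟩ := hlim z hz
      have hz0 : z ≠ 0 := by
        rintro rfl; have := hz.1; rw [norm_zero] at this; exact absurd this (not_lt.2 hb0.le)
      rw [Complex.exp_log hz0, schwarzExtension_of_le Y p₀ hz.2.le] at h1 h2
      exact ⟨h1, h2⟩)
  refine ⟨r₀, hr₀, hr₀1, h.isEmbedding hr₀ hYc hinj, ν', ⟨?_, hF'.inner_νν⟩,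
    hF'.coordEquiv ⁻¹' (f '' outerClosedAnnulus r₀), fun w => U (hF'.coordEquiv w),
    hopen.preimage hF'.coordEquiv.continuous, ?_, ?_, ?_, ?_, ?_⟩
  · intro v hv
    rw [lorentz_comm]
    exact (hF'.mem_iff v).1 hv
  · rw [mem_preimage, map_zero]; exact h0
  · exact hUc.comp hF'.coordEquiv.continuous.continuousOn fun w hw => hw
  · have hkey : ∀ z ∈ outerClosedAnnulus r₀, p₀ + ((hF'.coordEquiv.symm (f z) : P.direction) : L3)
        + U (f z) • ν' = Y z := by
      intro z hz
      rw [hU z hz, hF'.coe_coordEquiv_symm]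
      have h1 := hF'.eq_sum (Y z - p₀)
      have hre : (f z).re = lorentz (Y z - p₀) e₁ := by simp [hf, planarCoord_apply]
      have him : (f z).im = lorentz (Y z - p₀) e₂ := by simp [hf, planarCoord_apply]
      rw [hre, him, neg_smul, add_assoc, ← sub_eq_add_neg, ← h1, add_sub_cancel]
    ext x
    constructor
    · rintro ⟨z, hz, rfl⟩
      refine ⟨hF'.coordEquiv.symm (f z), ?_, ?_⟩
      · rw [mem_preimage, ContinuousLinearEquiv.apply_symm_apply]; exact ⟨z, hz, rfl⟩
      · simp only [ContinuousLinearEquiv.apply_symm_apply]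
        exact hkey z hz
    · rintro ⟨w, ⟨z, hz, hzw⟩, rfl⟩
      refine ⟨z, hz, ?_⟩
      rw [← hkey z hz, hzw, ContinuousLinearEquiv.symm_apply_apply]
  · exact fun w hw => hUnn _ hw
  · exact hF'.isAsymptoticToHalfCone hU1 hU2 hU3

end IsWeierstrassData

/-! ### The local structure, for given Weierstrass data -/

theorem IsSpecialSingularity.mapsTo {X : ℂ → L3} {D : Set ℂ} {q : ℂ} {r : ℝ} {h : ℂ → ℂ}
    (hX : IsSpecialSingularity X D q r h) : MapsTo h (outerClosedAnnulus r) D := fun z hz => by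
  rcases lt_or_eq_of_le hz.2 with h1 | h1
  · exact (hX.reparam.bijOn.mapsTo ⟨hz.1, h1⟩).1
  · rw [hX.reparam.circle z h1]; exact hX.mem

theorem IsSpecialSingularity.continuousOn_comp {X : ℂ → L3} {D : Set ℂ} {q : ℂ} {r : ℝ}
    {h : ℂ → ℂ} (hX : IsSpecialSingularity X D q r h) :
    ContinuousOn (X ∘ h) (outerClosedAnnulus r) :=
  hX.continuousOn.comp hX.reparam.continuousOn hX.mapsTo

theorem IsSpecialSingularity.comp_eq {X : ℂ → L3} {D : Set ℂ} {q : ℂ} {r : ℝ}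
    {h : ℂ → ℂ} (hX : IsSpecialSingularity X D q r h) (z : ℂ) (hz : ‖z‖ = 1) :
    (X ∘ h) z = X q := by rw [Function.comp_apply, hX.reparam.circle z hz]

/-- The number of sheets is `m + k` with `m > 0`. Hence a single sheet means `m = 1` and `k = 0`;
an embedding forces this, since the height separates the points in a fibre of the projection. -/
theorem IsWeierstrassData.local_structure {Y : ℂ → L3} {p₀ : L3} {r : ℝ} {g : ℂ → ℂ}
    {φ : Fin 3 → ℂ → ℂ} (W : IsWeierstrassData Y p₀ r g φ) (hr : 0 < r) (hr1 : r < 1)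
    (hY : ∀ z : ℂ, ‖z‖ = 1 → Y z = p₀) (hYc : ContinuousOn Y (outerClosedAnnulus r))
    (hpos : ∀ z ∈ openAnnulus r 1, 0 < inducedMetric Y z 1 1)
    {P : AffineSubspace ℝ L3} (hP : IsSpacelikePlane P) (hp₀ : p₀ ∈ P) :
    ∃ (d : ℤ) (m k : ℕ), HasCircleDegree g d ∧ m = d.natAbs ∧ circleZeroCount (φ 2) = 2 * k ∧
      (∃ s₀ : ℝ, 0 < s₀ ∧ ∀ s : ℝ, 0 < s → s ≤ s₀ →
        IsCoveringOfDegree (lorentzProj P hP p₀ ∘ Y)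
          (connectedComponentIn {z ∈ outerClosedAnnulus r |
            lorentzProj P hP p₀ (Y z) ∈ planeDisc P p₀ s} 1 \ sphere 0 1)
          (planeDisc P p₀ s \ {p₀}) (m + k)) ∧
      ((∃ r₀ : ℝ, r ≤ r₀ ∧ r₀ < 1 ∧ IsEmbedding ((openAnnulus r₀ 1).domRestrict Y)) ↔
        (InjOn g (sphere 0 1) ∧ ∀ z ∈ sphere (0 : ℂ) 1, φ 2 z ≠ 0)) ∧
      ((InjOn g (sphere 0 1) ∧ ∀ z ∈ sphere (0 : ℂ) 1, φ 2 z ≠ 0) ↔ (m = 1 ∧ k = 0)) ∧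
      (m = 1 ∧ k = 0 →
        ∃ r₀ : ℝ, r ≤ r₀ ∧ r₀ < 1 ∧ IsEmbedding ((openAnnulus r₀ 1).domRestrict Y) ∧
          IsConelikeGraph P p₀ (Y '' outerClosedAnnulus r₀)) := by
  obtain ⟨σ, d, m, k, hσ, hN, hd, hm, hm0, hk, hk0, hinj, ε, hε, hw⟩ :=
    W.exists_nullData hr hr1 hY hpos
  obtain ⟨e₁, e₂, ν, hF, hlt⟩ := hP.exists_adaptedFrame hσ
  obtain ⟨r₁, hB⟩ := W.exists_isPlanarBranch hr hr1 hY hYc hσ hN hF.toIsLorentzFrame hlt hε hw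
  have hiff : (InjOn g (sphere 0 1) ∧ ∀ z ∈ sphere (0 : ℂ) 1, φ 2 z ≠ 0) ↔ (m = 1 ∧ k = 0) :=
    and_congr hinj hk0.symm
  have hcone : m = 1 ∧ k = 0 →
      ∃ r₀ : ℝ, r ≤ r₀ ∧ r₀ < 1 ∧ IsEmbedding ((openAnnulus r₀ 1).domRestrict Y) ∧
        IsConelikeGraph P p₀ (Y '' outerClosedAnnulus r₀) := by
    rintro ⟨rfl, rfl⟩
    exact W.exists_isConelikeGraph hr hr1 hY hYc hF hB
      (planarForm_ne_zero hr hr1 hσ hN hF.toIsLorentzFrame hlt (hk0.1 rfl))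
  refine ⟨d, m, k, hd, hm, hk, hB.exists_isCoveringOfDegree hP hp₀ hF, ⟨?_, fun h => ?_⟩, hiff, hcone⟩
  · rintro ⟨r₀, hr₀, hr₀1, hemb⟩
    have hle := hB.le_one_of_separates (H := fun z => lorentz (Y z - p₀) ν) ?_ hr₀1 ?_
    · rw [hiff]; omega
    · have hcont : Continuous fun x : L3 => lorentz (x - p₀) ν := by
        simp only [lorentz_apply]; fun_prop
      exact hcont.comp_continuousOn (hYc.mono fun z hz => ⟨hz.1, hz.2.le⟩)
    · intro z hz z' hz' hf hH
      have heq : Y z = Y z' := by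
        have h1 : planarCoord e₁ e₂ (Y z - Y z') = 0 := by
          have : Y z - Y z' = (Y z - p₀) - (Y z' - p₀) := by abel
          rw [this, map_sub, sub_eq_zero]; exact hf
        have h2 : lorentz (Y z - Y z') ν = 0 := by
          have : Y z - Y z' = (Y z - p₀) - (Y z' - p₀) := by abel
          rw [this, map_sub, LinearMap.sub_apply, sub_eq_zero]; exact hH
        rw [planarCoord_apply] at h1
        refine sub_eq_zero.1 (hF.ext_of_inner ?_ ?_ h2)
        · simpa using congrArg Complex.re h1
        · simpa using congrArg Complex.im h1
      have := hemb.injective (a₁ := ⟨z, hz⟩) (a₂ := ⟨z', hz'⟩) heq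
      exact congrArg Subtype.val this
  · obtain ⟨r₀, h1, h2, h3, -⟩ := hcone (hiff.1 h)
    exact ⟨r₀, h1, h2, h3⟩

/-! ### The reflection principle for harmonic functions -/

section Harmonic

open InnerProductSpace Real

theorem InnerProductSpace.HarmonicAt.exists_analyticAt_re {u : ℂ → ℝ} {z : ℂ} (h : HarmonicAt u z) :
    ∃ F : ℂ → ℂ, AnalyticAt ℂ F z ∧ u =ᶠ[𝓝 z] fun w => (F w).re := by
  obtain ⟨ε, hε, hb⟩ := Metric.eventually_nhds_iff_ball.1 h.eventually
  obtain ⟨F, hF, hE⟩ := HarmonicOnNhd.exists_analyticOnNhd_ball_re_eq hb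
  exact ⟨F, hF z (mem_ball_self hε), (hE.eventuallyEq_of_mem (ball_mem_nhds z hε)).symm⟩

theorem InnerProductSpace.HarmonicAt.comp_analyticAt {u : ℂ → ℝ} {f : ℂ → ℂ} {z : ℂ} (hu : HarmonicAt u (f z))
    (hf : AnalyticAt ℂ f z) : HarmonicAt (u ∘ f) z := by
  obtain ⟨F, hF, hE⟩ := HarmonicAt.exists_analyticAt_re hu
  exact (harmonicAt_congr_nhds (hE.comp_tendsto hf.continuousAt)).2 (hF.comp hf).harmonicAt_re

theorem InnerProductSpace.HarmonicAt.comp_axisReflection {u : ℂ → ℝ} {z : ℂ} (hu : HarmonicAt u (axisReflection z)) :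
    HarmonicAt (u ∘ axisReflection) z := by
  obtain ⟨F, hF, hE⟩ := HarmonicAt.exists_analyticAt_re hu
  have hG : AnalyticAt ℂ (fun w => (starRingEnd ℂ) (F (-(starRingEnd ℂ) w))) z := by
    rw [Complex.analyticAt_iff_eventually_differentiableAt] at hF ⊢
    filter_upwards [continuous_axisReflection.continuousAt.eventually hF] with w hw
    have h1 : DifferentiableAt ℂ (fun v => F (-v)) ((starRingEnd ℂ) w) :=
      DifferentiableAt.comp ((starRingEnd ℂ) w) (g := F) (f := fun v : ℂ => -v) hw
        differentiableAt_id.neg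
    simpa [Function.comp_def] using h1.conj_conj
  refine (harmonicAt_congr_nhds ?_).2 hG.harmonicAt_re
  filter_upwards [continuous_axisReflection.continuousAt.eventually hE] with w hw
  simpa [axisReflection] using hw

/-- The strong maximum principle, from the maximum modulus principle for the exponential of a
holomorphic function with real part `u`. -/
theorem InnerProductSpace.HarmonicAt.eventually_eq_of_isLocalMax {u : ℂ → ℝ} {z : ℂ} (hu : HarmonicAt u z)
    (hmax : IsLocalMax u z) : ∀ᶠ w in 𝓝 z, u w = u z := by
  obtain ⟨F, hF, hE⟩ := HarmonicAt.exists_analyticAt_re hu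
  have hn : ∀ w, u w = (F w).re → ‖Complex.exp (F w)‖ = exp (u w) := fun w hw => by
    rw [Complex.norm_exp, hw]
  have h1 : IsLocalMax (norm ∘ fun w => Complex.exp (F w)) z := by
    filter_upwards [hmax, hE] with w hw hw'
    simp only [Function.comp_apply]
    rw [hn w hw', hn z hE.self_of_nhds]
    exact exp_le_exp.2 hw
  have h2 : ∀ᶠ w in 𝓝 z, DifferentiableAt ℂ (fun w => Complex.exp (F w)) w := by
    filter_upwards [hF.eventually_analyticAt] with w hw
    exact hw.differentiableAt.cexp
  filter_upwards [Complex.eventually_eq_of_isLocalMax_norm h2 h1, hE] with w hw hw'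
  have h3 := hn w hw'
  rw [hw, hn z hE.self_of_nhds] at h3
  exact (exp_injective h3).symm

/-- The Poisson integral of `a + C |ζ - ζ₀|²`, which on the circle is the affine function
`a + C (2 - 2 Re (conj ζ₀ ζ))`. It serves as a barrier at `ζ₀`. -/
theorem circleAverage_poissonKernel_dist_sq {w ζ₀ : ℂ} (hw : w ∈ ball (0 : ℂ) 1)
    (hζ₀ : ‖ζ₀‖ = 1) (a C : ℝ) :
    circleAverage (fun ζ => poissonKernel 0 w ζ * (a + C * ‖ζ - ζ₀‖ ^ 2)) 0 1
      = a + C * (2 - 2 * ((starRingEnd ℂ) ζ₀ * w).re) := by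
  have hf : HarmonicOnNhd (fun ζ : ℂ => (a + C * (2 - 2 * ((starRingEnd ℂ) ζ₀ * ζ)) : ℂ).re)
      (closedBall 0 1) := fun ζ _ => AnalyticAt.harmonicAt_re (by fun_prop)
  have h := hf.circleAverage_poissonKernel_smul hw
  have e : ∀ ζ : ℂ, (a + C * (2 - 2 * ((starRingEnd ℂ) ζ₀ * ζ)) : ℂ).re
      = a + C * (2 - 2 * ((starRingEnd ℂ) ζ₀ * ζ).re) := fun ζ => by
    simp
  rw [e] at h
  rw [← h]
  refine circleAverage_congr_sphere fun ζ hζ => ?_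
  have hζ1 : ‖ζ‖ = 1 := by simpa using hζ
  simp only [Pi.smul_apply', smul_eq_mul]
  rw [e]
  congr 3
  have h1 : ζ.re * ζ.re + ζ.im * ζ.im = 1 := by
    rw [← Complex.normSq_apply, Complex.normSq_eq_norm_sq, hζ1, one_pow]
  have h2 : ζ₀.re * ζ₀.re + ζ₀.im * ζ₀.im = 1 := by
    rw [← Complex.normSq_apply, Complex.normSq_eq_norm_sq, hζ₀, one_pow]
  rw [← Complex.normSq_eq_norm_sq, Complex.normSq_apply]
  simp
  linarith

theorem continuousOn_poissonKernel {w : ℂ} (hw : w ∈ ball (0 : ℂ) 1) :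
    ContinuousOn (poissonKernel 0 w) (sphere 0 1) := by
  have := continuousOn_herglotzRieszKernel_sphere (c := 0) (R := 1) hw
  rw [abs_one] at this
  rw [poissonKernel_eq_re_herglotzRieszKernel]
  exact Complex.continuous_re.comp_continuousOn this

theorem poissonKernel_nonneg {w ζ : ℂ} (hw : w ∈ ball (0 : ℂ) 1) (hζ : ‖ζ‖ = 1) :
    0 ≤ poissonKernel 0 w ζ := by
  have : ‖w‖ < 1 := by simpa using hw
  rw [poissonKernel_def, sub_zero, sub_zero, hζ]
  exact div_nonneg (by nlinarith [norm_nonneg w]) (by positivity)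

/-- A continuous function on the circle differs from its value at `ζ₀` by at most
`ε + C |ζ - ζ₀|²`. The right hand side is the restriction of a harmonic function, whose Poisson
integral is explicit. -/
theorem exists_forall_abs_sub_le {u : ℂ → ℝ} (hu : ContinuousOn u (sphere 0 1)) {ζ₀ : ℂ}
    (hζ₀ : ‖ζ₀‖ = 1) {ε : ℝ} (hε : 0 < ε) :
    ∃ C, 0 ≤ C ∧ ∀ ζ : ℂ, ‖ζ‖ = 1 → |u ζ - u ζ₀| ≤ ε + C * ‖ζ - ζ₀‖ ^ 2 := by
  obtain ⟨M, hM⟩ := (isCompact_sphere (0 : ℂ) 1).exists_bound_of_continuousOn hu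
  obtain ⟨δ, hδ, hd⟩ := Metric.continuousOn_iff.1 hu ζ₀ (by simpa using hζ₀) ε hε
  have hM0 : 0 ≤ M := (norm_nonneg _).trans (hM ζ₀ (by simpa using hζ₀))
  refine ⟨2 * M / δ ^ 2, by positivity, fun ζ hζ => ?_⟩
  rcases lt_or_ge ‖ζ - ζ₀‖ δ with h | h
  · have h1 := hd ζ (by simpa using hζ) (by rwa [dist_eq_norm])
    rw [Real.dist_eq] at h1
    have : 0 ≤ 2 * M / δ ^ 2 * ‖ζ - ζ₀‖ ^ 2 := by positivity
    linarith
  · have h1 : |u ζ - u ζ₀| ≤ 2 * M := by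
      have h2 := hM ζ (by simpa using hζ)
      have h3 := hM ζ₀ (by simpa using hζ₀)
      rw [Real.norm_eq_abs] at h2 h3
      have := abs_sub (u ζ) (u ζ₀)
      linarith
    have h2 : 2 * M ≤ 2 * M / δ ^ 2 * ‖ζ - ζ₀‖ ^ 2 := by
      rw [div_mul_eq_mul_div, le_div_iff₀ (by positivity)]
      gcongr
    linarith

/-- The Dirichlet problem for the unit disc, solved by the Poisson integral. -/
theorem exists_harmonicOnNhd_tendsto {u : ℂ → ℝ} (hu : ContinuousOn u (sphere 0 1)) :
    ∃ H : ℂ → ℝ, HarmonicOnNhd H (ball 0 1) ∧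
      ∀ ζ₀ : ℂ, ‖ζ₀‖ = 1 → Tendsto H (𝓝[ball 0 1] ζ₀) (𝓝 (u ζ₀)) := by
  have hci : CircleIntegrable u 0 1 := hu.circleIntegrable zero_le_one
  have hci' : CircleIntegrable (fun ζ => (u ζ : ℂ)) 0 1 :=
    (Complex.continuous_ofReal.comp_continuousOn hu).circleIntegrable zero_le_one
  set F : ℂ → ℂ := fun w => circleAverage (fun ζ => herglotzRieszKernel 0 w ζ • (u ζ : ℂ)) 0 1
    with hFdef
  have hF : AnalyticOnNhd ℂ F (ball 0 1) := analyticOnNhd_circleAverage_herglotzRieszKernel_smul hci'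
  refine ⟨fun w => (F w).re, fun w hw => (hF w hw).harmonicAt_re, fun ζ₀ hζ₀ => ?_⟩
  have hre : ∀ w ∈ ball (0 : ℂ) 1,
      (F w).re = circleAverage (fun ζ => poissonKernel 0 w ζ * u ζ) 0 1 := fun w hw => by
    rw [hFdef, re_circleAverage_herglotzRieszKernel_smul hci hw,
      ← poissonKernel_eq_re_herglotzRieszKernel]
    rfl
  rw [Metric.tendsto_nhds]
  intro ε hε
  obtain ⟨C, hC, hb⟩ := exists_forall_abs_sub_le hu hζ₀ (half_pos hε)
  have hlim : Tendsto (fun w : ℂ => ε / 2 + C * (2 - 2 * ((starRingEnd ℂ) ζ₀ * w).re))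
      (𝓝[ball 0 1] ζ₀) (𝓝 (ε / 2)) := by
    have hc : Continuous fun w : ℂ => ε / 2 + C * (2 - 2 * ((starRingEnd ℂ) ζ₀ * w).re) := by
      fun_prop
    have h := hc.tendsto ζ₀
    rw [Complex.conj_mul', hζ₀] at h
    simpa using h.mono_left nhdsWithin_le_nhds
  filter_upwards [hlim.eventually (gt_mem_nhds (half_lt_self hε)), self_mem_nhdsWithin] with w h1 hw
  have hK := continuousOn_poissonKernel hw
  have key : ∀ s : ℝ, (∀ ζ : ℂ, ‖ζ‖ = 1 →
      s * (u ζ - u ζ₀) ≤ ε / 2 + C * ‖ζ - ζ₀‖ ^ 2) → s * ((F w).re - u ζ₀) < ε := by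
    intro s hs
    have e1 : s * ((F w).re - u ζ₀)
        = circleAverage (fun ζ => poissonKernel 0 w ζ * (s * (u ζ - u ζ₀))) 0 1 := by
      have h2 := circleAverage_poissonKernel_dist_sq hw hζ₀ (u ζ₀) 0
      simp only [zero_mul, add_zero] at h2
      rw [hre w hw]
      conv_lhs => rw [← h2]
      rw [← circleAverage_fun_sub, ← smul_eq_mul, ← circleAverage_fun_smul]
      · simp only [smul_eq_mul]
        congr 1
        ext ζ
        ring
      · exact (hK.mul hu).circleIntegrable zero_le_one
      · exact (hK.mul continuousOn_const).circleIntegrable zero_le_one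
    rw [e1]
    refine lt_of_le_of_lt (circleAverage_mono ?_ ?_ fun ζ hζ => ?_)
      ((circleAverage_poissonKernel_dist_sq hw hζ₀ (ε / 2) C).trans_lt h1)
    · exact (hK.mul (continuousOn_const.mul (hu.sub continuousOn_const))).circleIntegrable
        zero_le_one
    · refine (hK.mul (Continuous.continuousOn ?_)).circleIntegrable zero_le_one
      fun_prop
    · have hζ1 : ‖ζ‖ = 1 := by simpa using hζ
      exact mul_le_mul_of_nonneg_left (hs ζ hζ1) (poissonKernel_nonneg hw hζ1)
  rw [Real.dist_eq, abs_lt]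
  have k1 := key 1 fun ζ hζ => by rw [one_mul]; exact (le_abs_self _).trans (hb ζ hζ)
  have k2 := key (-1) fun ζ hζ => by
    rw [neg_one_mul]; exact (neg_le_abs _).trans (hb ζ hζ)
  constructor <;> linarith

/-- The maximum principle for a function that is harmonic where it does not vanish. -/
theorem nonpos_of_harmonicAt_of_ne_zero {V : ℂ → ℝ} (hV : ContinuousOn V (closedBall 0 1))
    (h0 : ∀ ζ : ℂ, ‖ζ‖ = 1 → V ζ = 0)
    (hH : ∀ ζ ∈ ball (0 : ℂ) 1, V ζ ≠ 0 → HarmonicAt V ζ) : ∀ ζ ∈ ball (0 : ℂ) 1, V ζ ≤ 0 := by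
  intro ζ hζ
  by_contra! hpos
  obtain ⟨a, ha, hmax⟩ := (isCompact_closedBall (0 : ℂ) 1).exists_isMaxOn
    ⟨ζ, ball_subset_closedBall hζ⟩ hV
  have hVa : 0 < V a := hpos.trans_le (hmax (ball_subset_closedBall hζ))
  -- The set of all maximum points is open and closed.
  set T : Set ℂ := closedBall 0 1 ∩ V ⁻¹' {V a} with hT
  have hclosed : IsClosed T := hV.preimage_isClosed_of_isClosed isClosed_closedBall isClosed_singleton
  have hopen : IsOpen T := by
    rw [isOpen_iff_mem_nhds]
    rintro b ⟨hb, hb'⟩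
    have hb' : V b = V a := hb'
    have hbb : b ∈ ball (0 : ℂ) 1 := by
      rcases lt_or_eq_of_le (mem_closedBall_zero_iff.1 hb) with h | h
      · simpa using h
      · rw [h0 b h] at hb'; linarith
    have hnhds : ball (0 : ℂ) 1 ∈ 𝓝 b := isOpen_ball.mem_nhds hbb
    have hloc : IsLocalMax V b := by
      filter_upwards [hnhds] with y hy
      rw [hb']
      exact hmax (ball_subset_closedBall hy)
    filter_upwards [hnhds, (hH b hbb (by rw [hb']; exact hVa.ne')).eventually_eq_of_isLocalMax hloc]
      with y hy hy'
    exact ⟨ball_subset_closedBall hy, hy'.trans hb'⟩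
  have huniv : T = univ := IsClopen.eq_univ ⟨hclosed, hopen⟩ ⟨a, ha, rfl⟩
  have h2 : (2 : ℂ) ∈ T := huniv ▸ mem_univ _
  have := h2.1
  norm_num at this

/-- The reflection principle: a continuous function on the closed disc that is odd with respect to
the imaginary axis and harmonic to the left of it is harmonic. It agrees with the odd part of the
solution of the Dirichlet problem, as both vanish on the axis. -/
theorem harmonicOnNhd_of_odd {u : ℂ → ℝ} (hu : ContinuousOn u (closedBall 0 1))
    (hodd : ∀ ζ, u (axisReflection ζ) = -u ζ)
    (hH : ∀ ζ ∈ ball (0 : ℂ) 1, ζ.re < 0 → HarmonicAt u ζ) : HarmonicOnNhd u (ball 0 1) := by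
  have hball : ∀ ζ ∈ ball (0 : ℂ) 1, axisReflection ζ ∈ ball (0 : ℂ) 1 := fun ζ hζ => by
    simpa [axisReflection] using hζ
  have hH' : ∀ ζ ∈ ball (0 : ℂ) 1, ζ.re ≠ 0 → HarmonicAt u ζ := by
    intro ζ hζ hre
    rcases lt_or_gt_of_ne hre with h | h
    · exact hH ζ hζ h
    · have h1 := HarmonicAt.comp_axisReflection (hH _ (hball ζ hζ) (by simpa using h))
      have h2 := HarmonicAt.neg h1
      have e : -(u ∘ axisReflection) = u := by
        ext w; simp [hodd]
      rwa [e] at h2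
  obtain ⟨H₀, hH₀, hlim₀⟩ := exists_harmonicOnNhd_tendsto (hu.mono sphere_subset_closedBall)
  set H : ℂ → ℝ := (1 / 2 : ℝ) • (H₀ - H₀ ∘ axisReflection) with hHdef
  have hHharm : HarmonicOnNhd H (ball 0 1) := fun ζ hζ =>
    HarmonicAt.const_smul
      (HarmonicAt.sub (hH₀ ζ hζ) (HarmonicAt.comp_axisReflection (hH₀ _ (hball ζ hζ))))
  have hHodd : ∀ ζ, H (axisReflection ζ) = -H ζ := fun ζ => by
    simp [hHdef]; ring
  have hHlim : ∀ ζ₀ : ℂ, ‖ζ₀‖ = 1 → Tendsto H (𝓝[ball 0 1] ζ₀) (𝓝 (u ζ₀)) := by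
    intro ζ₀ hζ₀
    have h1 : Tendsto axisReflection (𝓝[ball 0 1] ζ₀) (𝓝[ball 0 1] (axisReflection ζ₀)) :=
      (continuous_axisReflection.continuousWithinAt (s := ball 0 1)).tendsto_nhdsWithin hball
    have h2 := (hlim₀ (axisReflection ζ₀) (by simpa [axisReflection] using hζ₀)).comp h1
    have h3 := ((hlim₀ ζ₀ hζ₀).sub h2).const_mul (1 / 2 : ℝ)
    rw [hodd] at h3
    have e : 1 / 2 * (u ζ₀ - -u ζ₀) = u ζ₀ := by ring
    rw [e] at h3
    exact h3
  set V : ℂ → ℝ := fun ζ => if ‖ζ‖ < 1 then u ζ - H ζ else 0 with hVdef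
  have hVball : ∀ ζ ∈ ball (0 : ℂ) 1, V ζ = u ζ - H ζ := fun ζ hζ => if_pos (by simpa using hζ)
  have hVsph : ∀ ζ : ℂ, ‖ζ‖ = 1 → V ζ = 0 := fun ζ hζ => if_neg (by simp [hζ])
  have hVodd : ∀ ζ, V (axisReflection ζ) = -V ζ := by
    intro ζ
    have : ‖axisReflection ζ‖ = ‖ζ‖ := by simp [axisReflection]
    simp only [hVdef, this, hodd, hHodd]
    split_ifs <;> ring
  have hVc : ContinuousOn V (closedBall 0 1) := by
    intro ζ hζ
    rcases lt_or_eq_of_le (mem_closedBall_zero_iff.1 hζ) with h | h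
    · have hb : ζ ∈ ball (0 : ℂ) 1 := by simpa using h
      have h1 : ContinuousAt (fun ζ => u ζ - H ζ) ζ :=
        (hu.continuousAt (closedBall_mem_nhds_of_mem hb)).sub (hHharm ζ hb).1.continuousAt
      refine (h1.congr ?_).continuousWithinAt
      filter_upwards [isOpen_ball.mem_nhds hb] with y hy
      exact (hVball y hy).symm
    · have hsub : closedBall (0 : ℂ) 1 = ball 0 1 ∪ sphere 0 1 := ball_union_sphere.symm
      show Tendsto V _ (𝓝 (V ζ))
      rw [hVsph ζ h, hsub, nhdsWithin_union]
      refine Tendsto.sup ?_ ?_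
      · have h1 := ((hu ζ hζ).mono_left (nhdsWithin_mono ζ ball_subset_closedBall)).sub (hHlim ζ h)
        rw [sub_self] at h1
        refine h1.congr' ?_
        filter_upwards [self_mem_nhdsWithin] with y hy
        exact (hVball y hy).symm
      · refine tendsto_const_nhds.congr' ?_
        filter_upwards [self_mem_nhdsWithin] with y hy
        exact (hVsph y (by simpa using hy)).symm
  have hVH : ∀ ζ ∈ ball (0 : ℂ) 1, V ζ ≠ 0 → HarmonicAt V ζ := by
    intro ζ hζ hne
    have hre : ζ.re ≠ 0 := fun h => hne (by
      have := hVodd ζ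
      rw [axisReflection_of_re_eq_zero h] at this
      linarith)
    refine (harmonicAt_congr_nhds ?_).2 (HarmonicAt.sub (hH' ζ hζ hre) (hHharm ζ hζ))
    filter_upwards [isOpen_ball.mem_nhds hζ] with y hy
    exact hVball y hy
  have hle := nonpos_of_harmonicAt_of_ne_zero hVc hVsph hVH
  have hzero : ∀ ζ ∈ ball (0 : ℂ) 1, u ζ = H ζ := fun ζ hζ => by
    have h1 := hle ζ hζ
    have h2 := hle _ (hball ζ hζ)
    rw [hVodd] at h2
    rw [hVball ζ hζ] at h1 h2
    linarith
  intro ζ hζ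
  refine (harmonicAt_congr_nhds ?_).2 (hHharm ζ hζ)
  filter_upwards [isOpen_ball.mem_nhds hζ] with y hy
  exact hzero y hy

end Harmonic

/-! ### Conformal maximal immersions are harmonic -/

theorem fderiv_lorentz {U V : ℂ → L3} {z : ℂ} (hU : DifferentiableAt ℝ U z)
    (hV : DifferentiableAt ℝ V z) (v : ℂ) :
    fderiv ℝ (fun w => lorentz (U w) (V w)) z v
      = lorentz (fderiv ℝ U z v) (V z) + lorentz (U z) (fderiv ℝ V z v) := by
  have h1 := fun j => hasFDerivAt_pi'.1 hU.hasFDerivAt j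
  have h2 := fun j => hasFDerivAt_pi'.1 hV.hasFDerivAt j
  have h3 := (((h1 0).mul (h2 0)).add ((h1 1).mul (h2 1))).sub ((h1 2).mul (h2 2))
  have h4 : HasFDerivAt (fun w => lorentz (U w) (V w)) _ z := h3
  rw [h4.fderiv]
  simp [lorentz_apply]
  ring

/-- The Laplacian of a conformal map is Lorentz-orthogonal to its image: this follows by
differentiating the conformality relations. -/
theorem lorentz_fderiv_fderiv_eq_zero {Y : ℂ → L3} {z : ℂ} (hY : ContDiffAt ℝ 2 Y z)
    (h1 : ∀ᶠ w in 𝓝 z, inducedMetric Y w 1 1 = inducedMetric Y w Complex.I Complex.I)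
    (h2 : ∀ᶠ w in 𝓝 z, inducedMetric Y w 1 Complex.I = 0) (v : ℂ) :
    lorentz (fderiv ℝ (fderiv ℝ Y) z 1 1 + fderiv ℝ (fderiv ℝ Y) z Complex.I Complex.I)
      (fderiv ℝ Y z v) = 0 := by
  have hd : DifferentiableAt ℝ (fderiv ℝ Y) z :=
    (hY.fderiv_right (m := 1) (by norm_num)).differentiableAt (by norm_num)
  have hdv : ∀ v, DifferentiableAt ℝ (fun w => fderiv ℝ Y w v) z := fun v =>
    hd.clm_apply (differentiableAt_const v)
  have hval : ∀ u v, fderiv ℝ (fun w => fderiv ℝ Y w v) z u = fderiv ℝ (fderiv ℝ Y) z u v := by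
    intro u v
    rw [fderiv_clm_apply hd (differentiableAt_const v)]
    simp
  have hsymm : fderiv ℝ (fderiv ℝ Y) z 1 Complex.I = fderiv ℝ (fderiv ℝ Y) z Complex.I 1 :=
    hY.isSymmSndFDerivAt (by simp) 1 Complex.I
  have e1 : ∀ u, fderiv ℝ (fun w => lorentz (fderiv ℝ Y w 1) (fderiv ℝ Y w 1)) z u
      = fderiv ℝ (fun w => lorentz (fderiv ℝ Y w Complex.I) (fderiv ℝ Y w Complex.I)) z u :=
    fun u => DFunLike.congr_fun (EventuallyEq.fderiv_eq (𝕜 := ℝ) h1) u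
  have e2 : ∀ u, fderiv ℝ (fun w => lorentz (fderiv ℝ Y w 1) (fderiv ℝ Y w Complex.I)) z u = 0 :=
    fun u => by
      have : (fun w => lorentz (fderiv ℝ Y w 1) (fderiv ℝ Y w Complex.I)) =ᶠ[𝓝 z] fun _ => 0 := h2
      rw [this.fderiv_eq]; simp
  simp only [fderiv_lorentz (hdv _) (hdv _), hval] at e1 e2
  have a1 := e1 1
  have a2 := e1 Complex.I
  have a3 := e2 1
  have a4 := e2 Complex.I
  have hv : fderiv ℝ Y z v = v.re • fderiv ℝ Y z 1 + v.im • fderiv ℝ Y z Complex.I := by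
    rw [← map_smul, ← map_smul, ← map_add]
    congr 1
    simp
  rw [hv]
  rw [hsymm] at a1 a3
  simp only [map_add, LinearMap.add_apply, map_smul, smul_eq_mul]
  simp only [lorentz_comm (fderiv ℝ Y z _)] at a1 a2 a3 a4
  linear_combination (v.re / 2) * a1 + v.re * a4 - (v.im / 2) * a2 + v.im * a3

theorem inducedMetric_of_conformal {Y : ℂ → L3} {z : ℂ}
    (h1 : inducedMetric Y z 1 1 = inducedMetric Y z Complex.I Complex.I)
    (h2 : inducedMetric Y z 1 Complex.I = 0) (v : ℂ) :
    inducedMetric Y z v v = Complex.normSq v * inducedMetric Y z 1 1 := by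
  have hv : fderiv ℝ Y z v = v.re • fderiv ℝ Y z 1 + v.im • fderiv ℝ Y z Complex.I := by
    rw [← map_smul, ← map_smul, ← map_add]
    congr 1
    simp
  simp only [inducedMetric] at *
  rw [hv, Complex.normSq_apply]
  simp only [map_add, LinearMap.add_apply, map_smul, smul_eq_mul, LinearMap.smul_apply]
  rw [lorentz_comm (fderiv ℝ Y z Complex.I) (fderiv ℝ Y z 1), h2, ← h1]
  ring

theorem fderiv_fderiv_comp_apply {X : ℂ → L3} {h : ℂ → ℂ} {z : ℂ} (hX : ContDiffAt ℝ 2 X (h z))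
    (hh : ContDiffAt ℝ 2 h z) (v : ℂ) :
    fderiv ℝ (fderiv ℝ (X ∘ h)) z v v
      = fderiv ℝ (fderiv ℝ X) (h z) (fderiv ℝ h z v) (fderiv ℝ h z v)
        + fderiv ℝ X (h z) (fderiv ℝ (fderiv ℝ h) z v v) := by
  have hev : fderiv ℝ (X ∘ h) =ᶠ[𝓝 z] fun w => (fderiv ℝ X (h w)).comp (fderiv ℝ h w) := by
    filter_upwards [hh.eventually (by simp), hh.continuousAt.eventually (hX.eventually (by simp))]
      with w hw hw'
    exact fderiv_comp w (hw'.differentiableAt (by norm_num)) (hw.differentiableAt (by norm_num))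
  have hdX : DifferentiableAt ℝ (fderiv ℝ X) (h z) :=
    (hX.fderiv_right (m := 1) (by norm_num)).differentiableAt (by norm_num)
  have hdh : DifferentiableAt ℝ (fderiv ℝ h) z :=
    (hh.fderiv_right (m := 1) (by norm_num)).differentiableAt (by norm_num)
  have hd : DifferentiableAt ℝ h z := hh.differentiableAt (by norm_num)
  have h1 : HasFDerivAt (fun w => (fderiv ℝ X (h w)).comp (fderiv ℝ h w)) _ z :=
    ((hdX.hasFDerivAt).comp z hd.hasFDerivAt).clm_comp hdh.hasFDerivAt
  rw [hev.fderiv_eq, h1.fderiv]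
  simp [add_comm]

/-- A maximal immersion in conformal coordinates is harmonic: the mean curvature is the normal
component of the Laplacian, up to a factor. -/
theorem IsSpecialSingularity.laplacian_eq_zero {X : ℂ → L3} {D : Set ℂ} {q : ℂ} {r : ℝ}
    {h : ℂ → ℂ} (hX : IsSpecialSingularity X D q r h) (hD : IsOpen D) {z : ℂ}
    (hz : z ∈ openAnnulus r 1) : ContDiffAt ℝ 2 (X ∘ h) z ∧
    fderiv ℝ (fderiv ℝ (X ∘ h)) z 1 1 + fderiv ℝ (fderiv ℝ (X ∘ h)) z Complex.I Complex.I = 0 := by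
  have hop := (isOpen_openAnnulus r 1).mem_nhds hz
  have hmem := hX.reparam.bijOn.mapsTo hz
  have hcX : ContDiffAt ℝ 2 X (h z) :=
    (hX.maximal.smooth.contDiffAt ((hD.sdiff isClosed_singleton).mem_nhds hmem)).of_le (by norm_cast)
  have hch : ContDiffAt ℝ 2 h z :=
    (hX.reparam.smooth.contDiffAt hop).of_le (by norm_cast)
  have hY : ContDiffAt ℝ 2 (X ∘ h) z := hcX.comp z hch
  refine ⟨hY, ?_⟩
  have hchain : fderiv ℝ (X ∘ h) z = (fderiv ℝ X (h z)).comp (fderiv ℝ h z) :=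
    fderiv_comp z (hcX.differentiableAt (by norm_num)) (hch.differentiableAt (by norm_num))
  have htan := lorentz_fderiv_fderiv_eq_zero hY
    (by filter_upwards [hop] with w hw using hX.reparam.isometric w hw)
    (by filter_upwards [hop] with w hw using hX.reparam.orthogonal w hw)
  have hpos := hX.reparam.pos z hz
  have hiso := hX.reparam.isometric z hz
  have hort := hX.reparam.orthogonal z hz
  have hmet := inducedMetric_of_conformal hiso hort
  have hinj : Function.Injective (fderiv ℝ h z : ℂ →ₗ[ℝ] ℂ) := by
    rw [← LinearMap.ker_eq_bot, LinearMap.ker_eq_bot']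
    intro v hv
    have hv : fderiv ℝ h z v = 0 := hv
    have h1 := hmet v
    rw [inducedMetric, hchain] at h1
    simp only [ContinuousLinearMap.comp_apply, hv, map_zero] at h1
    rcases mul_eq_zero.1 h1.symm with h2 | h2
    · exact Complex.normSq_eq_zero.1 h2
    · exact absurd h2 hpos.ne'
  have hsurj : Function.Surjective (fderiv ℝ h z : ℂ →ₗ[ℝ] ℂ) :=
    LinearMap.injective_iff_surjective.1 hinj
  -- the images of `l` and `l I` form an orthonormal basis of the tangent plane
  set l : ℝ := (Real.sqrt (inducedMetric (X ∘ h) z 1 1))⁻¹ with hl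
  have hl2 : l * l * inducedMetric (X ∘ h) z 1 1 = 1 := by
    rw [hl, ← mul_inv, Real.mul_self_sqrt hpos.le, inv_mul_cancel₀ hpos.ne']
  have hl0 : l ≠ 0 := by rintro h0; simp [h0] at hl2
  obtain ⟨ν, hF⟩ := exists_lorentzFrame (e₁ := fderiv ℝ (X ∘ h) z (l • 1))
    (e₂ := fderiv ℝ (X ∘ h) z (l • Complex.I))
    (by
      rw [← inducedMetric.eq_1, hmet]
      simpa [Complex.normSq_apply] using hl2)
    (by
      rw [← inducedMetric.eq_1, hmet]
      simpa [Complex.normSq_apply] using hl2)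
    (by
      rw [map_smul, map_smul, map_smul, map_smul, LinearMap.smul_apply]
      rw [inducedMetric] at hort
      rw [hort]; simp)
  have hnu : ∀ v, lorentz (fderiv ℝ X (h z) v) ν = 0 := by
    intro v
    obtain ⟨w, rfl⟩ := hsurj v
    have hw : w = (w.re / l) • (l • (1 : ℂ)) + (w.im / l) • (l • Complex.I) := by
      rw [smul_smul, smul_smul, div_mul_cancel₀ _ hl0, div_mul_cancel₀ _ hl0]
      simp
    have : lorentz (fderiv ℝ (X ∘ h) z w) ν = 0 := by
      have h1 := hF.inner_1ν
      have h2 := hF.inner_2ν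
      rw [hw]
      simp only [map_add, map_smul, LinearMap.add_apply, LinearMap.smul_apply, smul_eq_mul] at h1 h2 ⊢
      linear_combination (w.re / l) * h1 + (w.im / l) * h2
    rwa [hchain] at this
  have hind : ∀ u v, inducedMetric X (h z) (fderiv ℝ h z u) (fderiv ℝ h z v)
      = inducedMetric (X ∘ h) z u v := fun u v => by
    rw [inducedMetric, inducedMetric, hchain]; rfl
  have hmean := hX.maximal.meanCurvature_eq_zero (h z) hmem ν hnu
    (fderiv ℝ h z (l • 1)) (fderiv ℝ h z (l • Complex.I))
    (by rw [hind]; exact hF.inner_11) (by rw [hind]; exact hF.inner_22)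
    (by rw [hind]; exact hF.inner_12)
  -- the Laplacian has no tangential components by conformality; by the chain rule its normal component
  -- is that of the second derivative of `X` in an orthonormal basis, which is the mean curvature
  refine hF.ext_of_inner (htan _) (htan _) ?_
  rw [fderiv_fderiv_comp_apply hcX hch, fderiv_fderiv_comp_apply hcX hch]
  simp only [map_smul, smul_apply, map_add, LinearMap.add_apply, LinearMap.smul_apply,
    smul_eq_mul, hnu, add_zero] at hmean ⊢
  have hll : l * l ≠ 0 := mul_ne_zero hl0 hl0
  refine mul_left_cancel₀ hll ?_
  linear_combination hmean

theorem IsSpecialSingularity.harmonicAt {X : ℂ → L3} {D : Set ℂ} {q : ℂ} {r : ℝ}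
    {h : ℂ → ℂ} (hX : IsSpecialSingularity X D q r h) (hD : IsOpen D) {z : ℂ}
    (hz : z ∈ openAnnulus r 1) (j : Fin 3) :
    InnerProductSpace.HarmonicAt (fun w => X (h w) j) z := by
  have h1 : InnerProductSpace.HarmonicAt (X ∘ h) z := by
    refine ⟨(hX.laplacian_eq_zero hD hz).1, ?_⟩
    filter_upwards [(isOpen_openAnnulus r 1).mem_nhds hz] with w hw
    rw [InnerProductSpace.laplacian_eq_iteratedFDeriv_complexPlane]
    simp only [iteratedFDeriv_two_apply]
    simpa using (hX.laplacian_eq_zero hD hw).2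
  exact InnerProductSpace.HarmonicAt.comp_CLM h1 (ContinuousLinearMap.proj j)

/-! ### The holomorphic forms of the extended immersion -/

section Extension

open InnerProductSpace

variable {Y : ℂ → L3} {p₀ : L3} {r : ℝ}

theorem schwarzExtension_exp_axisReflection (hY : ∀ z : ℂ, ‖z‖ = 1 → Y z = p₀) (j : Fin 3) (w : ℂ) :
    schwarzExtension Y p₀ (Complex.exp (axisReflection w)) j - p₀ j
      = -(schwarzExtension Y p₀ (Complex.exp w) j - p₀ j) := by
  rw [exp_axisReflection, schwarzExtension_inversion hY (Complex.exp_ne_zero w)]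
  simp
  ring

theorem continuousOn_schwarzExtension_exp (hr : 0 < r) (hY : ∀ z : ℂ, ‖z‖ = 1 → Y z = p₀)
    (hYc : ContinuousOn Y (outerClosedAnnulus r)) (j : Fin 3) :
    ContinuousOn (fun w => schwarzExtension Y p₀ (Complex.exp w) j - p₀ j)
      (strip (-Real.log r)) := by
  set S : ℂ → ℝ := fun w => schwarzExtension Y p₀ (Complex.exp w) j - p₀ j with hS
  have hleft : ContinuousOn S (strip (-Real.log r) ∩ {w | w.re ≤ 0}) := by
    have hmaps : MapsTo Complex.exp (strip (-Real.log r) ∩ {w | w.re ≤ 0})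
        (outerClosedAnnulus r) := fun w hw =>
      ⟨((exp_mem_openAnnulus_iff hr).2 hw.1).1, by
        rw [Complex.norm_exp]; exact Real.exp_le_one_iff.2 hw.2⟩
    have h1 : ContinuousOn (fun w => Y (Complex.exp w)) (strip (-Real.log r) ∩ {w | w.re ≤ 0}) :=
      hYc.comp Complex.continuous_exp.continuousOn hmaps
    have h2 : ContinuousOn (fun w => Y (Complex.exp w) j - p₀ j)
        (strip (-Real.log r) ∩ {w | w.re ≤ 0}) :=
      ((continuous_apply j).comp_continuousOn h1).sub continuousOn_const
    refine h2.congr fun w hw => ?_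
    simp only [hS, schwarzExtension_of_le Y p₀ (hmaps hw).2]
  have hright : ContinuousOn S (strip (-Real.log r) ∩ {w | 0 ≤ w.re}) := by
    have h1 : ContinuousOn (fun w => -S (axisReflection w))
        (strip (-Real.log r) ∩ {w | 0 ≤ w.re}) :=
      (hleft.comp continuous_axisReflection.continuousOn fun w hw =>
        ⟨axisReflection_mem_strip hw.1, by simpa using hw.2⟩).neg
    refine h1.congr fun w _ => ?_
    simp only [hS]
    rw [schwarzExtension_exp_axisReflection hY, neg_neg]
  have hunion : strip (-Real.log r) = strip (-Real.log r) ∩ {w | w.re ≤ 0} ∪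
      strip (-Real.log r) ∩ {w | 0 ≤ w.re} := by
    rw [← inter_union_distrib_left]
    refine (inter_eq_left.2 fun w _ => ?_).symm
    exact le_total w.re 0
  intro w hw
  rw [hunion, continuousWithinAt_union]
  refine ⟨?_, ?_⟩
  · by_cases h : w.re ≤ 0
    · exact hleft w ⟨hw, h⟩
    · refine continuousWithinAt_of_notMem_closure fun hcl => h ?_
      exact closure_minimal inter_subset_right (isClosed_le Complex.continuous_re continuous_const)
        hcl
  · by_cases h : 0 ≤ w.re
    · exact hright w ⟨hw, h⟩
    · refine continuousWithinAt_of_notMem_closure fun hcl => h ?_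
      exact closure_minimal inter_subset_right (isClosed_le continuous_const Complex.continuous_re)
        hcl

/-- On the strip, the extended immersion is harmonic by the reflection principle, applied in a disc
centred at a point of the axis. -/
theorem harmonicAt_schwarzExtension_exp (hr : 0 < r) (hY : ∀ z : ℂ, ‖z‖ = 1 → Y z = p₀)
    (hYc : ContinuousOn Y (outerClosedAnnulus r)) (j : Fin 3)
    (hH : ∀ z ∈ openAnnulus r 1, HarmonicAt (fun w => Y w j) z) {w : ℂ}
    (hw : w ∈ strip (-Real.log r)) :
    HarmonicAt (fun w => schwarzExtension Y p₀ (Complex.exp w) j - p₀ j) w := by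
  set S : ℂ → ℝ := fun w => schwarzExtension Y p₀ (Complex.exp w) j - p₀ j with hS
  have hw' : |w.re| < -Real.log r := hw
  obtain ⟨R, hR1, hR2⟩ := exists_between hw'
  have hR : 0 < R := (abs_nonneg _).trans_lt hR1
  have hRc : (R : ℂ) ≠ 0 := by exact_mod_cast hR.ne'
  set τ : ℂ → ℂ := fun ζ => w.im * Complex.I + R * ζ with hτ
  have hτre : ∀ ζ, (τ ζ).re = R * ζ.re := fun ζ => by simp [hτ]
  have hτstrip : ∀ ζ ∈ closedBall (0 : ℂ) 1, τ ζ ∈ strip (-Real.log r) := fun ζ hζ => by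
    show |(τ ζ).re| < _
    rw [hτre, abs_mul, abs_of_pos hR]
    have : |ζ.re| ≤ 1 := (Complex.abs_re_le_norm ζ).trans (by simpa using hζ)
    nlinarith
  have hτc : Continuous τ := by fun_prop
  have hu : ContinuousOn (S ∘ τ) (closedBall 0 1) :=
    (continuousOn_schwarzExtension_exp hr hY hYc j).comp hτc.continuousOn hτstrip
  have hodd : ∀ ζ, (S ∘ τ) (axisReflection ζ) = -(S ∘ τ) ζ := fun ζ => by
    have : τ (axisReflection ζ) = axisReflection (τ ζ) := by
      simp [hτ, axisReflection, add_comm]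
    simp only [Function.comp_apply, this, hS]
    exact schwarzExtension_exp_axisReflection hY j _
  have hharm : ∀ ζ ∈ ball (0 : ℂ) 1, ζ.re < 0 → HarmonicAt (S ∘ τ) ζ := by
    intro ζ hζ hneg
    have hmem := (exp_mem_openAnnulus_iff hr).2 (hτstrip ζ (ball_subset_closedBall hζ))
    have hre : (τ ζ).re < 0 := by rw [hτre]; exact mul_neg_of_pos_of_neg hR hneg
    have hmem' : Complex.exp (τ ζ) ∈ openAnnulus r 1 :=
      ⟨hmem.1, by rw [Complex.norm_exp]; exact Real.exp_lt_one_iff.2 hre⟩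
    have hinner : HarmonicAt (fun v => schwarzExtension Y p₀ v j - p₀ j) (Complex.exp (τ ζ)) := by
      refine (harmonicAt_congr_nhds ?_).2
        (HarmonicAt.sub (hH _ hmem') (harmonicAt_const (p₀ j)))
      filter_upwards [(isOpen_openAnnulus r 1).mem_nhds hmem'] with v hv
      rw [schwarzExtension_of_le Y p₀ hv.2.le]
      rfl
    exact HarmonicAt.comp_analyticAt (f := fun ζ => Complex.exp (τ ζ)) hinner (by fun_prop)
  have hall := harmonicOnNhd_of_odd hu hodd hharm
  have hζ : (w.re : ℂ) / R ∈ ball (0 : ℂ) 1 := by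
    rw [mem_ball_zero_iff, norm_div, Complex.norm_real, Complex.norm_real, Real.norm_eq_abs,
      Real.norm_eq_abs, abs_of_pos hR, div_lt_one hR]
    exact hR1
  have hσ : ∀ v : ℂ, τ ((v - w.im * Complex.I) / R) = v := fun v => by
    simp only [hτ]
    field_simp
    ring
  have hpt : (w - w.im * Complex.I) / R = (w.re : ℂ) / R := by
    congr 1
    apply Complex.ext <;> simp
  have h := HarmonicAt.comp_analyticAt (u := S ∘ τ) (f := fun v => (v - w.im * Complex.I) / R)
    (z := w) (by rw [hpt]; exact hall _ hζ) (by fun_prop (disch := exact hRc))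
  refine (harmonicAt_congr_nhds (Eventually.of_forall fun v => ?_)).2 h
  simp only [Function.comp_apply, hσ]

/-- Off the origin, `z` is the exponential of a holomorphic function, which reduces the claim to the
strip. -/
theorem harmonicAt_schwarzExtension (hr : 0 < r) (hY : ∀ z : ℂ, ‖z‖ = 1 → Y z = p₀)
    (hYc : ContinuousOn Y (outerClosedAnnulus r)) (j : Fin 3)
    (hH : ∀ z ∈ openAnnulus r 1, HarmonicAt (fun w => Y w j) z) {z : ℂ}
    (hz : z ∈ openAnnulus r (1 / r)) :
    HarmonicAt (fun w => schwarzExtension Y p₀ w j) z := by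
  have hz0 : z ≠ 0 := norm_pos_iff.1 (hr.trans hz.1)
  set f : ℂ → ℂ := fun v => Complex.log z + Complex.log (v / z) with hf
  have hexp : ∀ᶠ v in 𝓝 z, Complex.exp (f v) = v := by
    filter_upwards [isOpen_ne.mem_nhds hz0] with v hv
    rw [hf, Complex.exp_add, Complex.exp_log hz0, Complex.exp_log (div_ne_zero hv hz0),
      mul_div_cancel₀ _ hz0]
  have hfz : f z ∈ strip (-Real.log r) := by
    rw [← exp_mem_openAnnulus_iff hr, hexp.self_of_nhds]
    exact hz
  have han : AnalyticAt ℂ f z := by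
    refine analyticAt_const.add (AnalyticAt.clog (by fun_prop (disch := exact hz0)) ?_)
    rw [div_self hz0]
    exact Complex.one_mem_slitPlane
  have h1 := HarmonicAt.comp_analyticAt (harmonicAt_schwarzExtension_exp hr hY hYc j hH hfz) han
  refine (harmonicAt_congr_nhds ?_).2 (HarmonicAt.add h1 (harmonicAt_const (p₀ j)))
  filter_upwards [hexp] with v hv
  simp [hv]

theorem InnerProductSpace.HarmonicAt.hasFDerivAt_re {u : ℂ → ℝ} {z : ℂ} (hu : HarmonicAt u z) :
    HasFDerivAt u (Complex.reCLM.comp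
      ((fderiv ℝ u z 1 - Complex.I * fderiv ℝ u z Complex.I : ℂ) •
        ContinuousLinearMap.id ℝ ℂ)) z := by
  refine (hu.1.differentiableAt (by norm_num)).hasFDerivAt.congr_fderiv ?_
  ext v
  have hv : v = v.re • (1 : ℂ) + v.im • Complex.I := by simp
  conv_lhs => rw [hv, map_add, map_smul, map_smul]
  simp [mul_comm]

end Extension

/-! ### Existence of the Weierstrass data -/

section Existence

open InnerProductSpace

variable {Y : ℂ → L3} {p₀ : L3} {r : ℝ} {φ : Fin 3 → ℂ → ℂ}

/-- As the surface is constant on the unit circle, `z φⱼ` is real there. -/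
theorem im_mul_eq_zero_of_norm_eq_one (hY : ∀ z : ℂ, ‖z‖ = 1 → Y z = p₀) {j : Fin 3} {z a : ℂ}
    (hz : ‖z‖ = 1) (hd : HasFDerivAt (fun w => schwarzExtension Y p₀ w j)
      (Complex.reCLM.comp (a • ContinuousLinearMap.id ℝ ℂ)) z) : (z * a).im = 0 := by
  have hcurve : HasDerivAt (fun t : ℝ => z * Complex.exp (t * Complex.I)) (z * Complex.I) 0 := by
    have h1 : HasDerivAt (fun t : ℝ => (t : ℂ) * Complex.I) Complex.I 0 := by
      simpa using (Complex.ofRealCLM.hasDerivAt (x := (0 : ℝ))).mul_const Complex.I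
    simpa using h1.cexp.const_mul z
  have hd' : HasFDerivAt (fun w => schwarzExtension Y p₀ w j)
      (Complex.reCLM.comp (a • ContinuousLinearMap.id ℝ ℂ))
      (z * Complex.exp ((0 : ℝ) * Complex.I)) := by simpa using hd
  have h1 := hd'.comp_hasDerivAt (0 : ℝ) hcurve
  have h2 : HasDerivAt ((fun w => schwarzExtension Y p₀ w j) ∘
      fun t : ℝ => z * Complex.exp (t * Complex.I)) 0 0 := by
    refine (hasDerivAt_const (0 : ℝ) (p₀ j)).congr_of_eventuallyEq
      (Eventually.of_forall fun t => ?_)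
    have hn : ‖z * Complex.exp (t * Complex.I)‖ = 1 := by
      rw [norm_mul, hz, Complex.norm_exp_ofReal_mul_I, one_mul]
    simp only [Function.comp_apply]
    rw [schwarzExtension_of_le Y p₀ hn.le, hY _ hn]
  have h3 := h1.unique h2
  simp at h3 ⊢
  linarith

/-- The last of the forms does not vanish identically: otherwise `φ₁² + φ₂² = 0`, and the first two
forms would vanish on the unit circle, where they are real multiples of `dz / z`. -/
theorem exists_ne_zero_of_null (hr : 0 < r) (hr1 : r < 1)
    (hY : ∀ z : ℂ, ‖z‖ = 1 → Y z = p₀)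
    (hhol : ∀ j, AnalyticOnNhd ℂ (φ j) (openAnnulus r (1 / r)))
    (hd : ∀ j, ∀ z ∈ openAnnulus r (1 / r), HasFDerivAt (fun w => schwarzExtension Y p₀ w j)
      (Complex.reCLM.comp (φ j z • ContinuousLinearMap.id ℝ ℂ)) z)
    (hnull : ∀ z ∈ openAnnulus r (1 / r), φ 0 z ^ 2 + φ 1 z ^ 2 = φ 2 z ^ 2)
    (hne : ∃ j, ∃ z ∈ openAnnulus r (1 / r), φ j z ≠ 0) :
    ∃ z ∈ openAnnulus r (1 / r), φ 2 z ≠ 0 := by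
  by_contra! h2
  have hpre : IsPreconnected (openAnnulus r (1 / r)) := isPreconnected_openAnnulus hr (by positivity)
  have hcirc : ∀ z : ℂ, ‖z‖ = 1 → z ∈ openAnnulus r (1 / r) := fun z hz => by
    refine ⟨hz ▸ hr1, ?_⟩
    rw [hz, one_div]
    exact (one_lt_inv₀ hr).2 hr1
  have hzero : ∀ z : ℂ, ‖z‖ = 1 → φ 0 z = 0 ∧ φ 1 z = 0 := by
    intro z hz
    have hz0 : z ≠ 0 := by rintro rfl; simp at hz
    have i0 := im_mul_eq_zero_of_norm_eq_one hY hz (hd 0 z (hcirc z hz))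
    have i1 := im_mul_eq_zero_of_norm_eq_one hY hz (hd 1 z (hcirc z hz))
    have hs : (z * φ 0 z) ^ 2 + (z * φ 1 z) ^ 2 = 0 := by
      have := hnull z (hcirc z hz)
      rw [h2 z (hcirc z hz)] at this
      linear_combination z ^ 2 * this
    have hre := congrArg Complex.re hs
    simp only [sq, Complex.add_re, Complex.mul_re (z * φ 0 z), Complex.mul_re (z * φ 1 z), i0, i1,
      mul_zero, sub_zero, Complex.zero_re] at hre
    have r0 : (z * φ 0 z).re = 0 := by nlinarith [sq_nonneg (z * φ 0 z).re, sq_nonneg (z * φ 1 z).re]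
    have r1 : (z * φ 1 z).re = 0 := by nlinarith [sq_nonneg (z * φ 0 z).re, sq_nonneg (z * φ 1 z).re]
    exact ⟨(mul_eq_zero.1 (Complex.ext r0 i0)).resolve_left hz0,
      (mul_eq_zero.1 (Complex.ext r1 i1)).resolve_left hz0⟩
  have hacc : Tendsto (fun t : ℝ => Complex.exp (t * Complex.I)) (𝓝[≠] 0) (𝓝[≠] 1) := by
    have h1 : HasDerivAt (fun t : ℝ => (t : ℂ) * Complex.I) Complex.I 0 := by
      simpa using (Complex.ofRealCLM.hasDerivAt (x := (0 : ℝ))).mul_const Complex.I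
    simpa using h1.cexp.tendsto_nhdsNE (by simp)
  have hfreq : ∀ j : Fin 3, (∀ z : ℂ, ‖z‖ = 1 → φ j z = 0) → EqOn (φ j) 0 (openAnnulus r (1 / r)) :=
    fun j hj => (hhol j).eqOn_zero_of_preconnected_of_frequently_eq_zero hpre
      (hcirc 1 norm_one) (hacc.frequently (Eventually.frequently (Eventually.of_forall fun t =>
        hj _ (Complex.norm_exp_ofReal_mul_I t))))
  obtain ⟨j, z, hz, hjz⟩ := hne
  fin_cases j
  · exact hjz (hfreq 0 (fun z hz => (hzero z hz).1) hz)
  · exact hjz (hfreq 1 (fun z hz => (hzero z hz).2) hz)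
  · exact hjz (h2 z hz)

/-- The Gauss map of a null triple of holomorphic forms. -/
theorem exists_gaussMap_of_null {A : Set ℂ} (hA : IsPreconnected A)
    (hhol : ∀ j, AnalyticOnNhd ℂ (φ j) A)
    (hnull : ∀ z ∈ A, φ 0 z ^ 2 + φ 1 z ^ 2 = φ 2 z ^ 2) (hne : ∃ z ∈ A, φ 2 z ≠ 0) :
    ∃ g : ℂ → ℂ, MeromorphicNFOn g A ∧ ∀ᶠ z in codiscreteWithin A, g z ≠ 0 ∧
      φ 0 z = Complex.I / 2 * φ 2 z * (1 / g z - g z) ∧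
      φ 1 z = -(1 / 2) * φ 2 z * (1 / g z + g z) := by
  set g₀ : ℂ → ℂ := fun z => (Complex.I * φ 0 z - φ 1 z) / φ 2 z with hg₀
  have hmer : MeromorphicOn g₀ A := fun z hz =>
    ((analyticAt_const.mul (hhol 0 z hz)).sub (hhol 1 z hz)).meromorphicAt.div
      (hhol 2 z hz).meromorphicAt
  have hφ : ∀ᶠ z in codiscreteWithin A, φ 2 z ≠ 0 := by
    rcases (hhol 2).eqOn_zero_or_eventually_ne_zero_of_preconnected hA with h | h
    · obtain ⟨z, hz, h2⟩ := hne
      exact absurd (h hz) h2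
    · exact h
  refine ⟨toMeromorphicNFOn g₀ A, meromorphicNFOn_toMeromorphicNFOn _ _, ?_⟩
  filter_upwards [hφ, toMeromorphicNFOn_eqOn_codiscrete hmer, self_mem_codiscreteWithin A]
    with z h2 hg hz
  rw [← hg]
  have hn := hnull z hz
  have hprod : (Complex.I * φ 0 z - φ 1 z) * (-Complex.I * φ 0 z - φ 1 z) = φ 2 z ^ 2 := by
    linear_combination hn - φ 0 z ^ 2 * Complex.I_sq
  -- the product of the two factors is `φ₃²`, so neither vanishes here
  have hN : Complex.I * φ 0 z - φ 1 z ≠ 0 := fun h0 => by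
    rw [h0, zero_mul] at hprod
    exact h2 (pow_eq_zero_iff (two_ne_zero) |>.1 hprod.symm)
  have hinv : 1 / g₀ z = (-Complex.I * φ 0 z - φ 1 z) / φ 2 z := by
    rw [hg₀, one_div_div, div_eq_div_iff hN h2]
    linear_combination -hprod
  refine ⟨div_ne_zero hN h2, ?_, ?_⟩
  · rw [hinv, hg₀]
    field_simp
    linear_combination (2 * φ 0 z) * Complex.I_sq
  · rw [hinv, hg₀]
    field_simp
    ring

/-- A conformal harmonic immersion that is constant on the unit circle has Weierstrass data. -/
theorem exists_isWeierstrassData (hr : 0 < r) (hr1 : r < 1) (hY : ∀ z : ℂ, ‖z‖ = 1 → Y z = p₀)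
    (hYc : ContinuousOn Y (outerClosedAnnulus r))
    (hH : ∀ z ∈ openAnnulus r 1, ∀ j, HarmonicAt (fun w => Y w j) z)
    (hpos : ∀ z ∈ openAnnulus r 1, 0 < inducedMetric Y z 1 1)
    (hiso : ∀ z ∈ openAnnulus r 1, inducedMetric Y z 1 1 = inducedMetric Y z Complex.I Complex.I)
    (hort : ∀ z ∈ openAnnulus r 1, inducedMetric Y z 1 Complex.I = 0) :
    ∃ (g : ℂ → ℂ) (φ : Fin 3 → ℂ → ℂ), IsWeierstrassData Y p₀ r g φ := by
  have hrr : (1 : ℝ) < 1 / r := by rw [one_div]; exact (one_lt_inv₀ hr).2 hr1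
  have hsub : openAnnulus r 1 ⊆ openAnnulus r (1 / r) := fun z hz => ⟨hz.1, hz.2.trans hrr⟩
  have hop := isOpen_openAnnulus r (1 / r)
  have hpre : IsPreconnected (openAnnulus r (1 / r)) := isPreconnected_openAnnulus hr (by positivity)
  have hS : ∀ j, ∀ z ∈ openAnnulus r (1 / r), HarmonicAt (fun w => schwarzExtension Y p₀ w j) z :=
    fun j z hz => harmonicAt_schwarzExtension hr hY hYc j (fun z hz => hH z hz j) hz
  set φ : Fin 3 → ℂ → ℂ := fun j z => fderiv ℝ (fun w => schwarzExtension Y p₀ w j) z 1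
    - Complex.I * fderiv ℝ (fun w => schwarzExtension Y p₀ w j) z Complex.I with hφ
  have hhol : ∀ j, AnalyticOnNhd ℂ (φ j) (openAnnulus r (1 / r)) := fun j z hz =>
    HarmonicAt.analyticAt_complex_partial (hS j z hz)
  have hd : ∀ j, ∀ z ∈ openAnnulus r (1 / r), HasFDerivAt (fun w => schwarzExtension Y p₀ w j)
      (Complex.reCLM.comp (φ j z • ContinuousLinearMap.id ℝ ℂ)) z := fun j z hz =>
    (hS j z hz).hasFDerivAt_re
  have hval : ∀ z ∈ openAnnulus r 1, ∀ j, φ j z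
      = fderiv ℝ Y z 1 j - Complex.I * fderiv ℝ Y z Complex.I j := by
    intro z hz j
    have hYd : HasFDerivAt Y (fderiv ℝ Y z) z :=
      (differentiableAt_pi.2 fun j => (hH z hz j).1.differentiableAt (by norm_num)).hasFDerivAt
    have h1 := hasFDerivAt_pi'.1 hYd j
    have hev : (fun w => schwarzExtension Y p₀ w j) =ᶠ[𝓝 z] fun w => Y w j := by
      filter_upwards [(isOpen_openAnnulus r 1).mem_nhds hz] with w hw
      rw [schwarzExtension_of_le Y p₀ hw.2.le]
    simp only [hφ]
    rw [hev.fderiv_eq, h1.fderiv]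
    rfl
  have hmem : (((r + 1) / 2 : ℝ) : ℂ) ∈ openAnnulus r 1 := by
    have : ‖(((r + 1) / 2 : ℝ) : ℂ)‖ = (r + 1) / 2 := by
      rw [Complex.norm_real, Real.norm_eq_abs, abs_of_pos (by linarith)]
    exact ⟨by rw [this]; linarith, by rw [this]; linarith⟩
  have hnull : ∀ z ∈ openAnnulus r (1 / r), φ 0 z ^ 2 + φ 1 z ^ 2 = φ 2 z ^ 2 := by
    refine AnalyticOnNhd.eqOn_of_preconnected_of_eventuallyEq
      (((hhol 0).pow 2).add ((hhol 1).pow 2)) ((hhol 2).pow 2) hpre (hsub hmem) ?_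
    filter_upwards [(isOpen_openAnnulus r 1).mem_nhds hmem] with z hz
    have h1 := hiso z hz
    have h2 := hort z hz
    simp only [inducedMetric, lorentz_apply] at h1 h2
    simp only [hval z hz]
    apply Complex.ext
    · simp [sq]
      linarith
    · simp [sq]
      linarith
  obtain ⟨z₂, hz₂, hne⟩ := exists_ne_zero_of_null hr hr1 hY hhol hd hnull (by
    by_contra! hall
    have h1 := hpos _ hmem
    have h2 : ∀ j, fderiv ℝ Y _ 1 j = 0 := fun j => by
      have h3 := congrArg Complex.re ((hval _ hmem j).symm.trans (hall j _ (hsub hmem)))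
      simpa using h3
    simp [inducedMetric, lorentz_apply, h2] at h1)
  obtain ⟨g, hg, hrel⟩ := exists_gaussMap_of_null hpre hhol hnull ⟨z₂, hz₂, hne⟩
  exact ⟨g, φ, fun j => (hhol j).differentiableOn, hd, hg, hrel⟩

end Existence

end

theorem lemma2p1 (c : ℂ) (R : ℝ) (X : ℂ → L3) (q : ℂ) (r : ℝ) (h : ℂ → ℂ)
    (hX : IsSpecialSingularity X (ball c R) q r h)
    (P : AffineSubspace ℝ L3) (hP : IsSpacelikePlane P) (hqP : X q ∈ P) :
    (∃ (g : ℂ → ℂ) (φ : Fin 3 → ℂ → ℂ), IsWeierstrassData (X ∘ h) (X q) r g φ) ∧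
    ∀ (g : ℂ → ℂ) (φ : Fin 3 → ℂ → ℂ), IsWeierstrassData (X ∘ h) (X q) r g φ →
      ∃ (d : ℤ) (m k : ℕ), HasCircleDegree g d ∧ m = d.natAbs ∧ circleZeroCount (φ 2) = 2 * k ∧
        (∃ s₀ : ℝ, 0 < s₀ ∧ ∀ s : ℝ, 0 < s → s ≤ s₀ →
          IsCoveringOfDegree (lorentzProj P hP (X q) ∘ X ∘ h)
            (connectedComponentIn
              {z ∈ outerClosedAnnulus r |
                lorentzProj P hP (X q) (X (h z)) ∈ planeDisc P (X q) s} 1 \ sphere 0 1)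
            (planeDisc P (X q) s \ {X q})
            (m + k)) ∧
        ((∃ r₀ : ℝ, r ≤ r₀ ∧ r₀ < 1 ∧ IsEmbedding ((openAnnulus r₀ 1).domRestrict (X ∘ h))) ↔
          (InjOn g (sphere 0 1) ∧ ∀ z ∈ sphere (0 : ℂ) 1, φ 2 z ≠ 0)) ∧
        ((InjOn g (sphere 0 1) ∧ ∀ z ∈ sphere (0 : ℂ) 1, φ 2 z ≠ 0) ↔ (m = 1 ∧ k = 0)) ∧
        (m = 1 ∧ k = 0 →
          ∃ r₀ : ℝ, r ≤ r₀ ∧ r₀ < 1 ∧ IsEmbedding ((openAnnulus r₀ 1).domRestrict (X ∘ h)) ∧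
            IsConelikeGraph P (X q) ((X ∘ h) '' outerClosedAnnulus r₀)) := by
  exact ⟨exists_isWeierstrassData hX.r_pos hX.r_lt_one hX.comp_eq hX.continuousOn_comp
      (fun z hz j => hX.harmonicAt isOpen_ball hz j) hX.reparam.pos hX.reparam.isometric
      hX.reparam.orthogonal,
    fun g φ W => W.local_structure hX.r_pos hX.r_lt_one hX.comp_eq hX.continuousOn_comp
      hX.reparam.pos hP hqP⟩
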